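/- Work in synthetic differential geometry, interpreted in a cartesian closed category $\mathcal C$ with finite limits (for example any topos). "Element of $A$" means generalized element $Y\to A$ at an arbitrary stage $Y$; a map $S\times Y\to M$ is an element of $M^S$ at stage $Y$. Let $k$ be a field of characteristic $0$ and let $R$ be a commutative $k$-algebra object of $\mathcal C$ satisfying the general Kock–Lawvere axiom: for every Weil algebra $W$ over $k$ (finite-dimensional commutative, with an augmentation to $k$ with nil kernel) the canonical map $R\otimes_k W\to R^{\operatorname{Spec}_R W}$ is an isomorphism, where $\operatorname{Spec}_R W$ is the object whose elements at stage $Y$ are the $k$-algebra homomorphisms $W\to \mathcal C(Y,R)$. Let $M$ be a microlinear object: whenever a Weil algebra is the limit, in commutative $k$-algebras, of a finite diagram of Weil algebras, the functor $M^{\operatorname{Spec}_R(-)}$ preserves this limit. Put $D=\{d\in R: d^2=0\}$, $D(n)=\{(d_1,\dots,d_n)\in D^n : d_id_j=0 \text{ for all } i,j\}$, $D^2\vee D=\{(d_1,d_2,e)\in D^3: d_1e=d_2e=0\}$. A tangent vector is an element of $M^D$. The sum of tangent vectors $t_1,\dots,t_n$ ($n\ge1$) with the same base point is $d\mapsto l(d,\dots,d)$,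 where $l\in M^{D(n)}$ is the map that restricts to $t_i$ on the $i$-th axis for each $i$; $(ct)(d)=t(cd)$. For $\gamma_1,\gamma_2\in M^{D^2}$ that agree on $D(2)$, the strong difference $\gamma_1\overset{\cdot}{-}\gamma_2\in M^D$ is $e\mapsto m(0,0,e)$, where $m\in M^{D^2\vee D}$ satisfies $m(d_1,d_2,d_1d_2)=\gamma_1(d_1,d_2)$ and $m(d_1,d_2,0)=\gamma_2(d_1,d_2)$. For $n\ge 0$ and $\gamma\in M^{D^n}$ put $(\alpha\cdot_i\gamma)(d_1,\dots,d_n)=\gamma(d_1,\dots,\alpha d_i,\dots,d_n)$ and $\gamma^\sigma(d_1,\dots,d_n)=\gamma(d_{\sigma(1)},\dots,d_{\sigma(n)})$. A tangent-vector-valued differential $n$-form on $M$ is a mapping $K:D\to M^{M^{D^n}}$, $d\mapsto K_d$, with $K_0(\gamma)=\gamma(0,\dots,0)$, $K_d(\alpha\cdot_i\gamma)=K_{\alpha d}(\gamma)$ for $\alpha\in R$ and $1\le i\le n$, and $K_d(\gamma^\sigma)=K_{\varepsilon_\sigma d}(\gamma)$ for $\sigma\in\mathbb S_n$, where $\varepsilon_\sigma$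 is the sign of $\sigma$. Such mappings are elements of $(M^{M^{D^n}})^D$ at an arbitrary stage $X$; sums, scalar multiples and strong differences of mappings into $M^{M^{D^n}}$ are formed pointwise in $\gamma$, and $0$ denotes the form $d\mapsto(\gamma\mapsto\gamma(0,\dots,0))$. For a $p$-form $K$ and a $q$-form $L$ define mappings $D^2\to M^{M^{D^{p+q}}}$ by $$(L*K)(d_1,d_2)(\gamma)=L_{d_2}\bigl(e\in D^q\mapsto K_{d_1}(d\in D^p\mapsto\gamma(d_1,\dots,d_p,e_1,\dots,e_q))\bigr),$$ $$(K\,\tilde *\,L)(d_1,d_2)(\gamma)=K_{d_1}\bigl(e\in D^p\mapsto L_{d_2}(d\in D^q\mapsto\gamma(e_1,\dots,e_p,d_1,\dots,d_q))\bigr)$$ (the components of the tuples $d,e$ being named independently of the parameters $d_1,d_2$ of the mappings), and put $$\lfloor K,L\rfloor=L*K\overset{\cdot}{-}K\,\tilde *\,L,\qquad \lceil K,L\rceil_d(\gamma)=\Bigl(\frac1{p!\,q!}\sum_{\sigma\in\mathbb S_{p+q}}\varepsilon_\sigma\,\lfloor K,L\rfloor(\gamma^\sigma)\Bigr)(d),$$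 where $\lfloor K,L\rfloor(\gamma)$ is the tangent vector $d\mapsto\lfloor K,L\rfloor_d(\gamma)$. Theorem. (0) The strong difference and the sum in this definition exist and are unique, and $\lceil K,L\rceil$ (the Frölicher–Nijenhuis bracket) is a tangent-vector-valued differential $(p+q)$-form on $M$. (1) For every $p$-form $K$ and every $q$-form $L$, $\lceil K,L\rceil=-(-1)^{pq}\lceil L,K\rceil$. (2) For every $p$-form $K_1$, $q$-form $K_2$ and $r$-form $K_3$, $$\lceil K_1,\lceil K_2,K_3\rceil\rceil+(-1)^{p(q+r)}\lceil K_2,\lceil K_3,K_1\rceil\rceil+(-1)^{r(p+q)}\lceil K_3,\lceil K_1,K_2\rceil\rceil=0.$$ -/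

import Mathlib

/-! Synthetic differential geometry, in an arbitrary cartesian closed category `C` with finite
limits (for instance any topos), read through generalized elements: a morphism `Y ⟶ A` is an
element of `A` at stage `Y`, and a morphism `S ⊗ Y ⟶ M` is an element of `M ^ S` at stage `Y`. -/

open CategoryTheory Limits MonoidalCategory CartesianMonoidalCategory
open scoped CommRingObj RingObj Nat

universe w v u

namespace SDG

noncomputable section

section Ring

variable {C : Type u} [Category.{v} C] [CartesianMonoidalCategory C] [BraidedCategory C]

/-- The structure of a `k`-algebra object on a commutative ring object `R`: a homomorphism from `k`
to the ring of global elements of `R`. -/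
class AlgObj (k : Type w) [Field k] (R : C) [CommRingObj R] where
  scalars : k →+* (𝟙_ C ⟶ R)

/-- Change of stage along `f : Y ⟶ Z`, for the elements of `R`. -/
def restrictRingHom (R : C) [CommRingObj R] {Y Z : C} (f : Y ⟶ Z) : (Z ⟶ R) →+* (Y ⟶ R) :=
  ((yonedaCommRingObj R).map f.op).hom

theorem restrictRingHom_apply (R : C) [CommRingObj R] {Y Z : C} (f : Y ⟶ Z) (a : Z ⟶ R) :
    restrictRingHom R f a = f ≫ a := rfl

/-- The elements of `R` at any stage form a `k`-algebra. -/
instance algebraHom (k : Type w) [Field k] (R : C) [CommRingObj R] [AlgObj k R] (Y : C) :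
    Algebra k (Y ⟶ R) :=
  ((restrictRingHom R (toUnit Y)).comp (AlgObj.scalars (k := k) (R := R))).toAlgebra

/-- Change of stage is a homomorphism of `k`-algebras. -/
def restrict (k : Type w) [Field k] (R : C) [CommRingObj R] [AlgObj k R] {Y Z : C} (f : Y ⟶ Z) :
    (Z ⟶ R) →ₐ[k] (Y ⟶ R) where
  __ := restrictRingHom R f
  commutes' c := by
    change f ≫ (toUnit Z ≫ AlgObj.scalars c) = toUnit Y ≫ AlgObj.scalars c
    rw [← Category.assoc]
    congr 1
    exact toUnit_unique _ _

/-! ### Weil algebras, the Kock-Lawvere axiom, microlinear objects -/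

/-- A Weil algebra over the field `k`: a finite-dimensional commutative algebra with an augmentation
to `k` whose kernel consists of nilpotent elements. -/
def IsWeil (k : Type w) [Field k] (W : Type w) [CommRing W] [Algebra k W] : Prop :=
  Module.Finite k W ∧ ∃ ε : W →ₐ[k] k, ∀ a, ε a = 0 → IsNilpotent a

/-- `χ` exhibits `S` as the infinitesimal object `Spec_R W`: the elements of `S` at a stage `Y`
correspond to the homomorphisms of `k`-algebras from `W` to the elements of `R` at the stage `Y`,
and `χ` is the generic one. As `C` has finite limits, every Weil algebra has such a spectrum. -/
def IsSpec {k : Type w} [Field k] {R : C} [CommRingObj R] [AlgObj k R]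
    {W : Type w} [CommRing W] [Algebra k W] {S : C} (χ : W →ₐ[k] (S ⟶ R)) : Prop :=
  ∀ (Y : C) (ψ : W →ₐ[k] (Y ⟶ R)), ∃! s : Y ⟶ S, ∀ a : W, s ≫ χ a = ψ a

/-- The element of `Spec_R W` that corresponds to a homomorphism. -/
def IsSpec.elem {k : Type w} [Field k] {R : C} [CommRingObj R] [AlgObj k R]
    {W : Type w} [CommRing W] [Algebra k W] {S : C} {χ : W →ₐ[k] (S ⟶ R)} (h : IsSpec χ)
    {Y : C} (ψ : W →ₐ[k] (Y ⟶ R)) : Y ⟶ S :=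
  (h Y ψ).choose

/-- The general Kock-Lawvere axiom: for every Weil algebra `W` over `k`, the canonical map
`W ⊗ R ⟶ R ^ (Spec_R W)` is an isomorphism; that is, at each stage `Y`, each
`f : Spec_R W ⊗ Y ⟶ R` comes from a unique element of `W ⊗ R(Y)`. -/
def KockLawvere (k : Type w) [Field k] (R : C) [CommRingObj R] [AlgObj k R] : Prop :=
  ∀ (W : Type w) [CommRing W] [Algebra k W], IsWeil k W →
    ∀ (S : C) (χ : W →ₐ[k] (S ⟶ R)), IsSpec χ →
      ∀ Y : C, Function.Bijective
        (Algebra.TensorProduct.productMap ((restrict k R (fst S Y)).comp χ)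
          (restrict k R (snd S Y)))

/-- `M` is microlinear: whenever a Weil algebra is the limit of a finite diagram of Weil algebras,
`M ^ (-)` takes the spectra of this diagram to a limit diagram. In elements at a stage `Y`: every
compatible family `g j : Spec_R (F j) ⊗ Y ⟶ M` comes from a unique `f : Spec_R (lim F) ⊗ Y ⟶ M`. -/
def Microlinear (k : Type w) [Field k] (R : C) [CommRingObj R] [AlgObj k R] (M : C) : Prop :=
  ∀ (J : Type) [SmallCategory J] [FinCategory J] (F : J ⥤ CommAlgCat.{w} k) (c : Cone F),
    Nonempty (IsLimit c) → IsWeil k c.pt → (∀ j, IsWeil k (F.obj j)) →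
    ∀ (S : J → C) (χ : ∀ j, F.obj j →ₐ[k] (S j ⟶ R)) (hχ : ∀ j, IsSpec (χ j))
      (T : C) (θ : c.pt →ₐ[k] (T ⟶ R)) (hθ : IsSpec θ)
      (Y : C) (g : ∀ j, S j ⊗ Y ⟶ M),
      (∀ (i j : J) (a : i ⟶ j), (hχ i).elem ((χ j).comp (F.map a).hom) ▷ Y ≫ g i = g j) →
      ∃! f : T ⊗ Y ⟶ M, ∀ j, hθ.elem ((χ j).comp (c.π.app j).hom) ▷ Y ≫ f = g j

/-! ### The infinitesimal objects `D`, `D ^ n`, `D(ι)`, `D² ∨ D` -/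

theorem comp_mul' {R Y Z : C} [CommRingObj R] (f : Y ⟶ Z) (a b : Z ⟶ R) :
    f ≫ (a * b) = (f ≫ a) * (f ≫ b) :=
  map_mul (restrictRingHom R f) a b

theorem comp_zero' {R Y Z : C} [CommRingObj R] (f : Y ⟶ Z) : f ≫ (0 : Z ⟶ R) = 0 :=
  map_zero (restrictRingHom R f)

variable [HasFiniteLimits C] (R : C) [CommRingObj R]

/-- `D = {d ∈ R | d² = 0}`. -/
def D : C := equalizer (𝟙 R * 𝟙 R) (0 : R ⟶ R)

/-- The inclusion of `D` in `R`. -/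
def incl : D R ⟶ R := equalizer.ι (𝟙 R * 𝟙 R) (0 : R ⟶ R)

variable {R}

/-- The element of `D` given by an element of `R` of square zero. -/
def mkD {Y : C} (a : Y ⟶ R) (h : a * a = 0) : Y ⟶ D R :=
  equalizer.lift a (by
    change restrictRingHom R a (𝟙 R * 𝟙 R) = restrictRingHom R a 0
    rw [map_mul, map_zero]
    change (a ≫ 𝟙 R) * (a ≫ 𝟙 R) = 0
    rw [Category.comp_id, h])

@[simp] theorem mkD_incl {Y : C} (a : Y ⟶ R) (h : a * a = 0) : mkD a h ≫ incl R = a :=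
  equalizer.lift_ι _ _

theorem sq_zero {Y : C} (d : Y ⟶ D R) : (d ≫ incl R) * (d ≫ incl R) = 0 := by
  rw [← comp_mul']
  have h : incl R * incl R = 0 := by
    have e : incl R ≫ (𝟙 R * 𝟙 R) = incl R ≫ (0 : R ⟶ R) := equalizer.condition _ _
    rwa [comp_mul', comp_zero', Category.comp_id] at e
  rw [h, comp_zero']

variable (R) in
/-- The element `0` of `D`. -/
def zeroD (Y : C) : Y ⟶ D R := mkD 0 (by simp)

/-- `a d` for `a ∈ R` and `d ∈ D`. -/
def smulD {Y : C} (a : Y ⟶ R) (d : Y ⟶ D R) : Y ⟶ D R :=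
  mkD (a * (d ≫ incl R)) (by rw [mul_mul_mul_comm, sq_zero, mul_zero])

/-- `c d` for a constant `c ∈ k` and `d ∈ D`. -/
def constSmulD {k : Type w} [Field k] [AlgObj k R] {Y : C} (c : k) (d : Y ⟶ D R) : Y ⟶ D R :=
  smulD (algebraMap k (Y ⟶ R) c) d

variable (R) in
/-- The power `D ^ n`. -/
abbrev Dpow (n : ℕ) : C := ∏ᶜ fun _ : Fin n => D R

/-- The element `(d_1, …, d_n)` of `D ^ n`. -/
def tuple {n : ℕ} {Y : C} (d : Fin n → (Y ⟶ D R)) : Y ⟶ Dpow R n := Pi.lift d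

/-- The `i`-th component of an element of `D ^ n`. -/
def comp {n : ℕ} {Y : C} (d : Y ⟶ Dpow R n) (i : Fin n) : Y ⟶ D R :=
  d ≫ Pi.π (fun _ : Fin n => D R) i

/-- The element `(d_1, …, d_m, e_1, …, e_n)` of `D ^ (m + n)`. -/
def append {m n : ℕ} {Y : C} (d : Y ⟶ Dpow R m) (e : Y ⟶ Dpow R n) : Y ⟶ Dpow R (m + n) :=
  tuple (Fin.append (comp d) (comp e))

variable (R) in
/-- `(d_1, …, d_n) ↦ (d_{σ(1)}, …, d_{σ(m)})`. -/
def powMap {m n : ℕ} (σ : Fin m → Fin n) : Dpow R n ⟶ Dpow R m :=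
  tuple fun i => comp (𝟙 _) (σ i)

variable (R) in
/-- `D(ι)`: the families `(d_i)` of elements of `D` indexed by the finite type `ι` with
`d_i d_j = 0` for all `i` and `j`. For `ι` with two elements this is `D(2)`. -/
def Dfirst (ι : Type) [Finite ι] : C :=
  equalizer
    (Pi.lift fun ij : ι × ι => (Pi.π (fun _ : ι => D R) ij.1 ≫ incl R) *
      (Pi.π (fun _ : ι => D R) ij.2 ≫ incl R))
    (Pi.lift fun _ : ι × ι => (0 : (∏ᶜ fun _ : ι => D R) ⟶ R))

/-- The element of `D(ι)` given by a family of elements of `D`. -/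
def mkDfirst {ι : Type} [Finite ι] {Y : C} (d : ι → (Y ⟶ D R))
    (h : ∀ i j, (d i ≫ incl R) * (d j ≫ incl R) = 0) : Y ⟶ Dfirst R ι :=
  equalizer.lift (Pi.lift d) (by
    apply Pi.hom_ext
    rintro ⟨i, j⟩
    simp only [Category.assoc, limit.lift_π, Fan.mk_π_app]
    rw [comp_mul', comp_zero', ← Category.assoc, ← Category.assoc]
    simpa using h i j)

variable (R) in
open Classical in
/-- The `i`-th axis `d ↦ (0, …, d, …, 0)` of `D(ι)`. -/
def axis {ι : Type} [Finite ι] (i : ι) : D R ⟶ Dfirst R ι :=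
  mkDfirst (fun j => if j = i then 𝟙 (D R) else zeroD R (D R)) (by
    intro j l
    by_cases hj : j = i
    · by_cases hl : l = i
      · rw [if_pos hj, if_pos hl]; exact sq_zero _
      · rw [if_neg hl, zeroD, mkD_incl, mul_zero]
    · rw [if_neg hj, zeroD, mkD_incl, zero_mul])

variable (R) in
/-- The diagonal `d ↦ (d, …, d)` of `D(ι)`. -/
def diagonal (ι : Type) [Finite ι] : D R ⟶ Dfirst R ι :=
  mkDfirst (fun _ => 𝟙 (D R)) fun _ _ => sq_zero _

variable (R) in
/-- `D² ∨ D = {(d_1, d_2, e) ∈ D³ | d_1 e = d_2 e = 0}`. -/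
def Wedge : C :=
  equalizer
    (lift ((fst (D R ⊗ D R) (D R) ≫ fst (D R) (D R) ≫ incl R) * (snd (D R ⊗ D R) (D R) ≫ incl R))
      ((fst (D R ⊗ D R) (D R) ≫ snd (D R) (D R) ≫ incl R) * (snd (D R ⊗ D R) (D R) ≫ incl R)))
    (lift (0 : (D R ⊗ D R) ⊗ D R ⟶ R) (0 : (D R ⊗ D R) ⊗ D R ⟶ R))

/-- The element `(d_1, d_2, e)` of `D² ∨ D`. -/
def mkWedge {Y : C} (d₁ d₂ e : Y ⟶ D R) (h₁ : (d₁ ≫ incl R) * (e ≫ incl R) = 0)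
    (h₂ : (d₂ ≫ incl R) * (e ≫ incl R) = 0) : Y ⟶ Wedge R :=
  equalizer.lift (lift (lift d₁ d₂) e) (by
    rw [comp_lift, comp_lift]
    congr 1
    · rw [comp_mul', comp_zero']; simpa using h₁
    · rw [comp_mul', comp_zero']; simpa using h₂)

variable (R) in
/-- `(d_1, d_2) ↦ (d_1, d_2, 0)`. -/
def wedgeZero : D R ⊗ D R ⟶ Wedge R :=
  mkWedge (fst _ _) (snd _ _) (zeroD R _)
    (by rw [zeroD, mkD_incl, mul_zero]) (by rw [zeroD, mkD_incl, mul_zero])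

variable (R) in
/-- `(d_1, d_2) ↦ (d_1, d_2, d_1 d_2)`. -/
def wedgeMul : D R ⊗ D R ⟶ Wedge R :=
  mkWedge (fst _ _) (snd _ _) (smulD (fst _ _ ≫ incl R) (snd _ _))
    (by rw [smulD, mkD_incl, ← mul_assoc, sq_zero, zero_mul])
    (by rw [smulD, mkD_incl, mul_left_comm, sq_zero, mul_zero])

variable (R) in
/-- `e ↦ (0, 0, e)`. -/
def wedgeAxis : D R ⟶ Wedge R :=
  mkWedge (zeroD R _) (zeroD R _) (𝟙 _)
    (by rw [zeroD, mkD_incl, zero_mul]) (by rw [zeroD, mkD_incl, zero_mul])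

/-! ### Tangent vectors at a stage `Z`: morphisms `D ⊗ Z ⟶ M` -/

variable {M Z : C}

/-- The multiple `c t` of a tangent vector: `(c t)(d) = t(c d)`, for `c ∈ k`. -/
def tanSmul {k : Type w} [Field k] [AlgObj k R] (c : k) (t : D R ⊗ Z ⟶ M) : D R ⊗ Z ⟶ M :=
  constSmulD c (𝟙 (D R)) ▷ Z ≫ t

/-- `s` is the sum of the finite family `t` of tangent vectors (at the same point): there is `l`
defined on `D(ι)` with `l(0, …, d, …, 0) = t i d` and `l(d, …, d) = s d`. -/
def IsTanSum {ι : Type} [Finite ι] (t : ι → (D R ⊗ Z ⟶ M)) (s : D R ⊗ Z ⟶ M) : Prop :=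
  ∃ l : Dfirst R ι ⊗ Z ⟶ M, (∀ i, axis R i ▷ Z ≫ l = t i) ∧ diagonal R ι ▷ Z ≫ l = s

open Classical in
/-- The sum of a finite family of tangent vectors (if they do not have the same base point, then an
irrelevant tangent vector). -/
def tanSum {ι : Type} [Finite ι] [Nonempty ι] (t : ι → (D R ⊗ Z ⟶ M)) : D R ⊗ Z ⟶ M :=
  if h : ∃ s, IsTanSum t s then h.choose else t (Classical.arbitrary ι)

/-- `t` is the strong difference of the microsquares `γ₁` and `γ₂` (in this order): there is `m`
defined on `D² ∨ D` with `m(d_1, d_2, d_1 d_2) = γ₁(d_1, d_2)`, `m(d_1, d_2, 0) = γ₂(d_1, d_2)`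
and `m(0, 0, e) = t(e)`. -/
def IsStrongDiff (γ₁ γ₂ : (D R ⊗ D R) ⊗ Z ⟶ M) (t : D R ⊗ Z ⟶ M) : Prop :=
  ∃ m : Wedge R ⊗ Z ⟶ M,
    wedgeMul R ▷ Z ≫ m = γ₁ ∧ wedgeZero R ▷ Z ≫ m = γ₂ ∧ wedgeAxis R ▷ Z ≫ m = t

open Classical in
/-- The strong difference of `γ₁` and `γ₂` (if they do not agree on `D(2)`, then an irrelevant
tangent vector). -/
def strongDiff (γ₁ γ₂ : (D R ⊗ D R) ⊗ Z ⟶ M) : D R ⊗ Z ⟶ M :=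
  if h : ∃ t, IsStrongDiff γ₁ γ₂ t then h.choose else lift (𝟙 (D R)) (zeroD R (D R)) ▷ Z ≫ γ₁

/-! ### Operations on `n`-microcubes at a stage `Y`: morphisms `D ^ n ⊗ Y ⟶ M` -/

/-- `γ^σ (d_1, …, d_n) = γ (d_{σ(1)}, …, d_{σ(m)})`. -/
def permCube {m n : ℕ} (σ : Fin m → Fin n) {Y : C} (γ : Dpow R m ⊗ Y ⟶ M) : Dpow R n ⊗ Y ⟶ M :=
  powMap R σ ▷ Y ≫ γ

/-- `(α ·_i γ) (d_1, …, d_n) = γ (d_1, …, α d_i, …, d_n)`, for `α ∈ R`. -/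
def scaleCube {n : ℕ} {Y : C} (α : Y ⟶ R) (i : Fin n) (γ : Dpow R n ⊗ Y ⟶ M) :
    Dpow R n ⊗ Y ⟶ M :=
  lift (tuple (Function.update (comp (fst (Dpow R n) Y)) i
    (smulD (snd (Dpow R n) Y ≫ α) (comp (fst (Dpow R n) Y) i)))) (snd (Dpow R n) Y) ≫ γ

/-- `γ (0, …, 0)`. -/
def baseCube {n : ℕ} {Y : C} (γ : Dpow R n ⊗ Y ⟶ M) : Y ⟶ M :=
  lift (tuple fun _ => zeroD R Y) (𝟙 Y) ≫ γ

end Ring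

section Forms

variable {C : Type u} [Category.{v} C] [CartesianMonoidalCategory C] [BraidedCategory C]
  [MonoidalClosed C] [HasFiniteLimits C] {R : C} [CommRingObj R] {M X : C}

variable (R M) in
/-- The object `M ^ (D ^ n)` of `n`-microcubes on `M`. -/
abbrev Cubes (n : ℕ) : C := (ihom (Dpow R n)).obj M

variable (R M X) in
/-- The elements at stage `X` of `(M ^ (M ^ (D ^ n))) ^ D`, that is, the mappings
`D ⟶ M ^ (M ^ (D ^ n))` parametrized by `X`. They are the same as the tangent vectors of `M` at the
stage `X ⊗ M ^ (D ^ n)`, and this is how they are added and multiplied by scalars. -/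
abbrev VMap (n : ℕ) : Type v := D R ⊗ (X ⊗ Cubes R M n) ⟶ M

/-- `K_d(γ)`, at any stage `Y`. -/
def VMap.eval {n : ℕ} (K : VMap R M X n) {Y : C} (x : Y ⟶ X) (d : Y ⟶ D R)
    (γ : Dpow R n ⊗ Y ⟶ M) : Y ⟶ M :=
  lift d (lift x (MonoidalClosed.curry γ)) ≫ K

/-- `K` is a tangent-vector-valued differential `n`-form on `M`, at stage `X`: `K_0(γ)` is the base
point of `γ`, and `K` is `n`-homogeneous and alternating. -/
structure IsForm (k : Type w) [Field k] [AlgObj k R] {n : ℕ} (K : VMap R M X n) : Prop where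
  base : ∀ (Y : C) (x : Y ⟶ X) (γ : Dpow R n ⊗ Y ⟶ M), K.eval x (zeroD R Y) γ = baseCube γ
  homogeneous : ∀ (Y : C) (x : Y ⟶ X) (d : Y ⟶ D R) (α : Y ⟶ R) (γ : Dpow R n ⊗ Y ⟶ M)
    (i : Fin n), K.eval x d (scaleCube α i γ) = K.eval x (smulD α d) γ
  alternating : ∀ (Y : C) (x : Y ⟶ X) (d : Y ⟶ D R) (γ : Dpow R n ⊗ Y ⟶ M)
    (σ : Equiv.Perm (Fin n)), K.eval x d (permCube σ γ) =
      K.eval x (constSmulD (((Equiv.Perm.sign σ : ℤˣ) : ℤ) : k) d) γ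

variable (R M X) in
/-- The zero form, `(d, γ) ↦ γ(0, …, 0)`. -/
def zeroForm (n : ℕ) : VMap R M X n :=
  baseCube (MonoidalClosed.uncurry (snd (D R) (X ⊗ Cubes R M n) ≫ snd X (Cubes R M n)))

/-- `φ ↦ φ^σ`, where `φ^σ (γ) = φ (γ^σ)`, on the values of `K`. -/
def VMap.perm {n : ℕ} (σ : Equiv.Perm (Fin n)) (K : VMap R M X n) : VMap R M X n :=
  D R ◁ X ◁ (MonoidalClosed.pre (powMap R σ)).app M ≫ K

/-- `(L_{d_2} ∗ K_{d_1})(γ) =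
L_{d_2} (e ∈ D ^ q ↦ K_{d_1} (d ∈ D ^ p ↦ γ(d_1, …, d_p, e_1, …, e_q)))`, at any stage `Y`. -/
def convAt {p q : ℕ} (L : VMap R M X q) (K : VMap R M X p) {Y : C} (x : Y ⟶ X)
    (d₁ d₂ : Y ⟶ D R) (γ : Dpow R (p + q) ⊗ Y ⟶ M) : Y ⟶ M :=
  L.eval x d₂
    (K.eval (snd (Dpow R q) Y ≫ x) (snd (Dpow R q) Y ≫ d₁)
      (lift
        (append (fst (Dpow R p) (Dpow R q ⊗ Y))
          (snd (Dpow R p) (Dpow R q ⊗ Y) ≫ fst (Dpow R q) Y))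
        (snd (Dpow R p) (Dpow R q ⊗ Y) ≫ snd (Dpow R q) Y) ≫ γ))

/-- `L ∗ K`, the mapping `(d_1, d_2) ↦ L_{d_2} ∗ K_{d_1}` from `D²` to `M ^ (M ^ (D ^ (p + q)))`. -/
def conv {p q : ℕ} (L : VMap R M X q) (K : VMap R M X p) :
    (D R ⊗ D R) ⊗ (X ⊗ Cubes R M (p + q)) ⟶ M :=
  convAt L K (snd _ _ ≫ fst _ _) (fst _ _ ≫ fst _ _) (fst _ _ ≫ snd _ _)
    (MonoidalClosed.uncurry (snd _ _ ≫ snd _ _))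

/-- The mapping `(d_1, d_2) ↦ ((K ∗ L)(d_2, d_1))^σ`, with `σ` the interchange of the block of the
first `p` and the block of the last `q` arguments, so that its value at `(d_1, d_2)` and `γ` is
`K_{d_1} (e ∈ D ^ p ↦ L_{d_2} (d ∈ D ^ q ↦ γ(e_1, …, e_p, d_1, …, d_q)))`. -/
def convTilde {p q : ℕ} (K : VMap R M X p) (L : VMap R M X q) :
    (D R ⊗ D R) ⊗ (X ⊗ Cubes R M (p + q)) ⟶ M :=
  convAt K L (snd _ _ ≫ fst _ _) (fst _ _ ≫ snd _ _) (fst _ _ ≫ fst _ _)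
    (permCube finAddFlip (MonoidalClosed.uncurry (snd _ _ ≫ snd _ _)))

/-- `⌊K, L⌋`, the strong difference of `L ∗ K` and `convTilde K L`. -/
def floorBracket {p q : ℕ} (K : VMap R M X p) (L : VMap R M X q) : VMap R M X (p + q) :=
  strongDiff (conv L K) (convTilde K L)

/-- The terms `ε_σ K^σ` of the alternation of `K`. -/
def altTerm (k : Type w) [Field k] [AlgObj k R] {n : ℕ} (K : VMap R M X n)
    (σ : Equiv.Perm (Fin n)) : VMap R M X n :=
  tanSmul (((Equiv.Perm.sign σ : ℤˣ) : ℤ) : k) (K.perm σ)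

/-- The alternation: the sum of `ε_σ K^σ` over all permutations `σ`. -/
def alternate (k : Type w) [Field k] [AlgObj k R] {n : ℕ} (K : VMap R M X n) : VMap R M X n :=
  tanSum (altTerm k K)

/-- The Frölicher-Nijenhuis bracket `⌈K, L⌉`, which is `1 / (p! q!)` times the alternation of
`⌊K, L⌋`. -/
def fnBracket (k : Type w) [Field k] [AlgObj k R] {p q : ℕ} (K : VMap R M X p)
    (L : VMap R M X q) : VMap R M X (p + q) :=
  tanSmul ((p ! * q ! : k)⁻¹) (alternate k (floorBracket K L))

/-- Transport along an equality of degrees. -/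
def VMap.recast {m n : ℕ} (h : m = n) (K : VMap R M X m) : VMap R M X n := h ▸ K

end Forms

end

end SDG

set_option linter.unusedSectionVars false


/-! Fix a stage and a base point. By microlinearity `W ↦ M^(Spec W)` preserves finite limits of Weil
algebras, so it behaves like a pro-representable functor. Fibre products over `k` merge finitely
many elements with one base point into a single `u` over one Weil algebra `A`, and passing to
equalizers shrinks `A` until `u` is `Faithful`: homomorphisms with the same effect on `u` are equal
(`exists_generic`). Equations in `M` thus become equations between homomorphisms out of `A`, and a
map on `D(n)` or `D² ∨ D` with prescribed restrictions is obtained by assembling such homomorphisms.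
Since `D`, `D²`, `D³`, `D(n)` and `D² ∨ D` are spectra of explicit algebras, everything is settled
by comparing coefficients.

In this way the tangent vectors at a point form a `k`-module, and the strong difference of two
squares has as its linear coefficient the difference of their coefficients of `ε₁ε₂`. So it is
linear in one coordinate of the squares (`eq_sum_of_isStrongDiff`), changes sign under the
interchange of squares and coordinates (`eq_neg_of_isStrongDiff`), and satisfies a general Jacobi
identity for six cubes in which the coefficients of `ε₁ε₂ε₃` telescope
(`sum_eq_zero_of_isStrongDiff`).

A mapping `K` with `K_0(γ) = γ(0)` is a tangent vector of `M` at the stage `X ⊗ M^(D^n)` with a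
fixed base point, so these results apply to it. A function `ρ : Fin N → Fin p ⊕ Fin q` records which
argument of a cube goes to which form; permutations then act by composing index functions. `L ∗ K`
and `K ∗~ L` agree on the axes of `D²` because a form at parameter `0` evaluates the cube at `0`.
Triple convolutions depend only on the order of nesting, which feeds the six-cube identity and gives
`floor_jacobi` before any alternation.

Alternation turns interchanges of blocks into the signs `(-1)^(pq)`, which gives antisymmetry. In an
iterated bracket the inner alternation is absorbed by the outer one, since `floor` is linear and
equivariant in its second argument; this produces a factor `(q+r)!` that cancels in characteristic
`0` (`fn_fn`). Alternating `floor_jacobi` then gives the Jacobi identity. Homogeneity of the bracket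
holds because scaling one argument of the cube scales one coordinate of `D²`, and hence the strong
difference. -/

namespace SDG

noncomputable section

/-! ### Closure properties of Weil algebras. -/

section Weil

variable {k : Type w} [Field k]

theorem IsWeil.self : IsWeil k k :=
  ⟨inferInstance, AlgHom.id k k, fun a (h : a = 0) => h ▸ IsNilpotent.zero⟩

theorem IsWeil.subalgebra {W : Type w} [CommRing W] [Algebra k W] (h : IsWeil k W)
    (S : Subalgebra k W) : IsWeil k S := by
  obtain ⟨hf, ε, hε⟩ := h
  refine ⟨FiniteDimensional.finiteDimensional_subalgebra S, ε.comp S.val, fun a ha => ?_⟩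
  obtain ⟨n, hn⟩ := hε a ha
  exact ⟨n, Subtype.ext (by simpa using hn)⟩

/-- The element `a - ε(a)` is nilpotent, and `k` is reduced, so every homomorphism to `k` kills it.
-/
theorem IsWeil.augmentation_unique {W : Type w} [CommRing W] [Algebra k W] (h : IsWeil k W)
    (f g : W →ₐ[k] k) : f = g := by
  obtain ⟨hf, ε, hε⟩ := h
  have key : ∀ f : W →ₐ[k] k, f = ε := by
    intro f
    ext a
    have h0 : ε (a - algebraMap k W (ε a)) = 0 := by simp
    have h1 := (hε _ h0).map f
    have h2 : f a - ε a = 0 := by simpa using h1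
    exact sub_eq_zero.mp h2
  rw [key f, key g]

/-- By uniqueness `f` and `g` are the augmentations, so both components of an element of the kernel
are nilpotent, and the sum of their exponents kills the pair. -/
theorem IsWeil.pullback {A B : Type w} [CommRing A] [Algebra k A] [CommRing B] [Algebra k B]
    (hA : IsWeil k A) (hB : IsWeil k B) (f : A →ₐ[k] k) (g : B →ₐ[k] k) :
    IsWeil k (AlgHom.equalizer (f.comp (AlgHom.fst k A B)) (g.comp (AlgHom.snd k A B))) := by
  obtain ⟨hfA, α, hα⟩ := id hA
  obtain ⟨hfB, β, hβ⟩ := id hB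
  obtain rfl := hA.augmentation_unique α f
  obtain rfl := hB.augmentation_unique β g
  refine ⟨FiniteDimensional.finiteDimensional_subalgebra _,
    (α.comp (AlgHom.fst k A B)).comp (Subalgebra.val _), fun a ha => ?_⟩
  have h1 : α a.1.1 = 0 := ha
  have h2 : β a.1.2 = 0 := by
    have h3 : α a.1.1 = β a.1.2 := a.2
    rw [← h3, h1]
  obtain ⟨m, hm⟩ := hα _ h1
  obtain ⟨n, hn⟩ := hβ _ h2
  refine ⟨m + n, Subtype.ext (Prod.ext ?_ ?_)⟩
  · simp [pow_add, hm]
  · simp [pow_add, hn]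

end Weil

/-! ### Existence and functoriality of spectra. -/

section Spectra

variable {C : Type u} [Category.{v} C] [CartesianMonoidalCategory C] [BraidedCategory C]

theorem IsSpec.elem_spec {k : Type w} [Field k] {R : C} [CommRingObj R] [AlgObj k R]
    {W : Type w} [CommRing W] [Algebra k W] {S : C} {χ : W →ₐ[k] (S ⟶ R)} (h : IsSpec χ)
    {Y : C} (ψ : W →ₐ[k] (Y ⟶ R)) (a : W) : h.elem ψ ≫ χ a = ψ a :=
  (h Y ψ).choose_spec.1 a

theorem IsSpec.hom_ext {k : Type w} [Field k] {R : C} [CommRingObj R] [AlgObj k R]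
    {W : Type w} [CommRing W] [Algebra k W] {S : C} {χ : W →ₐ[k] (S ⟶ R)} (h : IsSpec χ)
    {Y : C} {s t : Y ⟶ S} (hst : ∀ a, s ≫ χ a = t ≫ χ a) : s = t :=
  (h Y ((restrict k R t).comp χ)).unique hst fun _ => rfl

theorem restrict_apply (k : Type w) [Field k] (R : C) [CommRingObj R] [AlgObj k R] {Y Z : C}
    (f : Y ⟶ Z) (a : Z ⟶ R) : restrict k R f a = f ≫ a := rfl

theorem comp_add' {R Y Z : C} [CommRingObj R] (f : Y ⟶ Z) (a b : Z ⟶ R) :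
    f ≫ (a + b) = f ≫ a + f ≫ b :=
  map_add (restrictRingHom R f) a b

theorem comp_one' {R Y Z : C} [CommRingObj R] (f : Y ⟶ Z) : f ≫ (1 : Z ⟶ R) = 1 :=
  map_one (restrictRingHom R f)

theorem comp_algebraMap (k : Type w) [Field k] (R : C) [CommRingObj R] [AlgObj k R] {Y Z : C}
    (f : Y ⟶ Z) (c : k) : f ≫ algebraMap k (Z ⟶ R) c = algebraMap k (Y ⟶ R) c :=
  (restrict k R f).commutes c

theorem comp_smul' (k : Type w) [Field k] (R : C) [CommRingObj R] [AlgObj k R] {Y Z : C}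
    (f : Y ⟶ Z) (c : k) (a : Z ⟶ R) : f ≫ (c • a) = c • (f ≫ a) :=
  map_smul (restrict k R f) c a

theorem comp_sum' {R Y Z : C} [CommRingObj R] {ι : Type*} (s : Finset ι) (f : Y ⟶ Z)
    (a : ι → (Z ⟶ R)) : f ≫ (∑ i ∈ s, a i) = ∑ i ∈ s, f ≫ a i :=
  map_sum (restrictRingHom R f) a s

variable (k : Type w) [Field k] (R : C) [CommRingObj R] [AlgObj k R]

/-- Every Weil algebra has a spectrum: it is cut out of a power of `R` by the structure constants
with respect to a basis. -/
theorem exists_isSpec [HasFiniteLimits C] (W : Type w) [CommRing W] [Algebra k W]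
    [Module.Finite k W] : ∃ (S : C) (χ : W →ₐ[k] (S ⟶ R)), IsSpec χ := by
  classical
  let n := Module.finrank k W
  let b : Module.Basis (Fin n) k W := Module.finBasis k W
  let P : C := ∏ᶜ fun _ : Fin n => R
  -- the linear extension of a family of elements of `R`
  let lin {Y : C} (r : Fin n → (Y ⟶ R)) : W →ₗ[k] (Y ⟶ R) := b.constr k r
  have lin_nat : ∀ {Y Z : C} (f : Y ⟶ Z) (r : Fin n → (Z ⟶ R)) (a : W),
      f ≫ lin r a = lin (fun i => f ≫ r i) a := by
    intro Y Z f r a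
    simp only [lin, Module.Basis.constr_apply_fintype]
    rw [comp_sum']
    simp only [comp_smul']
  let r₀ : Fin n → (P ⟶ R) := fun i => Pi.π (fun _ : Fin n => R) i
  -- The index `none` carries the equation for the unit, `some (i, j)` the one for the product of
  -- two basis vectors.
  let lhs : P ⟶ ∏ᶜ fun _ : Option (Fin n × Fin n) => R := Pi.lift fun o =>
    o.elim (lin r₀ 1) fun ij => lin r₀ (b ij.1 * b ij.2)
  let rhs : P ⟶ ∏ᶜ fun _ : Option (Fin n × Fin n) => R := Pi.lift fun o =>
    o.elim 1 fun ij => r₀ ij.1 * r₀ ij.2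
  let S := equalizer lhs rhs
  let r : Fin n → (S ⟶ R) := fun i => equalizer.ι lhs rhs ≫ r₀ i
  have hcond : ∀ o, equalizer.ι lhs rhs ≫ (lhs ≫ Pi.π _ o) = equalizer.ι lhs rhs ≫ (rhs ≫ Pi.π _ o) := by
    intro o
    rw [← Category.assoc, equalizer.condition, Category.assoc]
  -- a family satisfying the equations gives a homomorphism
  have mk : ∀ {Y : C} (r : Fin n → (Y ⟶ R)), lin r 1 = 1 →
      (∀ i j, lin r (b i * b j) = r i * r j) → ∀ x y, lin r (x * y) = lin r x * lin r y := by
    intro Y r _ h2 x y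
    have : (LinearMap.mul k W).compr₂ (lin r) =
        (LinearMap.mul k (Y ⟶ R)).compl₁₂ (lin r) (lin r) := by
      refine b.ext fun i => b.ext fun j => ?_
      simp [h2, lin]
    exact LinearMap.congr_fun₂ this x y
  have h1 : lin r 1 = 1 := by
    have := hcond none
    simp only [lhs, rhs, limit.lift_π, Fan.mk_π_app, Option.elim] at this
    rw [lin_nat, comp_one'] at this
    exact this
  have h2 : ∀ i j, lin r (b i * b j) = r i * r j := by
    intro i j
    have := hcond (some (i, j))
    simp only [lhs, rhs, limit.lift_π, Fan.mk_π_app, Option.elim] at this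
    rw [lin_nat, comp_mul'] at this
    exact this
  let χ : W →ₐ[k] (S ⟶ R) := AlgHom.ofLinearMap (lin r) h1 (mk r h1 h2)
  refine ⟨S, χ, fun Y ψ => ?_⟩
  -- The values of `ψ` on the basis are the coordinates of the required point of `S`; they satisfy
  -- the equations because `ψ` is multiplicative and unital.
  have hψ : lin (fun i => ψ (b i)) = ψ.toLinearMap := b.ext fun i => by simp [lin]
  have hl : Pi.lift (fun i => ψ (b i)) ≫ lhs = Pi.lift (fun i => ψ (b i)) ≫ rhs := by
    have e : ∀ i, Pi.lift (fun i => ψ (b i)) ≫ r₀ i = ψ (b i) := by simp [r₀]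
    refine Pi.hom_ext _ _ fun o => ?_
    rcases o with _ | ⟨i, j⟩
    · simp only [lhs, rhs, Category.assoc, limit.lift_π, Fan.mk_π_app, Option.elim]
      rw [lin_nat, comp_one']
      simp only [e, hψ]
      simp
    · simp only [lhs, rhs, Category.assoc, limit.lift_π, Fan.mk_π_app, Option.elim]
      rw [lin_nat, comp_mul']
      simp only [e, hψ]
      simp
  refine ⟨equalizer.lift (Pi.lift fun i => ψ (b i)) hl, fun a => ?_, fun s hs => ?_⟩
  · change _ ≫ lin r a = ψ a
    rw [lin_nat]
    have : (fun i => equalizer.lift (f := lhs) (g := rhs) (Pi.lift fun i => ψ (b i)) hl ≫ r i) =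
        fun i => ψ (b i) := by
      funext i
      simp [r, r₀]
    rw [this, hψ]; rfl
  · apply equalizer.hom_ext
    apply Pi.hom_ext
    intro i
    have := hs (b i)
    have e : χ (b i) = r i := by
      change lin r (b i) = r i
      simp [lin]
    rw [e] at this
    simpa [r, r₀] using this

/-- A Weil algebra together with a spectrum. -/
structure WeilSpec where
  W : Type w
  [commRing : CommRing W]
  [algebra : Algebra k W]
  isWeil : IsWeil k W
  S : C
  χ : W →ₐ[k] (S ⟶ R)
  isSpec : IsSpec χ

attribute [instance] WeilSpec.commRing WeilSpec.algebra

namespace WeilSpec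

variable {k R}

theorem exists_of_isWeil [HasFiniteLimits C] {W : Type w} [CommRing W] [Algebra k W]
    (h : IsWeil k W) : ∃ (S : C) (χ : W →ₐ[k] (S ⟶ R)), IsSpec χ := by
  have := h.1
  exact exists_isSpec k R W

/-- A chosen spectrum. -/
def ofIsWeil [HasFiniteLimits C] {W : Type w} [CommRing W] [Algebra k W] (h : IsWeil k W) :
    WeilSpec k R where
  W := W
  isWeil := h
  S := (exists_of_isWeil (R := R) h).choose
  χ := (exists_of_isWeil (R := R) h).choose_spec.choose
  isSpec := (exists_of_isWeil (R := R) h).choose_spec.choose_spec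

variable (k R) in
/-- The terminal object as the spectrum of `k`. -/
def point : WeilSpec k R where
  W := k
  isWeil := IsWeil.self
  S := 𝟙_ C
  χ := Algebra.ofId k _
  isSpec Y ψ := ⟨toUnit Y, fun a => by
    change _ ≫ algebraMap _ _ _ = _
    rw [comp_algebraMap]
    exact (ψ.commutes a).symm, fun _ _ => toUnit_unique _ _⟩

variable {A B E : WeilSpec k R} {M Z : C}

/-- The morphism of spectra given by a homomorphism. -/
def pull (f : A.W →ₐ[k] B.W) : B.S ⟶ A.S := A.isSpec.elem (B.χ.comp f)

theorem pull_eq_iff {f : A.W →ₐ[k] B.W} {g : B.S ⟶ A.S} :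
    pull f = g ↔ ∀ a, g ≫ A.χ a = B.χ (f a) := by
  constructor
  · rintro rfl a
    exact A.isSpec.elem_spec _ a
  · intro h
    refine A.isSpec.hom_ext fun a => ?_
    rw [h a]
    exact A.isSpec.elem_spec _ a

theorem pull_comp_χ (f : A.W →ₐ[k] B.W) (a : A.W) : pull f ≫ A.χ a = B.χ (f a) :=
  A.isSpec.elem_spec _ a

theorem pull_comp (f : A.W →ₐ[k] B.W) (g : B.W →ₐ[k] E.W) : pull (g.comp f) = pull g ≫ pull f := by
  rw [pull_eq_iff]
  intro a
  rw [Category.assoc, pull_comp_χ, pull_comp_χ]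
  rfl

theorem pull_id : pull (AlgHom.id k A.W) = 𝟙 A.S := by
  rw [pull_eq_iff]
  intro a
  simp

/-- The covariant action of homomorphisms of Weil algebras on the maps from their spectra. -/
def act (f : A.W →ₐ[k] B.W) (u : A.S ⊗ Z ⟶ M) : B.S ⊗ Z ⟶ M := pull f ▷ Z ≫ u

theorem act_comp (f : A.W →ₐ[k] B.W) (g : B.W →ₐ[k] E.W) (u : A.S ⊗ Z ⟶ M) :
    act (g.comp f) u = act g (act f u) := by
  simp [act, pull_comp]

theorem act_id (u : A.S ⊗ Z ⟶ M) : act (AlgHom.id k A.W) u = u := by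
  simp [act, pull_id]

variable (A) in
/-- The augmentation. -/
def aug : A.W →ₐ[k] (point k R).W := A.isWeil.2.choose

theorem aug_unique (f g : A.W →ₐ[k] (point k R).W) : f = g := A.isWeil.augmentation_unique f g

/-- The base point. -/
def base (u : A.S ⊗ Z ⟶ M) : (point k R).S ⊗ Z ⟶ M := act A.aug u

/-- Homomorphisms of Weil algebras respect the unique augmentations; base points are compared in
this way throughout. -/
theorem base_act (f : A.W →ₐ[k] B.W) (u : A.S ⊗ Z ⟶ M) : base (act f u) = base u := by
  rw [base, ← act_comp, base, aug_unique (B.aug.comp f) A.aug]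

end WeilSpec

end Spectra

end

end SDG

namespace SDG

noncomputable section

/-! ### Microlinearity and generic elements. -/

namespace WeilSpec

variable {C : Type u} [Category.{v} C] [CartesianMonoidalCategory C] [BraidedCategory C]
  [HasFiniteLimits C] {k : Type w} [Field k] {R : C} [CommRingObj R] [AlgObj k R] {M Z : C}

/-- The fibre product over `k`. -/
def prod (A B : WeilSpec k R) : WeilSpec k R :=
  ofIsWeil (A.isWeil.pullback B.isWeil A.aug B.aug)

variable {A B : WeilSpec k R}

def prodFst : (prod A B).W →ₐ[k] A.W :=
  (AlgHom.fst k A.W B.W).comp (Subalgebra.val _)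

def prodSnd : (prod A B).W →ₐ[k] B.W :=
  (AlgHom.snd k A.W B.W).comp (Subalgebra.val _)

/-- This is microlinearity for the cospan `A → k ← B`; the compatible family consists of `u`, `v`
and their common base point. -/
theorem exists_prod (hM : Microlinear k R M) (u : A.S ⊗ Z ⟶ M) (v : B.S ⊗ Z ⟶ M)
    (h : base u = base v) :
    ∃ t : (prod A B).S ⊗ Z ⟶ M, act prodFst t = u ∧ act prodSnd t = v := by
  let f : CommAlgCat.of k A.W ⟶ CommAlgCat.of k (point k R).W := CommAlgCat.ofHom A.aug
  let g : CommAlgCat.of k B.W ⟶ CommAlgCat.of k (point k R).W := CommAlgCat.ofHom B.aug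
  let p₁ : CommAlgCat.of k (prod A B).W ⟶ CommAlgCat.of k A.W := CommAlgCat.ofHom prodFst
  let p₂ : CommAlgCat.of k (prod A B).W ⟶ CommAlgCat.of k B.W := CommAlgCat.ofHom prodSnd
  have w : p₁ ≫ f = p₂ ≫ g := by
    ext a
    exact a.2
  have lim : IsLimit (PullbackCone.mk p₁ p₂ w) := PullbackCone.IsLimit.mk w
    (fun s => CommAlgCat.ofHom (AlgHom.codRestrict (AlgHom.prod s.fst.hom s.snd.hom) _ (by
      intro x
      exact congrArg (fun q => (q.hom : _ →ₐ[k] _) x) s.condition)))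
    (fun s => by ext x; rfl) (fun s => by ext x; rfl)
    (fun s m h₁ h₂ => by
      ext x
      refine Subtype.ext (Prod.ext ?_ ?_)
      · exact congrArg (fun q => (q.hom : _ →ₐ[k] _) x) h₁
      · exact congrArg (fun q => (q.hom : _ →ₐ[k] _) x) h₂)
  let V : WalkingCospan → WeilSpec k R
    | none => point k R
    | some .left => A
    | some .right => B
  let χ : ∀ j, (cospan f g).obj j →ₐ[k] ((V j).S ⟶ R)
    | none => (point k R).χ
    | some .left => A.χ
    | some .right => B.χ
  have hχ : ∀ j, IsSpec (χ j)
    | none => (point k R).isSpec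
    | some .left => A.isSpec
    | some .right => B.isSpec
  let γ : ∀ j, (V j).S ⊗ Z ⟶ M
    | none => base u
    | some .left => u
    | some .right => v
  obtain ⟨t, ht, -⟩ := hM WalkingCospan (cospan f g) (PullbackCone.mk p₁ p₂ w) ⟨lim⟩
    (prod A B).isWeil
    (fun | none => (point k R).isWeil | some .left => A.isWeil | some .right => B.isWeil)
    (fun j => (V j).S) χ hχ (prod A B).S (prod A B).χ (prod A B).isSpec Z γ (by
      rintro (_ | _ | _) (_ | _ | _) (_ | _)
      · exact act_id (A := point k R) (base u)
      · rfl
      · exact act_id u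
      · exact h.symm
      · exact act_id v)
  exact ⟨t, ht (some .left), ht (some .right)⟩

/-- The subalgebra on which two homomorphisms agree. -/
def eqz (f g : A.W →ₐ[k] B.W) : WeilSpec k R :=
  ofIsWeil (A.isWeil.subalgebra (AlgHom.equalizer f g))

def eqzVal (f g : A.W →ₐ[k] B.W) : (eqz f g).W →ₐ[k] A.W := Subalgebra.val _

/-- This is microlinearity for the parallel pair `f`, `g`. -/
theorem exists_eqz (hM : Microlinear k R M) (f g : A.W →ₐ[k] B.W) (u : A.S ⊗ Z ⟶ M)
    (h : act f u = act g u) : ∃ t : (eqz f g).S ⊗ Z ⟶ M, act (eqzVal f g) t = u := by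
  let f' : CommAlgCat.of k A.W ⟶ CommAlgCat.of k B.W := CommAlgCat.ofHom f
  let g' : CommAlgCat.of k A.W ⟶ CommAlgCat.of k B.W := CommAlgCat.ofHom g
  let i : CommAlgCat.of k (eqz f g).W ⟶ CommAlgCat.of k A.W := CommAlgCat.ofHom (eqzVal f g)
  have w : i ≫ f' = i ≫ g' := by
    ext a
    exact a.2
  have lim : IsLimit (Fork.ofι i w) := Fork.IsLimit.mk _
    (fun s => CommAlgCat.ofHom (AlgHom.codRestrict s.ι.hom _ (by
      intro x
      exact congrArg (fun q => (q.hom : _ →ₐ[k] _) x) s.condition)))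
    (fun s => by ext x; rfl)
    (fun s m h₁ => by
      ext x
      refine Subtype.ext ?_
      exact congrArg (fun q => (q.hom : _ →ₐ[k] _) x) h₁)
  let V : WalkingParallelPair → WeilSpec k R
    | .zero => A
    | .one => B
  let χ : ∀ j, (parallelPair f' g').obj j →ₐ[k] ((V j).S ⟶ R)
    | .zero => A.χ
    | .one => B.χ
  have hχ : ∀ j, IsSpec (χ j)
    | .zero => A.isSpec
    | .one => B.isSpec
  let γ : ∀ j, (V j).S ⊗ Z ⟶ M
    | .zero => u
    | .one => act f u
  obtain ⟨t, ht, -⟩ := hM WalkingParallelPair (parallelPair f' g') (Fork.ofι i w) ⟨lim⟩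
    (eqz f g).isWeil (fun | .zero => A.isWeil | .one => B.isWeil)
    (fun j => (V j).S) χ hχ (eqz f g).S (eqz f g).χ (eqz f g).isSpec Z γ (by
      rintro _ _ (_ | _ | _ | _)
      · rfl
      · exact h.symm
      · exact act_id u
      · exact act_id (act f u))
  exact ⟨t, ht .zero⟩

/-- Finitely many elements with the same base point come from a single one. -/
theorem exists_common (hM : Microlinear k R M) (b : (point k R).S ⊗ Z ⟶ M) (ι : Type) [Finite ι]
    (B : ι → WeilSpec k R) (x : ∀ i, (B i).S ⊗ Z ⟶ M) (hx : ∀ i, base (x i) = b) :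
    ∃ (A : WeilSpec k R) (u : A.S ⊗ Z ⟶ M) (θ : ∀ i, A.W →ₐ[k] (B i).W),
      base u = b ∧ ∀ i, act (θ i) u = x i := by
  revert B
  refine Finite.induction_empty_option (P := fun ι => ∀ (B : ι → WeilSpec k R)
    (x : ∀ i, (B i).S ⊗ Z ⟶ M), (∀ i, base (x i) = b) →
    ∃ (A : WeilSpec k R) (u : A.S ⊗ Z ⟶ M) (θ : ∀ i, A.W →ₐ[k] (B i).W),
      base u = b ∧ ∀ i, act (θ i) u = x i) ?_ ?_ ?_ ι
  · intro α β e ih B x hx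
    obtain ⟨A, u, θ, hu, h⟩ := ih (fun i => B (e i)) (fun i => x (e i)) fun i => hx (e i)
    refine ⟨A, u, fun i => (e.apply_symm_apply i) ▸ θ (e.symm i), hu, fun i => ?_⟩
    obtain ⟨j, rfl⟩ := e.surjective i
    have key : ∀ (j' : α) (hj : j' = j) (hj' : e j' = e j),
        act (hj' ▸ θ j' : A.W →ₐ[k] (B (e j)).W) u = x (e j) := by
      rintro _ rfl _
      exact h _
    exact key _ (e.symm_apply_apply j) _
  · intro B x _
    -- An empty family has no base point of its own, which is why `b` is prescribed; it is realised
    -- over `k`.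
    exact ⟨point k R, b, fun i => i.elim, by
      rw [base, aug_unique (aug (point k R)) (AlgHom.id k _), act_id], fun i => i.elim⟩
  · intro α _ ih B x hx
    obtain ⟨A, u, θ, hu, h⟩ := ih (fun i => B (some i)) (fun i => x (some i)) fun i => hx _
    -- The new element and the one that serves all earlier ones are merged over the fibre product of
    -- their algebras.
    obtain ⟨t, ht₁, ht₂⟩ := exists_prod hM u (x none) (by rw [hu, hx])
    refine ⟨prod A (B none), t, fun | none => prodSnd | some i => (θ i).comp prodFst, ?_, ?_⟩
    · rw [← hu, ← ht₁, base_act]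
    · rintro (_ | i)
      · exact ht₂
      · rw [act_comp, ht₁, h]

theorem act_act {E : WeilSpec k R} {f : A.W →ₐ[k] B.W} {g : B.W →ₐ[k] E.W} {h : A.W →ₐ[k] E.W}
    (e : ∀ a, g (f a) = h a) (u : A.S ⊗ Z ⟶ M) : act g (act f u) = act h u := by
  rw [← act_comp]
  congr 1
  exact AlgHom.ext e

/-- `u` is not the image of an element defined on a proper subalgebra. -/
def Faithful (u : A.S ⊗ Z ⟶ M) : Prop :=
  ∀ (V : WeilSpec k R) (f g : A.W →ₐ[k] V.W), act f u = act g u → f = g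

/-- Descent on the dimension: if `f ≠ g` have the same effect on `u`, then `u` comes from their
equalizer, a proper subalgebra and hence of smaller dimension. -/
theorem exists_faithful (hM : Microlinear k R M) : ∀ (n : ℕ) (A : WeilSpec k R)
    (u : A.S ⊗ Z ⟶ M), Module.finrank k A.W = n →
    ∃ (B : WeilSpec k R) (v : B.S ⊗ Z ⟶ M) (f : B.W →ₐ[k] A.W), act f v = u ∧ Faithful v := by
  intro n
  induction n using Nat.strong_induction_on with
  | _ n ih =>
    rintro A u rfl
    by_cases hu : Faithful u
    · exact ⟨A, u, AlgHom.id k _, act_id u, hu⟩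
    · simp only [Faithful, not_forall] at hu
      obtain ⟨V, f, g, hfg, hne⟩ := hu
      obtain ⟨t, ht⟩ := exists_eqz hM f g u hfg
      have := A.isWeil.1
      have hlt : Module.finrank k (eqz f g).W < Module.finrank k A.W := by
        refine Submodule.finrank_lt (s := Subalgebra.toSubmodule (AlgHom.equalizer f g)) ?_
        intro htop
        apply hne
        ext a
        have : a ∈ Subalgebra.toSubmodule (AlgHom.equalizer f g) := htop ▸ Submodule.mem_top
        exact this
      obtain ⟨B, v, e, he, hv⟩ := ih _ hlt (eqz f g) t rfl
      exact ⟨B, v, (eqzVal f g).comp e, by rw [act_comp, he, ht], hv⟩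

/-- Finitely many elements with the same base point are images of a faithful one; every equation
between them then holds for the homomorphisms that define them. -/
theorem exists_generic (hM : Microlinear k R M) (b : (point k R).S ⊗ Z ⟶ M) {ι : Type} [Finite ι]
    (B : ι → WeilSpec k R) (x : ∀ i, (B i).S ⊗ Z ⟶ M) (hx : ∀ i, base (x i) = b) :
    ∃ (A : WeilSpec k R) (u : A.S ⊗ Z ⟶ M) (θ : ∀ i, A.W →ₐ[k] (B i).W),
      base u = b ∧ Faithful u ∧ ∀ i, act (θ i) u = x i := by
  obtain ⟨A, u, θ, hb, h⟩ := exists_common hM b ι B x hx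
  obtain ⟨A', u', f, rfl, hu'⟩ := exists_faithful hM _ A u rfl
  exact ⟨A', u', fun i => (θ i).comp f, by rw [← hb, base_act], hu', fun i => by rw [act_comp, h]⟩

/-- The transfer principle: an equation in `M` between images of `x` and `y` is turned into an
equation in the Weil algebra `V`. -/
theorem Faithful.comp_eq {u : A.S ⊗ Z ⟶ M} (hu : Faithful u) {B₁ B₂ V : WeilSpec k R}
    {θ : A.W →ₐ[k] B₁.W} {ψ : A.W →ₐ[k] B₂.W} {x : B₁.S ⊗ Z ⟶ M} {y : B₂.S ⊗ Z ⟶ M}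
    (hx : act θ u = x) (hy : act ψ u = y) (f : B₁.W →ₐ[k] V.W) (g : B₂.W →ₐ[k] V.W)
    (h : act f x = act g y) (a : A.W) : f (θ a) = g (ψ a) := by
  have := hu V (f.comp θ) (g.comp ψ) (by rw [act_comp, act_comp, hx, hy, h])
  exact DFunLike.congr_fun this a

/-- A jointly injective family of homomorphisms acts in a jointly injective way. -/
theorem act_injective (hM : Microlinear k R M) {ι : Type} [Nonempty ι] {V : ι → WeilSpec k R}
    (f : ∀ i, A.W →ₐ[k] (V i).W) (hf : ∀ a a', (∀ i, f i a = f i a') → a = a')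
    {x y : A.S ⊗ Z ⟶ M} (h : ∀ i, act (f i) x = act (f i) y) : x = y := by
  -- One index suffices to compare the base points, as homomorphisms preserve them; this is where
  -- the family must be nonempty.
  have hb : base y = base x := by
    rw [← base_act (f (Classical.arbitrary ι)) x, h, base_act]
  obtain ⟨A', u, θ, -, hu, hθ⟩ := exists_generic hM (base x) (fun _ : Bool => A)
    (fun i => bif i then x else y) (by rintro (_ | _) <;> simp [hb])
  have h1 : act (θ true) u = x := hθ true
  have h2 : act (θ false) u = y := hθ false
  have : θ true = θ false := by
    ext a
    exact hf _ _ fun i => hu.comp_eq h1 h2 (f i) (f i) (h i) a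
  rw [← h1, ← h2, this]

end WeilSpec

end

end SDG

namespace SDG

noncomputable section

/-! ### Coordinates on `D`, `D(ι)` and `D² ∨ D`. -/

section Infinitesimal

variable {C : Type u} [Category.{v} C] [CartesianMonoidalCategory C] [BraidedCategory C]
  [HasFiniteLimits C] {R : C} [CommRingObj R]

theorem D_hom_ext {Y : C} {a b : Y ⟶ D R} (h : a ≫ incl R = b ≫ incl R) : a = b :=
  equalizer.hom_ext h

@[simp] theorem comp_zeroD {Y Y' : C} (f : Y' ⟶ Y) : f ≫ zeroD R Y = zeroD R Y' :=
  D_hom_ext (by rw [zeroD, zeroD, Category.assoc, mkD_incl, mkD_incl, comp_zero'])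

@[simp] theorem zeroD_incl (Y : C) : zeroD R Y ≫ incl R = 0 := by simp [zeroD]

@[simp] theorem smulD_incl {Y : C} (a : Y ⟶ R) (d : Y ⟶ D R) :
    smulD a d ≫ incl R = a * (d ≫ incl R) := by simp [smulD]

@[simp] theorem comp_smulD {Y Y' : C} (f : Y' ⟶ Y) (a : Y ⟶ R) (d : Y ⟶ D R) :
    f ≫ smulD a d = smulD (f ≫ a) (f ≫ d) :=
  D_hom_ext (by simp [comp_mul'])

@[simp] theorem comp_constSmulD {k : Type w} [Field k] [AlgObj k R] {Y Y' : C} (f : Y' ⟶ Y) (c : k)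
    (d : Y ⟶ D R) : f ≫ constSmulD c d = constSmulD c (f ≫ d) := by
  rw [constSmulD, constSmulD, comp_smulD, comp_algebraMap]

@[simp] theorem smulD_zeroD {Y : C} (a : Y ⟶ R) : smulD a (zeroD R Y) = zeroD R Y :=
  D_hom_ext (by simp)

/-- The inclusion of `D(ι)` in the power of `D`. -/
def dfirstIncl (ι : Type) [Finite ι] : Dfirst R ι ⟶ ∏ᶜ fun _ : ι => D R := equalizer.ι _ _

instance (ι : Type) [Finite ι] : Mono (dfirstIncl (R := R) ι) := equalizer.ι_mono

/-- The component of an element of `D(ι)`. -/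
def dfirstComp {ι : Type} [Finite ι] (i : ι) : Dfirst R ι ⟶ D R :=
  dfirstIncl ι ≫ Pi.π (fun _ : ι => D R) i

variable {ι : Type} [Finite ι]

theorem Dfirst_hom_ext {Y : C} {a b : Y ⟶ Dfirst R ι}
    (h : ∀ i, a ≫ dfirstComp i = b ≫ dfirstComp i) : a = b := by
  rw [← cancel_mono (dfirstIncl ι)]
  exact Pi.hom_ext _ _ fun i => by simpa [dfirstComp] using h i

@[simp] theorem mkDfirst_comp {Y : C} (d : ι → (Y ⟶ D R))
    (h : ∀ i j, (d i ≫ incl R) * (d j ≫ incl R) = 0) (i : ι) :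
    mkDfirst d h ≫ dfirstComp i = d i := by
  have : mkDfirst d h ≫ dfirstIncl ι = Pi.lift d := equalizer.lift_ι _ _
  rw [dfirstComp, ← Category.assoc, this]
  simp

theorem dfirstComp_mul (i j : ι) :
    (dfirstComp i ≫ incl R) * (dfirstComp j ≫ incl R) = 0 := by
  have h : dfirstIncl (R := R) ι ≫ (Pi.lift fun ij : ι × ι =>
      (Pi.π (fun _ : ι => D R) ij.1 ≫ incl R) * (Pi.π (fun _ : ι => D R) ij.2 ≫ incl R)) =
      dfirstIncl ι ≫ (Pi.lift fun _ : ι × ι => (0 : (∏ᶜ fun _ : ι => D R) ⟶ R)) :=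
    equalizer.condition _ _
  have h := congrArg (fun q => q ≫ Pi.π (fun _ : ι × ι => R) (i, j)) h
  simp only [Category.assoc, limit.lift_π, Fan.mk_π_app] at h
  rw [comp_mul', comp_zero'] at h
  simpa only [dfirstComp, Category.assoc] using h

variable (R) in
/-- The inclusion of `D² ∨ D` in `D³`. -/
def wedgeIncl : Wedge R ⟶ (D R ⊗ D R) ⊗ D R := equalizer.ι _ _

instance : Mono (wedgeIncl R) := equalizer.ι_mono

/-- The components `d_1`, `d_2` and `e` of an element of `D² ∨ D`. -/
def wedge₁ : Wedge R ⟶ D R := wedgeIncl R ≫ fst (D R ⊗ D R) (D R) ≫ fst (D R) (D R)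

def wedge₂ : Wedge R ⟶ D R := wedgeIncl R ≫ fst (D R ⊗ D R) (D R) ≫ snd (D R) (D R)

def wedge₃ : Wedge R ⟶ D R := wedgeIncl R ≫ snd (D R ⊗ D R) (D R)

theorem Wedge_hom_ext {Y : C} {a b : Y ⟶ Wedge R} (h₁ : a ≫ wedge₁ = b ≫ wedge₁)
    (h₂ : a ≫ wedge₂ = b ≫ wedge₂) (h₃ : a ≫ wedge₃ = b ≫ wedge₃) : a = b := by
  rw [← cancel_mono (wedgeIncl R)]
  refine CartesianMonoidalCategory.hom_ext _ _ (CartesianMonoidalCategory.hom_ext _ _ ?_ ?_) ?_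
  · simpa [wedge₁] using h₁
  · simpa [wedge₂] using h₂
  · simpa [wedge₃] using h₃

section

variable {Y : C} (d₁ d₂ e : Y ⟶ D R) (h₁ : (d₁ ≫ incl R) * (e ≫ incl R) = 0)
    (h₂ : (d₂ ≫ incl R) * (e ≫ incl R) = 0)

theorem mkWedge_incl : mkWedge d₁ d₂ e h₁ h₂ ≫ wedgeIncl R = lift (lift d₁ d₂) e :=
  equalizer.lift_ι _ _

@[simp] theorem mkWedge_wedge₁ : mkWedge d₁ d₂ e h₁ h₂ ≫ wedge₁ = d₁ := by
  rw [wedge₁, ← Category.assoc, mkWedge_incl]; simp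

@[simp] theorem mkWedge_wedge₂ : mkWedge d₁ d₂ e h₁ h₂ ≫ wedge₂ = d₂ := by
  rw [wedge₂, ← Category.assoc, mkWedge_incl]; simp

@[simp] theorem mkWedge_wedge₃ : mkWedge d₁ d₂ e h₁ h₂ ≫ wedge₃ = e := by
  rw [wedge₃, ← Category.assoc, mkWedge_incl]; simp

end

theorem wedge_condition :
    ((wedge₁ ≫ incl R) * (wedge₃ ≫ incl R) : Wedge R ⟶ R) = 0 ∧
      ((wedge₂ ≫ incl R) * (wedge₃ ≫ incl R) : Wedge R ⟶ R) = 0 := by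
  have h : wedgeIncl R ≫
      lift ((fst (D R ⊗ D R) (D R) ≫ fst (D R) (D R) ≫ incl R) * (snd (D R ⊗ D R) (D R) ≫ incl R))
        ((fst (D R ⊗ D R) (D R) ≫ snd (D R) (D R) ≫ incl R) * (snd (D R ⊗ D R) (D R) ≫ incl R)) =
      wedgeIncl R ≫ lift (0 : (D R ⊗ D R) ⊗ D R ⟶ R) (0 : (D R ⊗ D R) ⊗ D R ⟶ R) :=
    equalizer.condition _ _
  have h₁ := congrArg (fun q => q ≫ fst _ _) h
  have h₂ := congrArg (fun q => q ≫ snd _ _) h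
  simp only [Category.assoc, lift_fst, lift_snd] at h₁ h₂
  rw [comp_mul', comp_zero'] at h₁ h₂
  exact ⟨by simpa only [wedge₁, wedge₃, Category.assoc] using h₁,
    by simpa only [wedge₂, wedge₃, Category.assoc] using h₂⟩

end Infinitesimal

/-! ### The infinitesimal objects as spectra of explicit Weil algebras. -/

namespace WeilSpec

open TrivSqZeroExt

variable {C : Type u} [Category.{v} C] [CartesianMonoidalCategory C] [BraidedCategory C]
  [HasFiniteLimits C] (k : Type w) [Field k] (R : C) [CommRingObj R] [AlgObj k R]

theorem isWeil_tsze (V : Type w) [AddCommGroup V] [Module k V] [Module kᵐᵒᵖ V]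
    [IsCentralScalar k V] [Module.Finite k V] : IsWeil k (TrivSqZeroExt k V) :=
  ⟨inferInstanceAs (Module.Finite k (k × V)), fstHom k k V, fun a (ha : a.fst = 0) => by
    rw [isNilpotent_iff_isNilpotent_fst, ha]; exact IsNilpotent.zero⟩

/-- The generic homomorphism to the functions on `D`. -/
def lineChar : DualNumber k →ₐ[k] (D R ⟶ R) :=
  DualNumber.lift ⟨(Algebra.ofId k _, incl R), by
    have := sq_zero (𝟙 (D R))
    rwa [Category.id_comp] at this, fun _ => Commute.all _ _⟩

theorem lineChar_apply (a : DualNumber k) : lineChar k R a =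
    algebraMap k (D R ⟶ R) a.fst + algebraMap k (D R ⟶ R) a.snd * incl R := rfl

theorem lineChar_eps : lineChar k R DualNumber.eps = incl R := DualNumber.lift_apply_eps _

theorem isSpec_lineChar : IsSpec (lineChar k R) := by
  intro Y ψ
  obtain ⟨s, hs⟩ : ∃ s : Y ⟶ D R, s ≫ incl R = ψ DualNumber.eps :=
    ⟨mkD (ψ DualNumber.eps) (by rw [← map_mul, DualNumber.eps_mul_eps, map_zero]), mkD_incl _ _⟩
  refine ⟨s, fun a => ?_, fun t ht => ?_⟩
  · refine DFunLike.congr_fun (f := (restrict k R s).comp (lineChar k R)) (g := ψ) ?_ a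
    ext
    rw [AlgHom.comp_apply, restrict_apply, lineChar_eps, hs]
  · apply D_hom_ext
    rw [hs, ← ht, lineChar_eps]

/-- `D` as the spectrum of the dual numbers. -/
def line : WeilSpec k R where
  W := DualNumber k
  isWeil := isWeil_tsze k k
  S := D R
  χ := lineChar k R
  isSpec := isSpec_lineChar k R

variable {k R}

theorem isWeil_dual (A : WeilSpec k R) : IsWeil k (DualNumber A.W) := by
  obtain ⟨hf, ε, hε⟩ := A.isWeil
  exact ⟨inferInstanceAs (Module.Finite k (A.W × A.W)), ε.comp (fstHom k A.W A.W), fun a ha => by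
    rw [isNilpotent_iff_isNilpotent_fst]; exact hε _ ha⟩

/-- The generic homomorphism to the functions on `D × S`. -/
def dualChar {W : Type w} [CommRing W] [Algebra k W] {S : C} (χ : W →ₐ[k] (S ⟶ R)) :
    DualNumber W →ₐ[k] (D R ⊗ S ⟶ R) :=
  DualNumber.lift ⟨((restrict k R (snd (D R) S)).comp χ, fst (D R) S ≫ incl R),
    sq_zero _, fun _ => Commute.all _ _⟩

section

variable {W : Type w} [CommRing W] [Algebra k W] {S : C} (χ : W →ₐ[k] (S ⟶ R))

theorem dualChar_apply (a : DualNumber W) : dualChar χ a =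
    snd _ _ ≫ χ a.fst + (snd _ _ ≫ χ a.snd) * (fst _ _ ≫ incl R) := rfl

theorem dualChar_eps : dualChar χ DualNumber.eps = fst _ _ ≫ incl R := DualNumber.lift_apply_eps _

theorem dualChar_inl (a : W) : dualChar χ (inl a) = snd _ _ ≫ χ a := DualNumber.lift_apply_inl _ _

/-- A homomorphism from `W[ε]` amounts to one from `W` together with an element of square zero, so
adjoining `ε` multiplies the spectrum by `D`. On iteration the outermost `ε` belongs to the first
factor: for `D²`, `x.snd.fst` is the coefficient of `d_1` and `x.fst.snd` that of `d_2`. -/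
theorem isSpec_dualChar {χ : W →ₐ[k] (S ⟶ R)} (h : IsSpec χ) : IsSpec (dualChar χ) := by
  intro Y ψ
  refine ⟨lift (mkD (ψ DualNumber.eps) (by rw [← map_mul, DualNumber.eps_mul_eps, map_zero]))
    (h.elem (ψ.comp (inlAlgHom k W W))), fun a => ?_, fun s hs => ?_⟩
  · have ha : a = inl a.fst + inl a.snd * DualNumber.eps := by
      ext <;> simp
    conv_rhs => rw [ha]
    rw [dualChar_apply, comp_add', comp_mul', lift_snd_assoc, lift_snd_assoc, lift_fst_assoc,
      mkD_incl, IsSpec.elem_spec, IsSpec.elem_spec, map_add, map_mul]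
    rfl
  · apply CartesianMonoidalCategory.hom_ext
    · apply D_hom_ext
      rw [lift_fst, mkD_incl, ← hs, dualChar_eps, Category.assoc]
    · rw [lift_snd]
      refine h.hom_ext fun a => ?_
      rw [IsSpec.elem_spec, AlgHom.comp_apply, ← hs, inlAlgHom_apply, dualChar_inl, Category.assoc]

end

/-- `D × S` as the spectrum of the dual numbers over `A`. -/
def dual (A : WeilSpec k R) : WeilSpec k R where
  W := DualNumber A.W
  isWeil := isWeil_dual A
  S := D R ⊗ A.S
  χ := dualChar A.χ
  isSpec := isSpec_dualChar A.isSpec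

variable (k R) in
/-- The generic homomorphism to the functions on `D(ι)`. -/
def firstChar (ι : Type) [Fintype ι] : TrivSqZeroExt k (ι → k) →ₐ[k] (Dfirst R ι ⟶ R) :=
  liftEquivOfComm ⟨Fintype.linearCombination k fun i => dfirstComp i ≫ incl R, fun x y => by
    rw [Fintype.linearCombination_apply, Fintype.linearCombination_apply, Finset.sum_mul_sum]
    refine Finset.sum_eq_zero fun i _ => Finset.sum_eq_zero fun j _ => ?_
    rw [smul_mul_smul_comm, dfirstComp_mul, smul_zero]⟩

theorem firstChar_apply {ι : Type} [Fintype ι] (a : TrivSqZeroExt k (ι → k)) :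
    firstChar k R ι a = algebraMap k (Dfirst R ι ⟶ R) a.fst +
      ∑ i, a.snd i • (dfirstComp i ≫ incl R) := rfl

theorem firstChar_inr {ι : Type} [Fintype ι] (m : ι → k) :
    firstChar k R ι (inr m) = ∑ i, m i • (dfirstComp i ≫ incl R) := by
  rw [firstChar_apply, fst_inr, snd_inr, map_zero, zero_add]

/-- The images of the unit vectors determine a homomorphism, and they can be any family whose
pairwise products, squares included, vanish. -/
theorem isSpec_firstChar (ι : Type) [Fintype ι] : IsSpec (firstChar k R ι) := by
  classical
  intro Y ψ
  obtain ⟨s, hs⟩ : ∃ s : Y ⟶ Dfirst R ι,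
      ∀ i, s ≫ dfirstComp i ≫ incl R = ψ (inr (Pi.single i 1)) := by
    refine ⟨mkDfirst (fun i => mkD (ψ (inr (Pi.single i 1))) ?_) ?_, fun i => ?_⟩
    · rw [← map_mul, inr_mul_inr, map_zero]
    · intro i j
      rw [mkD_incl, mkD_incl, ← map_mul, inr_mul_inr, map_zero]
    · rw [← Category.assoc, mkDfirst_comp, mkD_incl]
  refine ⟨s, fun a => ?_, fun t ht => ?_⟩
  · refine DFunLike.congr_fun (f := (restrict k R s).comp (firstChar k R ι)) (g := ψ) ?_ a
    refine algHom_ext fun m => ?_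
    rw [AlgHom.comp_apply, restrict_apply, firstChar_inr, comp_sum']
    simp only [comp_smul', hs, ← map_smul, ← map_sum, ← inr_smul, ← inr_sum]
    congr 2
    ext i
    simp [Finset.sum_apply, Pi.single_apply]
  · refine Dfirst_hom_ext fun i => D_hom_ext ?_
    rw [Category.assoc, Category.assoc, hs, ← ht, firstChar_inr]
    simp [Pi.single_apply]

variable (k R) in
/-- `D(ι)` as the spectrum of the trivial square zero extension by `ι → k`. -/
def first (ι : Type) [Fintype ι] : WeilSpec k R where
  W := TrivSqZeroExt k (ι → k)
  isWeil := isWeil_tsze k (ι → k)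
  S := Dfirst R ι
  χ := firstChar k R ι
  isSpec := isSpec_firstChar ι

variable (k) in
/-- The algebra of pairs of elements of `k[ε₁, ε₂]` that differ only in the coefficient of
`ε₁ ε₂`. -/
def wedgeAlg : Subalgebra k (DualNumber (DualNumber k) × DualNumber (DualNumber k)) where
  carrier := {p | p.1.fst = p.2.fst ∧ p.1.snd.fst = p.2.snd.fst}
  mul_mem' := by
    rintro p q ⟨h₁, h₂⟩ ⟨h₃, h₄⟩
    constructor <;> simp [h₁, h₂, h₃, h₄]
  add_mem' := by
    rintro p q ⟨h₁, h₂⟩ ⟨h₃, h₄⟩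
    constructor <;> simp [h₁, h₂, h₃, h₄]
  algebraMap_mem' c := ⟨rfl, rfl⟩

theorem isWeil_wedgeAlg : IsWeil k (wedgeAlg k) := by
  have : Module.Finite k (DualNumber k) := inferInstanceAs (Module.Finite k (k × k))
  have : Module.Finite k (DualNumber (DualNumber k)) :=
    inferInstanceAs (Module.Finite k (DualNumber k × DualNumber k))
  refine ⟨FiniteDimensional.finiteDimensional_subalgebra _,
    ((fstHom k k k).comp (fstHom k (DualNumber k) (DualNumber k))).comp
      ((AlgHom.fst k _ _).comp (Subalgebra.val _)), fun a ha => ?_⟩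
  have h₁ : a.1.1.fst.fst = 0 := ha
  have h₂ : a.1.2.fst.fst = 0 := by rw [← a.2.1, h₁]
  have n₁ : IsNilpotent a.1.1 := by
    rw [isNilpotent_iff_isNilpotent_fst, isNilpotent_iff_isNilpotent_fst, h₁]
    exact IsNilpotent.zero
  have n₂ : IsNilpotent a.1.2 := by
    rw [isNilpotent_iff_isNilpotent_fst, isNilpotent_iff_isNilpotent_fst, h₂]
    exact IsNilpotent.zero
  obtain ⟨m, hm⟩ := n₁
  obtain ⟨n, hn⟩ := n₂
  refine ⟨m + n, Subtype.ext (Prod.ext ?_ ?_)⟩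
  · simp [pow_add, hm]
  · simp [pow_add, hn]

/-- The element with the given coordinates in a ring that contains elements like those of
`D² ∨ D`. -/
def wedgeFun {B : Type*} [Semiring B] [Algebra k B] (d₁ d₂ e : B) (p : wedgeAlg k) : B :=
  algebraMap k B p.1.2.fst.fst + algebraMap k B p.1.2.fst.snd * d₂ +
    algebraMap k B p.1.2.snd.fst * d₁ + algebraMap k B p.1.2.snd.snd * (d₁ * d₂) +
    algebraMap k B (p.1.1.snd.snd - p.1.2.snd.snd) * e

/-- For a pair `(x, y)` the coefficients of `1`, `d_1`, `d_2`, `d_1 d_2` are read off from `y`, and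
that of `e` is the difference of the top coefficients of `x` and `y`. Multiplicativity needs exactly
the five relations among `d_1`, `d_2`, `e`. -/
def wedgeLift {B : Type*} [CommRing B] [Algebra k B] (d₁ d₂ e : B) (h₁ : d₁ * d₁ = 0)
    (h₂ : d₂ * d₂ = 0) (h₃ : e * e = 0) (h₁₃ : d₁ * e = 0) (h₂₃ : d₂ * e = 0) :
    wedgeAlg k →ₐ[k] B where
  toFun := wedgeFun d₁ d₂ e
  map_one' := by simp [wedgeFun]
  map_zero' := by simp [wedgeFun]
  map_add' p q := by
    simp only [wedgeFun, Subalgebra.coe_add, Prod.fst_add, Prod.snd_add, fst_add, snd_add, map_add,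
      map_sub]
    ring
  commutes' c := by
    change algebraMap k B c + algebraMap k B 0 * d₂ + algebraMap k B 0 * d₁ +
      algebraMap k B 0 * (d₁ * d₂) + algebraMap k B (0 - 0) * e = _
    simp
  map_mul' p q := by
    obtain ⟨⟨x, y⟩, hx, hy⟩ := p
    obtain ⟨⟨x', y'⟩, hx', hy'⟩ := q
    dsimp only at hx hy hx' hy'
    simp only [wedgeFun, Subalgebra.coe_mul, Prod.fst_mul, Prod.snd_mul, fst_mul,
      DualNumber.snd_mul, fst_add, snd_add, map_add, map_sub, map_mul, hx, hy, hx', hy']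
    generalize algebraMap k B y.fst.fst = a00
    generalize algebraMap k B y.fst.snd = a01
    generalize algebraMap k B y.snd.fst = a10
    generalize algebraMap k B y.snd.snd = a11
    generalize algebraMap k B x.snd.snd = ae
    generalize algebraMap k B y'.fst.fst = b00
    generalize algebraMap k B y'.fst.snd = b01
    generalize algebraMap k B y'.snd.fst = b10
    generalize algebraMap k B y'.snd.snd = b11
    generalize algebraMap k B x'.snd.snd = be
    -- The multipliers collect the monomials of the expanded product that contain `d_2²`, `d_1²`,
    -- `e²`, `d_2 e` and `d_1 e`.
    linear_combination (-(a01 * b01 + (a01 * b11 + a11 * b01) * d₁)) * h₂ -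
      (a10 * b10 + (a10 * b11 + a11 * b10) * d₂ + a11 * b11 * d₂ * d₂) * h₁ -
      (ae - a11) * (be - b11) * h₃ - (a01 * (be - b11) + (ae - a11) * b01) * h₂₃ -
      (a10 * (be - b11) + (ae - a11) * b10 + (a11 * (be - b11) + (ae - a11) * b11) * d₂) * h₁₃

theorem map_wedgeFun {B B' : Type*} [Semiring B] [Algebra k B] [Semiring B'] [Algebra k B']
    (f : B →ₐ[k] B') (d₁ d₂ e : B) (p : wedgeAlg k) :
    f (wedgeFun d₁ d₂ e p) = wedgeFun (f d₁) (f d₂) (f e) p := by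
  simp only [wedgeFun, map_add, map_mul, AlgHom.commutes]

variable (k) in
def wedgeGen₁ : wedgeAlg k := ⟨(inr 1, inr 1), rfl, rfl⟩

variable (k) in
def wedgeGen₂ : wedgeAlg k := ⟨(inl (inr 1), inl (inr 1)), rfl, rfl⟩

variable (k) in
-- The coordinate `e`: it is `d_1 d_2` along `wedgeMul` and `0` along `wedgeZero`, whence the pair
-- `(ε₁ε₂, 0)`.
def wedgeGen₃ : wedgeAlg k := ⟨(inr (inr 1), 0), rfl, rfl⟩

/-- The three coordinates generate `wedgeAlg`, so that homomorphisms out of it are determined by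
their values on them. -/
theorem wedgeFun_gen (p : wedgeAlg k) :
    wedgeFun (wedgeGen₁ k) (wedgeGen₂ k) (wedgeGen₃ k) p = p := by
  refine Subtype.ext (Prod.ext ?_ ?_)
  · refine (map_wedgeFun ((AlgHom.fst k _ _).comp (wedgeAlg k).val) _ _ _ p).trans ?_
    change wedgeFun (inr 1) (inl (inr 1)) (inr (inr 1)) p = p.1.1
    have h₁ := p.2.1
    have h₂ := p.2.2
    refine TrivSqZeroExt.ext (TrivSqZeroExt.ext ?_ ?_) (TrivSqZeroExt.ext ?_ ?_) <;>
      simp [wedgeFun, h₁, h₂, algebraMap_eq_inl']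
  · refine (map_wedgeFun ((AlgHom.snd k _ _).comp (wedgeAlg k).val) _ _ _ p).trans ?_
    change wedgeFun (inr 1) (inl (inr 1)) 0 p = p.1.2
    refine TrivSqZeroExt.ext (TrivSqZeroExt.ext ?_ ?_) (TrivSqZeroExt.ext ?_ ?_) <;>
      simp [wedgeFun, algebraMap_eq_inl']

theorem wedgeGen_mul : wedgeGen₁ k * wedgeGen₁ k = 0 ∧ wedgeGen₂ k * wedgeGen₂ k = 0 ∧
    wedgeGen₃ k * wedgeGen₃ k = 0 ∧ wedgeGen₁ k * wedgeGen₃ k = 0 ∧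
    wedgeGen₂ k * wedgeGen₃ k = 0 := by
  refine ⟨?_, ?_, ?_, ?_, ?_⟩ <;> refine Subtype.ext (Prod.ext ?_ ?_) <;>
    refine TrivSqZeroExt.ext (TrivSqZeroExt.ext ?_ ?_) (TrivSqZeroExt.ext ?_ ?_) <;>
    simp [wedgeGen₁, wedgeGen₂, wedgeGen₃]

theorem wedgeGen_hom {B : Type*} [Semiring B] [Algebra k B] (ψ : wedgeAlg k →ₐ[k] B)
    (p : wedgeAlg k) :
    ψ p = wedgeFun (ψ (wedgeGen₁ k)) (ψ (wedgeGen₂ k)) (ψ (wedgeGen₃ k)) p := by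
  conv_lhs => rw [← wedgeFun_gen p]
  exact map_wedgeFun ψ _ _ _ p

theorem map_wedgeGen_mul {B : Type*} [Semiring B] [Algebra k B] (ψ : wedgeAlg k →ₐ[k] B) :
    ψ (wedgeGen₁ k) * ψ (wedgeGen₁ k) = 0 ∧ ψ (wedgeGen₂ k) * ψ (wedgeGen₂ k) = 0 ∧
    ψ (wedgeGen₃ k) * ψ (wedgeGen₃ k) = 0 ∧ ψ (wedgeGen₁ k) * ψ (wedgeGen₃ k) = 0 ∧
    ψ (wedgeGen₂ k) * ψ (wedgeGen₃ k) = 0 := by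
  obtain ⟨r₁, r₂, r₃, r₁₃, r₂₃⟩ := wedgeGen_mul (k := k)
  have key : ∀ {a b : wedgeAlg k}, a * b = 0 → ψ a * ψ b = 0 := fun {a b} h =>
    (ψ.map_mul' a b).symm.trans ((congrArg ψ h).trans ψ.map_zero')
  exact ⟨key r₁, key r₂, key r₃, key r₁₃, key r₂₃⟩

theorem wedgeFun_gen₁ {B : Type*} [Semiring B] [Algebra k B] (d₁ d₂ e : B) :
    wedgeFun d₁ d₂ e (wedgeGen₁ k) = d₁ := by
  simp [wedgeFun, wedgeGen₁]

theorem wedgeFun_gen₂ {B : Type*} [Semiring B] [Algebra k B] (d₁ d₂ e : B) :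
    wedgeFun d₁ d₂ e (wedgeGen₂ k) = d₂ := by
  simp [wedgeFun, wedgeGen₂]

theorem wedgeFun_gen₃ {B : Type*} [Semiring B] [Algebra k B] (d₁ d₂ e : B) :
    wedgeFun d₁ d₂ e (wedgeGen₃ k) = e := by
  simp [wedgeFun, wedgeGen₃]

variable (k R) in
/-- The generic homomorphism to the functions on `D² ∨ D`. -/
def wedgeChar : wedgeAlg k →ₐ[k] (Wedge R ⟶ R) :=
  wedgeLift (wedge₁ ≫ incl R) (wedge₂ ≫ incl R) (wedge₃ ≫ incl R) (sq_zero _) (sq_zero _)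
    (sq_zero _) wedge_condition.1 wedge_condition.2

theorem wedgeChar_apply (p : wedgeAlg k) : wedgeChar k R p =
    wedgeFun (wedge₁ ≫ incl R) (wedge₂ ≫ incl R) (wedge₃ ≫ incl R) p := rfl

theorem isSpec_wedgeChar : IsSpec (k := k) (R := R) (W := wedgeAlg k) (wedgeChar k R) := by
  intro Y ψ
  obtain ⟨r₁, r₂, r₃, r₁₃, r₂₃⟩ := map_wedgeGen_mul (k := k) ψ
  obtain ⟨s, h₁, h₂, h₃⟩ : ∃ s : Y ⟶ Wedge R, s ≫ wedge₁ ≫ incl R = ψ (wedgeGen₁ k) ∧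
      s ≫ wedge₂ ≫ incl R = ψ (wedgeGen₂ k) ∧ s ≫ wedge₃ ≫ incl R = ψ (wedgeGen₃ k) := by
    refine ⟨mkWedge (mkD _ r₁) (mkD _ r₂) (mkD _ r₃) ?_ ?_, ?_, ?_, ?_⟩
    · rw [mkD_incl, mkD_incl]
      exact r₁₃
    · rw [mkD_incl, mkD_incl]
      exact r₂₃
    · rw [← Category.assoc, mkWedge_wedge₁, mkD_incl]
    · rw [← Category.assoc, mkWedge_wedge₂, mkD_incl]
    · rw [← Category.assoc, mkWedge_wedge₃, mkD_incl]
  refine ⟨s, fun a => ?_, fun t ht => ?_⟩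
  · rw [wedgeGen_hom ψ a, wedgeChar_apply, ← h₁, ← h₂, ← h₃]
    exact map_wedgeFun (restrict k R s) _ _ _ a
  · have e₁ : t ≫ wedge₁ ≫ incl R = ψ (wedgeGen₁ k) := by
      rw [← ht, wedgeChar_apply]; exact congrArg (t ≫ ·) (wedgeFun_gen₁ _ _ _).symm
    have e₂ : t ≫ wedge₂ ≫ incl R = ψ (wedgeGen₂ k) := by
      rw [← ht, wedgeChar_apply]; exact congrArg (t ≫ ·) (wedgeFun_gen₂ _ _ _).symm
    have e₃ : t ≫ wedge₃ ≫ incl R = ψ (wedgeGen₃ k) := by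
      rw [← ht, wedgeChar_apply]; exact congrArg (t ≫ ·) (wedgeFun_gen₃ _ _ _).symm
    refine Wedge_hom_ext (D_hom_ext ?_) (D_hom_ext ?_) (D_hom_ext ?_)
    · rw [Category.assoc, Category.assoc, e₁, h₁]
    · rw [Category.assoc, Category.assoc, e₂, h₂]
    · rw [Category.assoc, Category.assoc, e₃, h₃]

variable (k R) in
/-- `D² ∨ D` as a spectrum. -/
def wedge : WeilSpec k R where
  W := wedgeAlg k
  isWeil := isWeil_wedgeAlg
  S := Wedge R
  χ := wedgeChar k R
  isSpec := isSpec_wedgeChar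

end WeilSpec

end

end SDG

namespace SDG

noncomputable section

namespace WeilSpec

open TrivSqZeroExt

/-! ### Homomorphisms dual to the maps between infinitesimal objects. -/

section Algebra

variable {k : Type w} [Field k] {ι : Type} [Fintype ι]

/-- The homomorphism of Weil algebras dual to `d ↦ (c_i d)`. -/
def slopeHom (c : ι → k) : TrivSqZeroExt k (ι → k) →ₐ[k] DualNumber k :=
  TrivSqZeroExt.map (Fintype.linearCombination k c)

@[simp] theorem slopeHom_fst (c : ι → k) (a : TrivSqZeroExt k (ι → k)) :
    (slopeHom c a).fst = a.fst := fst_map _ _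

@[simp] theorem slopeHom_snd (c : ι → k) (a : TrivSqZeroExt k (ι → k)) :
    (slopeHom c a).snd = ∑ i, a.snd i * c i := by
  refine (snd_map _ _).trans ?_
  simp [Fintype.linearCombination_apply]

/-- The homomorphism on dual numbers given by a homomorphism. -/
def dualMap {A B : Type w} [CommRing A] [Algebra k A] [CommRing B] [Algebra k B] (f : A →ₐ[k] B) :
    DualNumber A →ₐ[k] DualNumber B :=
  DualNumber.lift ⟨((inlAlgHom k B B).comp f, DualNumber.eps),
    DualNumber.eps_mul_eps, fun _ => Commute.all _ _⟩

section

variable {A B : Type w} [CommRing A] [Algebra k A] [CommRing B] [Algebra k B] (f : A →ₐ[k] B)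
  (a : DualNumber A)

@[simp] theorem dualMap_fst : (dualMap f a).fst = f a.fst := by
  change (inl (f a.fst) + inl (f a.snd) * DualNumber.eps : DualNumber B).fst = _
  simp

@[simp] theorem dualMap_snd : (dualMap f a).snd = f a.snd := by
  change (inl (f a.fst) + inl (f a.snd) * DualNumber.eps : DualNumber B).snd = _
  simp

end

variable (k) in
def wedgeMulHom : wedgeAlg k →ₐ[k] DualNumber (DualNumber k) :=
  (AlgHom.fst k _ _).comp (wedgeAlg k).val

variable (k) in
def wedgeZeroHom : wedgeAlg k →ₐ[k] DualNumber (DualNumber k) :=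
  (AlgHom.snd k _ _).comp (wedgeAlg k).val

theorem wedgeMulHom_apply (p : wedgeAlg k) : wedgeMulHom k p = p.1.1 := rfl

theorem wedgeZeroHom_apply (p : wedgeAlg k) : wedgeZeroHom k p = p.1.2 := rfl

variable (k) in
-- On `(0, 0, e)` only the constant and the coefficient of `e` survive, and the latter is the
-- difference of the two coefficients of `ε₁ε₂`. Every computation with strong differences rests on
-- this formula.
def wedgeAxisHom : wedgeAlg k →ₐ[k] DualNumber k where
  toFun p := inl p.1.2.fst.fst + inr (p.1.1.snd.snd - p.1.2.snd.snd)
  map_one' := by ext <;> simp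
  map_zero' := by ext <;> simp
  map_add' p q := by
    ext
    · simp
    · simp; ring
  commutes' c := by
    refine TrivSqZeroExt.ext ?_ ?_
    · change c + 0 = c
      simp
    · change 0 + ((0 : k) - 0) = 0
      simp
  map_mul' p q := by
    obtain ⟨⟨x, y⟩, hx, hy⟩ := p
    obtain ⟨⟨x', y'⟩, hx', hy'⟩ := q
    dsimp only at hx hy hx' hy'
    ext
    · simp
    · simp [hx, hy, hx', hy']
      ring

@[simp] theorem wedgeAxisHom_snd (p : wedgeAlg k) :
    (wedgeAxisHom k p).snd = p.1.1.snd.snd - p.1.2.snd.snd := by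
  change 0 + (p.1.1.snd.snd - p.1.2.snd.snd) = _
  rw [zero_add]

@[simp] theorem wedgeAxisHom_fst (p : wedgeAlg k) : (wedgeAxisHom k p).fst = p.1.2.fst.fst := by
  change p.1.2.fst.fst + 0 = _
  rw [add_zero]

/-- The element `a + b ε`. -/
def mkDual {B : Type*} [CommRing B] (a b : B) : DualNumber B := inl a + inr b

@[simp] theorem mkDual_fst {B : Type*} [CommRing B] (a b : B) : (mkDual a b).fst = a := by
  simp [mkDual]

@[simp] theorem mkDual_snd {B : Type*} [CommRing B] (a b : B) : (mkDual a b).snd = b := by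
  simp [mkDual]

variable (k) in
/-- The interchange of the two coordinates of `D²`. -/
def swapHom : DualNumber (DualNumber k) →ₐ[k] DualNumber (DualNumber k) where
  toFun x := mkDual (mkDual x.fst.fst x.snd.fst) (mkDual x.fst.snd x.snd.snd)
  map_one' := by ext <;> simp
  map_zero' := by ext <;> simp
  map_add' x y := by ext <;> simp
  commutes' c := by ext <;> simp [algebraMap_eq_inl']
  map_mul' x y := by ext <;> simp <;> ring

theorem swapHom_apply (x : DualNumber (DualNumber k)) :
    swapHom k x = mkDual (mkDual x.fst.fst x.snd.fst) (mkDual x.fst.snd x.snd.snd) := rfl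

variable (k) in
/-- The homomorphism dual to `(d_1, d_2, d_3) ↦ (d_2, d_3, d_1)`. -/
def cycleHom : DualNumber (DualNumber (DualNumber k)) →ₐ[k]
    DualNumber (DualNumber (DualNumber k)) where
  toFun x :=
    mkDual (mkDual (mkDual x.fst.fst.fst x.fst.snd.fst) (mkDual x.snd.fst.fst x.snd.snd.fst))
      (mkDual (mkDual x.fst.fst.snd x.fst.snd.snd) (mkDual x.snd.fst.snd x.snd.snd.snd))
  map_one' := by ext <;> simp
  map_zero' := by ext <;> simp
  map_add' x y := by ext <;> simp
  commutes' c := by ext <;> simp [algebraMap_eq_inl']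
  map_mul' x y := by ext <;> simp <;> ring

theorem cycleHom_apply (x : DualNumber (DualNumber (DualNumber k))) : cycleHom k x =
    mkDual (mkDual (mkDual x.fst.fst.fst x.fst.snd.fst) (mkDual x.snd.fst.fst x.snd.snd.fst))
      (mkDual (mkDual x.fst.fst.snd x.fst.snd.snd) (mkDual x.snd.fst.snd x.snd.snd.snd)) := rfl

end Algebra

/-! ### Identification of these homomorphisms with maps of spectra. -/

section Morphisms

variable {C : Type u} [Category.{v} C] [CartesianMonoidalCategory C] [BraidedCategory C]
  [HasFiniteLimits C] {k : Type w} [Field k] {R : C} [CommRingObj R] [AlgObj k R] {M Z : C}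

/-- Translates between the algebraic action and composition with a map of spectra; it suffices to
compare the effect on coordinate functions. -/
theorem act_eq {A B : WeilSpec k R} {f : A.W →ₐ[k] B.W} {g : B.S ⟶ A.S}
    (h : ∀ a, g ≫ A.χ a = B.χ (f a)) (u : A.S ⊗ Z ⟶ M) : act f u = g ▷ Z ≫ u := by
  rw [act, pull_eq_iff.2 h]

variable {ι : Type} [Fintype ι]

theorem constSmulD_mul {Y : C} (c c' : k) (d : Y ⟶ D R) :
    (constSmulD c d ≫ incl R) * (constSmulD c' d ≫ incl R) = 0 := by
  simp only [constSmulD, smulD_incl]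
  rw [mul_mul_mul_comm, sq_zero, mul_zero]

variable (R) in
/-- The line `d ↦ (c_i d)` in `D(ι)`. -/
def slope (c : ι → k) : D R ⟶ Dfirst R ι :=
  mkDfirst (fun i => constSmulD (c i) (𝟙 (D R))) fun _ _ => constSmulD_mul _ _ _

/-- Axes and diagonal are both lines through the origin with constant slopes, so the single family
`slopeHom` handles restriction and summation. -/
theorem axis_eq_slope [DecidableEq ι] (i : ι) : axis R i = slope R (Pi.single i (1 : k)) := by
  refine Dfirst_hom_ext fun j => D_hom_ext ?_
  rw [axis, mkDfirst_comp, slope, mkDfirst_comp]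
  by_cases h : j = i
  · subst h
    simp [constSmulD]
  · simp [constSmulD, h]

theorem diagonal_eq_slope : diagonal R ι = slope R (1 : ι → k) := by
  refine Dfirst_hom_ext fun j => D_hom_ext ?_
  rw [diagonal, mkDfirst_comp, slope, mkDfirst_comp]
  simp [constSmulD]

theorem slope_char (c : ι → k) (a : TrivSqZeroExt k (ι → k)) :
    slope R c ≫ firstChar k R ι a = lineChar k R (slopeHom c a) := by
  rw [firstChar_apply, lineChar_apply, slopeHom_fst, slopeHom_snd, comp_add', comp_algebraMap,
    comp_sum']
  congr 1
  rw [map_sum, Finset.sum_mul]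
  refine Finset.sum_congr rfl fun i _ => ?_
  rw [comp_smul', ← Category.assoc, slope, mkDfirst_comp, constSmulD, smulD_incl, Category.id_comp,
    Algebra.smul_def, map_mul, mul_assoc]

theorem act_slopeHom (c : ι → k) (u : Dfirst R ι ⊗ Z ⟶ M) :
    act (A := first k R ι) (B := line k R) (slopeHom c) u = slope R c ▷ Z ≫ u :=
  act_eq (A := first k R ι) (B := line k R) (slope_char c) u

/-- The base point of a tangent vector. -/
def tanBase (t : D R ⊗ Z ⟶ M) : Z ⟶ M := lift (zeroD R Z) (𝟙 Z) ≫ t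

theorem zeroD_char (a : DualNumber k) : zeroD R (𝟙_ C) ≫ lineChar k R a =
    algebraMap k (𝟙_ C ⟶ R) a.fst := by
  rw [lineChar_apply, comp_add', comp_mul', comp_algebraMap, zeroD_incl, mul_zero, add_zero]

theorem base_line (t : D R ⊗ Z ⟶ M) : base (A := line k R) t = zeroD R (𝟙_ C) ▷ Z ≫ t := by
  change act (aug (line k R)) t = _
  rw [aug_unique (aug (line k R)) (fstHom k k k)]
  exact act_eq (A := line k R) (B := point k R) (f := fstHom k k k) (g := zeroD R (𝟙_ C))
    (fun a => zeroD_char a) t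

/-- Reconciles the two notions of base point: `base` is a map on `𝟙_ C ⊗ Z`, `tanBase` a map on `Z`.
-/
theorem zeroD_whisker {t : D R ⊗ Z ⟶ M} {b : Z ⟶ M} :
    zeroD R (𝟙_ C) ▷ Z ≫ t = snd _ _ ≫ b ↔ tanBase t = b := by
  have h₁ : lift (zeroD R Z) (𝟙 Z) = lift (toUnit Z) (𝟙 Z) ≫ zeroD R (𝟙_ C) ▷ Z := by
    ext <;> simp
  constructor
  · intro h
    rw [tanBase, h₁, Category.assoc, h, lift_snd_assoc, Category.id_comp]
  · intro h
    have h₂ : zeroD R (𝟙_ C) ▷ Z = snd (𝟙_ C) Z ≫ lift (zeroD R Z) (𝟙 Z) := by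
      ext <;> simp
    rw [← h, tanBase, h₂, Category.assoc]

theorem base_line_iff {t : D R ⊗ Z ⟶ M} {b : Z ⟶ M} :
    base (A := line k R) t = snd (𝟙_ C) Z ≫ b ↔ tanBase t = b := by
  rw [← zeroD_whisker, ← base_line (k := k)]
  rfl

theorem whisker_dualChar {A B : Type w} [CommRing A] [Algebra k A] [CommRing B] [Algebra k B]
    {S T : C} {χ : A →ₐ[k] (S ⟶ R)} {ξ : B →ₐ[k] (T ⟶ R)} {f : A →ₐ[k] B} {g : T ⟶ S}
    (h : ∀ a, g ≫ χ a = ξ (f a)) (a : DualNumber A) :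
    D R ◁ g ≫ dualChar χ a = dualChar ξ (dualMap f a) := by
  rw [dualChar_apply, dualChar_apply, dualMap_fst, dualMap_snd, comp_add', comp_mul', ← h, ← h]
  simp only [← Category.assoc, whiskerLeft_snd, whiskerLeft_fst]

theorem act_dualMap {A B : WeilSpec k R} {f : A.W →ₐ[k] B.W} {g : B.S ⟶ A.S}
    (h : ∀ a, g ≫ A.χ a = B.χ (f a)) (u : (D R ⊗ A.S) ⊗ Z ⟶ M) :
    act (A := dual A) (B := dual B) (dualMap f) u = (D R ◁ g) ▷ Z ≫ u :=
  act_eq (A := dual A) (B := dual B) (whisker_dualChar h) u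

variable (k R) in
/-- `D²` as a spectrum. -/
abbrev square : WeilSpec k R := dual (line k R)

variable (k R) in
abbrev squareChar : DualNumber (DualNumber k) →ₐ[k] (D R ⊗ D R ⟶ R) := dualChar (lineChar k R)

theorem squareChar_apply (a : DualNumber (DualNumber k)) :
    squareChar k R a = algebraMap k (D R ⊗ D R ⟶ R) a.fst.fst +
      algebraMap k (D R ⊗ D R ⟶ R) a.fst.snd * (snd _ _ ≫ incl R) +
      (algebraMap k (D R ⊗ D R ⟶ R) a.snd.fst +
        algebraMap k (D R ⊗ D R ⟶ R) a.snd.snd * (snd _ _ ≫ incl R)) * (fst _ _ ≫ incl R) := by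
  rw [dualChar_apply, lineChar_apply, lineChar_apply, comp_add', comp_mul', comp_algebraMap,
    comp_algebraMap, comp_add', comp_mul', comp_algebraMap, comp_algebraMap]

theorem comp_wedgeChar {Y : C} (s : Y ⟶ Wedge R) (p : wedgeAlg k) :
    s ≫ wedgeChar k R p = wedgeFun ((s ≫ wedge₁) ≫ incl R) ((s ≫ wedge₂) ≫ incl R)
      ((s ≫ wedge₃) ≫ incl R) p := by
  rw [Category.assoc, Category.assoc, Category.assoc]
  exact map_wedgeFun (restrict k R s) _ _ _ p

theorem wedgeMul_char (p : wedgeAlg k) :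
    wedgeMul R ≫ wedgeChar k R p = squareChar k R (wedgeMulHom k p) := by
  rw [comp_wedgeChar, squareChar_apply, wedgeMulHom_apply, wedgeMul, mkWedge_wedge₁,
    mkWedge_wedge₂, mkWedge_wedge₃, smulD_incl, wedgeFun, p.2.1, p.2.2, map_sub]
  ring

theorem wedgeZero_char (p : wedgeAlg k) :
    wedgeZero R ≫ wedgeChar k R p = squareChar k R (wedgeZeroHom k p) := by
  rw [comp_wedgeChar, squareChar_apply, wedgeZeroHom_apply, wedgeZero, mkWedge_wedge₁,
    mkWedge_wedge₂, mkWedge_wedge₃, zeroD_incl, wedgeFun, map_sub]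
  ring

theorem wedgeAxis_char (p : wedgeAlg k) :
    wedgeAxis R ≫ wedgeChar k R p = lineChar k R (wedgeAxisHom k p) := by
  rw [comp_wedgeChar, lineChar_apply, wedgeAxis, mkWedge_wedge₁, mkWedge_wedge₂, mkWedge_wedge₃,
    zeroD_incl, wedgeFun, wedgeAxisHom_fst, wedgeAxisHom_snd, Category.id_comp]
  ring

variable (R) in
/-- The interchange of the factors of `D²`. -/
def swapD : D R ⊗ D R ⟶ D R ⊗ D R := lift (snd _ _) (fst _ _)

theorem swap_char (a : DualNumber (DualNumber k)) :
    swapD R ≫ squareChar k R a = squareChar k R (swapHom k a) := by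
  rw [squareChar_apply, squareChar_apply, swapHom_apply, swapD]
  simp only [comp_add', comp_mul', comp_algebraMap, ← Category.assoc, lift_fst, lift_snd,
    mkDual_fst, mkDual_snd]
  ring

variable (R) in
/-- The cyclic permutation `(d_1, d_2, d_3) ↦ (d_2, d_3, d_1)`. -/
def cycleD : D R ⊗ (D R ⊗ D R) ⟶ D R ⊗ (D R ⊗ D R) :=
  lift (snd _ _ ≫ fst _ _) (lift (snd _ _ ≫ snd _ _) (fst _ _))

variable (k R) in
/-- `D³` as a spectrum. -/
abbrev cube : WeilSpec k R := dual (square k R)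

variable (k R) in
abbrev cubeChar : DualNumber (DualNumber (DualNumber k)) →ₐ[k] (D R ⊗ (D R ⊗ D R) ⟶ R) :=
  dualChar (k := k) (R := R) (W := DualNumber (DualNumber k)) (S := D R ⊗ D R) (squareChar k R)

theorem cubeChar_apply (a : DualNumber (DualNumber (DualNumber k))) :
    cubeChar k R a = (snd _ _ ≫ squareChar k R a.fst) +
        (snd _ _ ≫ squareChar k R a.snd) * (fst _ _ ≫ incl R) := dualChar_apply _ _

theorem cycle_char (a : DualNumber (DualNumber (DualNumber k))) :
    cycleD R ≫ cubeChar k R a = cubeChar k R (cycleHom k a) := by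
  rw [cubeChar_apply, cubeChar_apply, squareChar_apply, squareChar_apply, squareChar_apply,
    squareChar_apply, cycleHom_apply, cycleD]
  simp only [comp_add', comp_mul', comp_algebraMap, ← Category.assoc, lift_fst, lift_snd,
    mkDual_fst, mkDual_snd]
  ring

theorem act_wedgeMulHom (u : Wedge R ⊗ Z ⟶ M) :
    act (A := wedge k R) (B := square k R) (wedgeMulHom k) u = wedgeMul R ▷ Z ≫ u :=
  act_eq (A := wedge k R) (B := square k R) wedgeMul_char u

theorem act_wedgeZeroHom (u : Wedge R ⊗ Z ⟶ M) :
    act (A := wedge k R) (B := square k R) (wedgeZeroHom k) u = wedgeZero R ▷ Z ≫ u :=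
  act_eq (A := wedge k R) (B := square k R) wedgeZero_char u

theorem act_wedgeAxisHom (u : Wedge R ⊗ Z ⟶ M) :
    act (A := wedge k R) (B := line k R) (wedgeAxisHom k) u = wedgeAxis R ▷ Z ≫ u :=
  act_eq (A := wedge k R) (B := line k R) wedgeAxis_char u

theorem act_swapHom (u : (D R ⊗ D R) ⊗ Z ⟶ M) :
    act (A := square k R) (B := square k R) (swapHom k) u = swapD R ▷ Z ≫ u :=
  act_eq (A := square k R) (B := square k R) swap_char u

theorem act_cycleHom (u : (D R ⊗ (D R ⊗ D R)) ⊗ Z ⟶ M) :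
    act (A := cube k R) (B := cube k R) (cycleHom k) u = cycleD R ▷ Z ≫ u :=
  act_eq (A := cube k R) (B := cube k R) cycle_char u

theorem act_dual_slope (c : ι → k) (u : (D R ⊗ Dfirst R ι) ⊗ Z ⟶ M) :
    act (A := dual (first k R ι)) (B := square k R) (dualMap (slopeHom c)) u =
      (D R ◁ slope R c) ▷ Z ≫ u :=
  act_dualMap (A := first k R ι) (B := line k R) (slope_char c) u

theorem firstAxis_char (a : DualNumber (DualNumber k)) :
    lift (𝟙 (D R)) (zeroD R (D R)) ≫ squareChar k R a =
      lineChar k R (dualMap (fstHom k k k) a) := by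
  rw [squareChar_apply, lineChar_apply, dualMap_fst, dualMap_snd]
  simp only [comp_add', comp_mul', comp_algebraMap, ← Category.assoc, lift_fst, lift_snd,
    zeroD_incl, mul_zero, add_zero, Category.id_comp, fstHom_apply]

theorem secondAxis_char (a : DualNumber (DualNumber k)) :
    lift (zeroD R (D R)) (𝟙 (D R)) ≫ squareChar k R a =
      lineChar k R (fstHom k (DualNumber k) (DualNumber k) a) := by
  rw [squareChar_apply, lineChar_apply]
  simp only [comp_add', comp_mul', comp_algebraMap, ← Category.assoc, lift_fst, lift_snd,
    zeroD_incl, mul_zero, add_zero, Category.id_comp, fstHom_apply]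

theorem act_firstAxis (u : (D R ⊗ D R) ⊗ Z ⟶ M) :
    act (A := square k R) (B := line k R) (dualMap (fstHom k k k)) u =
      lift (𝟙 (D R)) (zeroD R (D R)) ▷ Z ≫ u :=
  act_eq (A := square k R) (B := line k R) firstAxis_char u

theorem act_secondAxis (u : (D R ⊗ D R) ⊗ Z ⟶ M) :
    act (A := square k R) (B := line k R) (fstHom k (DualNumber k) (DualNumber k)) u =
      lift (zeroD R (D R)) (𝟙 (D R)) ▷ Z ≫ u :=
  act_eq (A := square k R) (B := line k R) secondAxis_char u

end Morphisms

end WeilSpec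

end

end SDG

namespace SDG

noncomputable section

/-! ### Existence and uniqueness of maps on `D(ι)` and on `D² ∨ D`. -/

namespace WeilSpec

open TrivSqZeroExt

variable {C : Type u} [Category.{v} C] [CartesianMonoidalCategory C] [BraidedCategory C]
  [HasFiniteLimits C] {k : Type w} [Field k] {R : C} [CommRingObj R] [AlgObj k R] {M Z : C}
  {ι κ : Type} [Fintype ι] [Fintype κ]

/-- The augmentation, with values in `k`. -/
def augHom (A : WeilSpec k R) : A.W →ₐ[k] k := aug A

theorem fst_hom_eq_aug {A : WeilSpec k R} {V : Type w} [AddCommGroup V] [Module k V]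
    [Module kᵐᵒᵖ V] [IsCentralScalar k V] (f : A.W →ₐ[k] TrivSqZeroExt k V) (a : A.W) :
    (f a).fst = augHom A a :=
  DFunLike.congr_fun (aug_unique ((fstHom k k V).comp f) (aug A)) a

/-- A family of tangent vectors of a Weil algebra, as a homomorphism. -/
def firstLift {A : WeilSpec k R} (τ : ι → (A.W →ₐ[k] DualNumber k)) :
    A.W →ₐ[k] TrivSqZeroExt k (ι → k) where
  toFun a := inl (augHom A a) + inr fun i => (τ i a).snd
  map_one' := by ext <;> simp
  map_zero' := by ext <;> simp
  map_add' a b := by ext <;> simp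
  commutes' c := by ext <;> simp [algebraMap_eq_inl']
  -- Every `τ i` has the augmentation as first component, so the second components all obey the same
  -- Leibniz rule.
  map_mul' a b := by
    ext
    · simp
    · simp [fst_hom_eq_aug, mul_comm]

theorem slopeHom_firstLift [DecidableEq ι] {A : WeilSpec k R} (τ : ι → (A.W →ₐ[k] DualNumber k))
    (i : ι) (a : A.W) : slopeHom (Pi.single i 1) (firstLift τ a) = τ i a := by
  ext
  · simp [firstLift, fst_hom_eq_aug]
  · simp [firstLift, Pi.single_apply]

/-- The augmentation and the axes are jointly injective on the algebra of `D(ι)`. Base points are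
compared separately because `ι` may be empty. -/
theorem first_hom_ext (hM : Microlinear k R M) [DecidableEq ι] {l l' : Dfirst R ι ⊗ Z ⟶ M}
    (hb : base (A := first k R ι) l = base (A := first k R ι) l')
    (h : ∀ i, axis R i ▷ Z ≫ l = axis R i ▷ Z ≫ l') : l = l' := by
  refine act_injective (A := first k R ι) hM (ι := Option ι)
    (V := fun | none => point k R | some _ => line k R)
    (fun | none => aug (first k R ι) | some i => slopeHom (Pi.single i 1)) ?_ ?_
  · intro (a : TrivSqZeroExt k (ι → k)) (a' : TrivSqZeroExt k (ι → k)) haa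
    have h₀ : ∀ a : TrivSqZeroExt k (ι → k), aug (first k R ι) a = a.fst := fun a =>
      DFunLike.congr_fun (aug_unique (aug (first k R ι)) (fstHom k k (ι → k))) a
    have h₁ := haa none
    dsimp only at h₁
    rw [h₀, h₀] at h₁
    refine TrivSqZeroExt.ext h₁ (funext fun i => ?_)
    have h₂ : (slopeHom (Pi.single i 1) a).snd = (slopeHom (Pi.single i 1) a').snd :=
      congrArg TrivSqZeroExt.snd (haa (some i))
    rw [slopeHom_snd, slopeHom_snd] at h₂
    simpa [Pi.single_apply] using h₂
  · rintro (_ | i)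
    · exact hb
    · exact (act_slopeHom _ l).trans (by
        rw [← axis_eq_slope, h, axis_eq_slope (k := k)]; exact (act_slopeHom _ l').symm)

/-- All `t i` come from one generic element by homomorphisms to `k[ε]`, which `firstLift` assembles
into one. -/
theorem exists_first (hM : Microlinear k R M) [DecidableEq ι] {b : Z ⟶ M}
    {t : ι → (D R ⊗ Z ⟶ M)} (ht : ∀ i, tanBase (t i) = b) :
    ∃ l : Dfirst R ι ⊗ Z ⟶ M, base (A := first k R ι) l = snd (𝟙_ C) Z ≫ b ∧
      ∀ i, axis R i ▷ Z ≫ l = t i := by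
  obtain ⟨A, u, τ, hb, -, hτ⟩ := exists_generic hM (snd (𝟙_ C) Z ≫ b) (fun _ : ι => line k R) t
    fun i => base_line_iff.2 (ht i)
  refine ⟨act (B := first k R ι) (firstLift τ) u, (base_act (B := first k R ι) _ u).trans hb,
    fun i => ?_⟩
  rw [axis_eq_slope (k := k)]
  refine (act_slopeHom _ _).symm.trans ?_
  exact (act_act (B := first k R ι) (E := line k R) (slopeHom_firstLift τ i) u).trans (hτ i)

theorem tanBase_slope {b : Z ⟶ M} {l : Dfirst R ι ⊗ Z ⟶ M}
    (hl : base (A := first k R ι) l = snd (𝟙_ C) Z ≫ b) (c : ι → k) :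
    tanBase (slope R c ▷ Z ≫ l) = b := by
  rw [← base_line_iff (k := k), ← act_slopeHom]
  exact (base_act (A := first k R ι) (B := line k R) _ l).trans hl

/-- The algebra of `D² ∨ D` lies in a product of two copies of that of `D²`, so the two projections
are jointly injective. -/
theorem wedge_hom_ext (hM : Microlinear k R M) {m m' : Wedge R ⊗ Z ⟶ M}
    (h₁ : wedgeMul R ▷ Z ≫ m = wedgeMul R ▷ Z ≫ m')
    (h₂ : wedgeZero R ▷ Z ≫ m = wedgeZero R ▷ Z ≫ m') : m = m' := by
  refine act_injective (A := wedge k R) hM (ι := Bool) (V := fun _ => square k R)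
    (fun | true => wedgeMulHom k | false => wedgeZeroHom k) ?_ ?_
  · intro a a' h
    exact Subtype.ext (Prod.ext (h true) (h false))
  · rintro (_ | _)
    · exact (act_wedgeZeroHom m).trans (h₂.trans (act_wedgeZeroHom m').symm)
    · exact (act_wedgeMulHom m).trans (h₁.trans (act_wedgeMulHom m').symm)

/-- Agreement on the two axes says that the homomorphisms defining the squares differ only in the
coefficient of `ε₁ε₂`, so that together they take values in `wedgeAlg`. -/
theorem exists_wedge (hM : Microlinear k R M) {γ₁ γ₂ : (D R ⊗ D R) ⊗ Z ⟶ M}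
    (h₁ : lift (𝟙 (D R)) (zeroD R (D R)) ▷ Z ≫ γ₁ = lift (𝟙 (D R)) (zeroD R (D R)) ▷ Z ≫ γ₂)
    (h₂ : lift (zeroD R (D R)) (𝟙 (D R)) ▷ Z ≫ γ₁ = lift (zeroD R (D R)) (𝟙 (D R)) ▷ Z ≫ γ₂) :
    ∃ m : Wedge R ⊗ Z ⟶ M, wedgeMul R ▷ Z ≫ m = γ₁ ∧ wedgeZero R ▷ Z ≫ m = γ₂ := by
  replace h₁ := (act_firstAxis (k := k) γ₁).trans (h₁.trans (act_firstAxis (k := k) γ₂).symm)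
  replace h₂ := (act_secondAxis (k := k) γ₁).trans (h₂.trans (act_secondAxis (k := k) γ₂).symm)
  obtain ⟨A, u, θ, -, hu, hθ⟩ := exists_generic hM (base (A := square k R) γ₁)
    (fun _ : Bool => square k R) (fun i => bif i then γ₁ else γ₂) (by
      rintro (_ | _)
      · change base (A := square k R) γ₂ = base (A := square k R) γ₁
        exact ((base_act (A := square k R) (B := line k R) _ γ₂).symm.trans
          (congrArg (base (A := line k R)) h₂.symm)).trans
          (base_act (A := square k R) (B := line k R) _ γ₁)
      · rfl)
  have e₁ : act (θ true) u = γ₁ := hθ true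
  have e₂ : act (θ false) u = γ₂ := hθ false
  have k₁ : ∀ a, dualMap (fstHom k k k) (θ true a) = dualMap (fstHom k k k) (θ false a) :=
    hu.comp_eq (V := line k R) e₁ e₂ _ _ h₁
  have k₂ : ∀ a, fstHom k (DualNumber k) (DualNumber k) (θ true a) =
      fstHom k (DualNumber k) (DualNumber k) (θ false a) :=
    hu.comp_eq (V := line k R) e₁ e₂ _ _ h₂
  let μ : A.W →ₐ[k] wedgeAlg k := AlgHom.codRestrict
    ((θ true : A.W →ₐ[k] DualNumber (DualNumber k)).prod (θ false)) (wedgeAlg k) fun a =>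
      ⟨k₂ a, by
        exact (dualMap_snd _ _).symm.trans ((congrArg TrivSqZeroExt.snd (k₁ a)).trans
          (dualMap_snd _ _))⟩
  refine ⟨act (B := wedge k R) μ u, ?_, ?_⟩
  · refine (act_wedgeMulHom (k := k) _).symm.trans ?_
    exact (act_act (A := A) (B := wedge k R) (E := square k R) (h := θ true) (fun _ => rfl) u).trans
      e₁
  · refine (act_wedgeZeroHom (k := k) _).symm.trans ?_
    exact (act_act (A := A) (B := wedge k R) (E := square k R) (h := θ false) (fun _ => rfl)
      u).trans e₂

end WeilSpec

end

end SDG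

namespace SDG

noncomputable section

open WeilSpec

variable {C : Type u} [Category.{v} C] [CartesianMonoidalCategory C] [BraidedCategory C]
  [HasFiniteLimits C] {k : Type w} [Field k] {R : C} [CommRingObj R] [AlgObj k R] {M Z : C}

/-! ### The module of tangent vectors with a given base point -/

/-- The tangent vectors at `b`. -/
@[ext]
structure Tan (_ : Microlinear k R M) (b : Z ⟶ M) where
  val : D R ⊗ Z ⟶ M
  tanBase_val : tanBase val = b

theorem tanBase_whiskerLeft {Z' : C} (f : Z' ⟶ Z) (t : D R ⊗ Z ⟶ M) :
    tanBase (D R ◁ f ≫ t) = f ≫ tanBase t := by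
  simp only [tanBase, ← Category.assoc]
  congr 1
  apply CartesianMonoidalCategory.hom_ext
  · simp only [lift_whiskerLeft, lift_fst, comp_lift]
    exact (comp_zeroD _).symm
  · simp

theorem WeilSpec.base_whiskerLeft {A : WeilSpec k R} {Z' : C} (f : Z' ⟶ Z) (u : A.S ⊗ Z ⟶ M) :
    base (A := A) (A.S ◁ f ≫ u) = (point k R).S ◁ f ≫ base u := by
  rw [base, base, act, act, whisker_exchange_assoc]

namespace Tan

variable {hM : Microlinear k R M} {b : Z ⟶ M} {ι κ : Type} [Fintype ι] [Fintype κ]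

/-- The map on `D(ι)` with the given restrictions to the axes. -/
def joint (t : ι → Tan hM b) : Dfirst R ι ⊗ Z ⟶ M := by
  classical
  exact (exists_first hM (t := fun i => (t i).1) fun i => (t i).2).choose

theorem base_joint (t : ι → Tan hM b) :
    base (A := first k R ι) (joint t) = snd (𝟙_ C) Z ≫ b := by
  classical
  exact (exists_first hM (t := fun i => (t i).1) fun i => (t i).2).choose_spec.1

theorem axis_joint (t : ι → Tan hM b) (i : ι) : axis R i ▷ Z ≫ joint t = (t i).1 := by
  classical
  exact (exists_first hM (t := fun i => (t i).1) fun i => (t i).2).choose_spec.2 i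

theorem eq_joint {t : ι → Tan hM b} {l : Dfirst R ι ⊗ Z ⟶ M}
    (hb : base (A := first k R ι) l = snd (𝟙_ C) Z ≫ b)
    (h : ∀ i, axis R i ▷ Z ≫ l = (t i).1) : l = joint t := by
  classical
  exact first_hom_ext hM (hb.trans (base_joint t).symm) fun i => by rw [h, axis_joint]

/-- The linear combination `d ↦ l (c_i d)`. -/
def comb (c : ι → k) (t : ι → Tan hM b) : Tan hM b :=
  ⟨slope R c ▷ Z ≫ joint t, tanBase_slope (base_joint t) c⟩

theorem comb_single [DecidableEq ι] (i : ι) (t : ι → Tan hM b) :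
    comb (Pi.single i 1) t = t i := by
  refine Tan.ext ?_
  change slope R _ ▷ Z ≫ joint t = _
  rw [← axis_eq_slope, axis_joint]

/-- The matrix `B` defines a map `D(κ) → D(ι)`, and by uniqueness `joint t` pulls back along it to
the joint map of the combinations. This reduces the module axioms to identities between coefficient
vectors. -/
theorem comb_comb (c : κ → k) (B : κ → ι → k) (t : ι → Tan hM b) :
    comb c (fun j => comb (B j) t) = comb (∑ j, c j • B j) t := by
  classical
  let f : TrivSqZeroExt k (ι → k) →ₐ[k] TrivSqZeroExt k (κ → k) :=
    TrivSqZeroExt.map (LinearMap.pi fun j => Fintype.linearCombination k (B j))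
  have hf : ∀ (c : κ → k) (a : TrivSqZeroExt k (ι → k)),
      slopeHom c (f a) = slopeHom (∑ j, c j • B j) a := by
    intro c a
    ext
    · simp [f]
    · simp [f, Fintype.linearCombination_apply, Finset.mul_sum, Finset.sum_mul]
      rw [Finset.sum_comm]
      refine Finset.sum_congr rfl fun i _ => Finset.sum_congr rfl fun j _ => ?_
      ring
  have hl : act (A := first k R ι) (B := first k R κ) f (joint t) =
      joint fun j => comb (B j) t := by
    refine eq_joint ((base_act (A := first k R ι) (B := first k R κ) f _).trans (base_joint t))
      fun j => ?_
    rw [axis_eq_slope (k := k)]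
    refine (act_slopeHom _ _).symm.trans ?_
    refine (act_act (A := first k R ι) (B := first k R κ) (E := line k R) (hf _) _).trans ?_
    refine (act_slopeHom _ _).trans ?_
    have : ∑ j', (Pi.single j 1 : κ → k) j' • B j' = B j := by
      simp [Pi.single_apply]
    rw [this]
    rfl
  refine Tan.ext ?_
  change slope R c ▷ Z ≫ joint _ = slope R _ ▷ Z ≫ joint t
  rw [← hl]
  refine (act_slopeHom _ _).symm.trans ?_
  refine (act_act (A := first k R ι) (B := first k R κ) (E := line k R) (hf _) _).trans ?_
  exact act_slopeHom _ _

/-- Zero is the empty combination; its joint map is still determined, by the base point. -/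
instance : Zero (Tan hM b) := ⟨comb (0 : Fin 0 → k) Fin.elim0⟩
instance : Add (Tan hM b) := ⟨fun s t => comb 1 ![s, t]⟩
instance : SMul k (Tan hM b) := ⟨fun c t => comb (fun _ : Unit => c) fun _ => t⟩
instance : Neg (Tan hM b) := ⟨fun t => (-1 : k) • t⟩

theorem zero_eq_comb (t : ι → Tan hM b) : 0 = comb 0 t := by
  have h := comb_comb (0 : Fin 0 → k) (fun _ => 0) t
  simp only [Finset.univ_eq_empty, Finset.sum_empty] at h
  rw [← h]
  change comb _ _ = _
  congr 1
  exact Subsingleton.elim _ _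

theorem comb_add_comb (c c' : ι → k) (t : ι → Tan hM b) :
    comb c t + comb c' t = comb (c + c') t := by
  have h := comb_comb (1 : Fin 2 → k) ![c, c'] t
  simp only [Fin.sum_univ_two, Pi.one_apply, one_smul] at h
  change comb 1 ![comb c t, comb c' t] = _
  rw [show c + c' = ![c, c'] 0 + ![c, c'] 1 from rfl, ← h]
  congr 1
  funext j
  fin_cases j <;> rfl

theorem smul_comb (a : k) (c : ι → k) (t : ι → Tan hM b) : a • comb c t = comb (a • c) t := by
  have h := comb_comb (fun _ : Unit => a) (fun _ => c) t
  rw [Finset.univ_unique, Finset.sum_singleton] at h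
  exact h

theorem neg_eq (t : Tan hM b) : -t = (-1 : k) • t := rfl

theorem exists_comb_unit (x : Tan hM b) : ∃ (t : Unit → Tan hM b) (c : Unit → k), x = comb c t :=
  ⟨fun _ => x, Pi.single () 1, (comb_single () fun _ => x).symm⟩

/-- Elements written over one common family can be added coefficientwise. -/
theorem exists_comb_three (x y z : Tan hM b) :
    ∃ (t : Fin 3 → Tan hM b) (c₁ c₂ c₃ : Fin 3 → k),
      x = comb c₁ t ∧ y = comb c₂ t ∧ z = comb c₃ t :=
  ⟨![x, y, z], Pi.single 0 1, Pi.single 1 1, Pi.single 2 1, (comb_single 0 ![x, y, z]).symm,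
    (comb_single 1 ![x, y, z]).symm, (comb_single 2 ![x, y, z]).symm⟩

instance : AddCommGroup (Tan hM b) where
  add_assoc x y z := by
    obtain ⟨t, c₁, c₂, c₃, rfl, rfl, rfl⟩ := exists_comb_three x y z
    simp only [comb_add_comb, add_assoc]
  zero_add x := by
    obtain ⟨t, c, rfl⟩ := exists_comb_unit x
    rw [zero_eq_comb t, comb_add_comb, zero_add]
  add_zero x := by
    obtain ⟨t, c, rfl⟩ := exists_comb_unit x
    rw [zero_eq_comb t, comb_add_comb, add_zero]
  neg_add_cancel x := by
    obtain ⟨t, c, rfl⟩ := exists_comb_unit x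
    rw [neg_eq, zero_eq_comb t, smul_comb, comb_add_comb, neg_one_smul, neg_add_cancel]
  add_comm x y := by
    obtain ⟨t, c₁, c₂, -, rfl, rfl, -⟩ := exists_comb_three x y y
    simp only [comb_add_comb, add_comm]
  nsmul := nsmulRec
  zsmul := zsmulRec

instance : Module k (Tan hM b) where
  one_smul x := by
    obtain ⟨t, c, rfl⟩ := exists_comb_unit x
    rw [smul_comb, one_smul]
  mul_smul a a' x := by
    obtain ⟨t, c, rfl⟩ := exists_comb_unit x
    simp only [smul_comb, mul_smul]
  smul_zero a := by
    rw [zero_eq_comb (fun i : Fin 0 => (i.elim0 : Tan hM b)), smul_comb, smul_zero]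
  smul_add a x y := by
    obtain ⟨t, c₁, c₂, -, rfl, rfl, -⟩ := exists_comb_three x y y
    simp only [comb_add_comb, smul_comb, smul_add]
  add_smul a a' x := by
    obtain ⟨t, c, rfl⟩ := exists_comb_unit x
    simp only [comb_add_comb, smul_comb, add_smul]
  zero_smul x := by
    obtain ⟨t, c, rfl⟩ := exists_comb_unit x
    rw [zero_eq_comb t, smul_comb, zero_smul]

theorem comb_eq_sum (c : ι → k) (t : ι → Tan hM b) : comb c t = ∑ i, c i • t i := by
  classical
  let L : (ι → k) →ₗ[k] Tan hM b :=
    { toFun := fun c => comb c t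
      map_add' := fun c c' => (comb_add_comb c c' t).symm
      map_smul' := fun a c => (smul_comb a c t).symm }
  have h : c = ∑ i, c i • (Pi.single i 1 : ι → k) := pi_eq_sum_univ' c
  change L c = _
  conv_lhs => rw [h]
  rw [map_sum]
  refine Finset.sum_congr rfl fun i _ => ?_
  rw [map_smul]
  congr 1
  exact comb_single i t

/-- A map between modules of tangent vectors that commutes with linear combinations is linear. -/
def linearOfComb {Z' : C} {b' : Z' ⟶ M} (f : Tan hM b → Tan hM b')
    (h : ∀ (n : ℕ) (c : Fin n → k) (t : Fin n → Tan hM b), f (comb c t) = comb c fun i => f (t i)) :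
    Tan hM b →ₗ[k] Tan hM b' where
  toFun := f
  map_add' x y := by
    have := h 2 1 ![x, y]
    rw [comb_eq_sum, comb_eq_sum] at this
    simpa [Fin.sum_univ_two] using this
  map_smul' a x := by
    have := h 1 (fun _ => a) (fun _ => x)
    rw [comb_eq_sum, comb_eq_sum] at this
    simpa using this

/-- Multiplication by `c` followed by the only axis of `D(1)` is the line of slope `c`. -/
theorem smul_val (c : k) (t : Tan hM b) : (c • t).1 = tanSmul c t.1 := by
  have h₀ : (c • t).1 = slope R (fun _ : Unit => c) ▷ Z ≫ joint (fun _ : Unit => t) := rfl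
  have h₁ := axis_joint (fun _ : Unit => t) ()
  have h₂ : constSmulD c (𝟙 (D R)) ≫ axis R () = slope R (fun _ : Unit => c) := by
    refine Dfirst_hom_ext fun j => ?_
    rw [axis, WeilSpec.slope, Category.assoc, mkDfirst_comp, mkDfirst_comp]
    simp
  rw [h₀, tanSmul, ← h₁, ← h₂]
  simp

theorem tanBase_snd (b : Z ⟶ M) : tanBase (snd (D R) Z ≫ b) = b := by
  simp [tanBase]

theorem zero_val : (0 : Tan hM b).1 = snd (D R) Z ≫ b := by
  have h := smul_val (hM := hM) (0 : k) (⟨snd (D R) Z ≫ b, tanBase_snd b⟩ : Tan hM b)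
  rw [zero_smul k] at h
  rw [h]
  simp [tanSmul]

theorem isTanSum_iff (t : ι → Tan hM b) [Nonempty ι] (s : D R ⊗ Z ⟶ M) :
    IsTanSum (fun i => (t i).1) s ↔ s = (∑ i, t i : Tan hM b).1 := by
  have h₁ : (∑ i, t i : Tan hM b) = comb 1 t := by
    rw [comb_eq_sum]; simp
  rw [h₁]
  change _ ↔ s = slope R 1 ▷ Z ≫ joint t
  rw [← diagonal_eq_slope]
  constructor
  · rintro ⟨l, hl, rfl⟩
    rw [eq_joint (k := k) (l := l) ?_ hl]
    -- The map `l` of `IsTanSum` comes without a condition on its base point; any one axis supplies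
    -- it.
    have i := Classical.arbitrary ι
    classical
    have hi := hl i
    rw [axis_eq_slope (k := k), ← act_slopeHom] at hi
    exact ((base_act (A := first k R ι) (B := line k R) _ l).symm.trans
      (congrArg (base (A := line k R)) hi)).trans (base_line_iff.2 (t i).2)
  · rintro rfl
    exact ⟨joint t, axis_joint t, rfl⟩

/-- Change of stage. -/
def pullback {Z' : C} (f : Z' ⟶ Z) {b' : Z' ⟶ M} (hf : f ≫ b = b') : Tan hM b →ₗ[k] Tan hM b' :=
  linearOfComb (fun t => ⟨D R ◁ f ≫ t.1, (tanBase_whiskerLeft f t.1).trans (by rw [t.2, hf])⟩)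
    fun n c t => by
      refine Tan.ext ?_
      have h : Dfirst R (Fin n) ◁ f ≫ joint t =
          joint fun i => (⟨D R ◁ f ≫ (t i).1,
            (tanBase_whiskerLeft f (t i).1).trans (by rw [(t i).2, hf])⟩ : Tan hM b') := by
        refine eq_joint ?_ fun i => ?_
        · refine (base_whiskerLeft (A := first k R (Fin n)) f (joint t)).trans ?_
          rw [base_joint, ← hf]
          exact whiskerLeft_snd_assoc _ _ _
        · rw [← whisker_exchange_assoc, axis_joint]
      change D R ◁ f ≫ slope R c ▷ Z ≫ joint t = slope R c ▷ Z' ≫ joint _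
      rw [← h, whisker_exchange_assoc]

theorem pullback_val {Z' : C} (f : Z' ⟶ Z) {b' : Z' ⟶ M} (hf : f ≫ b = b') (t : Tan hM b) :
    (pullback f hf t).1 = D R ◁ f ≫ t.1 := rfl

/-- The line of slope `0` exists even for empty `ι`, where no axis is at hand to test the base
point. -/
theorem base_first_iff {l : Dfirst R ι ⊗ Z ⟶ M} : base (A := first k R ι) l = snd (𝟙_ C) Z ≫ b ↔
    tanBase (slope R (0 : ι → k) ▷ Z ≫ l) = b := by
  refine ⟨fun h => tanBase_slope h 0, fun h => ?_⟩
  rw [← base_line_iff (k := k), ← act_slopeHom] at h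
  exact (base_act (A := first k R ι) (B := line k R) _ l).symm.trans h

/-- `(d, z) ↦ (a(z) s(d, z), z)`, for `s` in `D(ι)`. -/
def scaleFirst (ι : Type) [Finite ι] (a : Z ⟶ R) : Dfirst R ι ⊗ Z ⟶ Dfirst R ι ⊗ Z :=
  lift (mkDfirst (fun i => smulD (snd (Dfirst R ι) Z ≫ a) (fst (Dfirst R ι) Z ≫ dfirstComp i))
    fun i j => by
      rw [smulD_incl, smulD_incl, mul_mul_mul_comm, Category.assoc, Category.assoc,
        ← comp_mul' (fst (Dfirst R ι) Z), dfirstComp_mul, comp_zero', mul_zero]) (snd _ _)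

/-- `(d, z) ↦ (a(z) d, z)`. -/
def scaleLine (a : Z ⟶ R) : D R ⊗ Z ⟶ D R ⊗ Z :=
  lift (smulD (snd (D R) Z ≫ a) (fst (D R) Z)) (snd _ _)

theorem tanBase_scaleLine (a : Z ⟶ R) (t : D R ⊗ Z ⟶ M) :
    tanBase (scaleLine a ≫ t) = tanBase t := by
  simp only [tanBase, scaleLine, ← Category.assoc]
  congr 1
  apply CartesianMonoidalCategory.hom_ext
  · apply D_hom_ext
    simp [comp_smulD]
  · simp

theorem slope_scaleFirst (c : ι → k) (a : Z ⟶ R) :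
    slope R c ▷ Z ≫ scaleFirst ι a = scaleLine a ≫ slope R c ▷ Z := by
  apply CartesianMonoidalCategory.hom_ext
  · refine Dfirst_hom_ext fun i => D_hom_ext ?_
    have h : slope R c ≫ dfirstComp i = constSmulD (c i) (𝟙 (D R)) := mkDfirst_comp _ _ _
    simp only [scaleFirst, scaleLine, Category.assoc, lift_fst_assoc, lift_fst, mkDfirst_comp,
      comp_smulD, whiskerRight_snd_assoc, whiskerRight_fst_assoc, whiskerRight_fst, h,
      Category.comp_id, smulD_incl, constSmulD]
    simp [comp_mul', comp_algebraMap]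
    ring
  · simp [scaleFirst, scaleLine]

/-- Multiplication by an element of `R`. -/
def scale (a : Z ⟶ R) : Tan hM b →ₗ[k] Tan hM b :=
  linearOfComb (fun t => ⟨scaleLine a ≫ t.1, (tanBase_scaleLine a t.1).trans t.2⟩)
    fun n c t => by
      refine Tan.ext ?_
      have h : scaleFirst (Fin n) a ≫ joint t =
          joint fun i => (⟨scaleLine a ≫ (t i).1,
            (tanBase_scaleLine a (t i).1).trans (t i).2⟩ : Tan hM b) := by
        refine eq_joint ?_ fun i => ?_
        · rw [base_first_iff, ← Category.assoc, slope_scaleFirst, Category.assoc,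
            tanBase_scaleLine, ← base_first_iff, base_joint]
        · rw [axis_eq_slope (k := k), ← Category.assoc, slope_scaleFirst, Category.assoc,
            ← axis_eq_slope, axis_joint]
      change scaleLine a ≫ slope R c ▷ Z ≫ joint t = slope R c ▷ Z ≫ joint _
      rw [← h, ← Category.assoc, ← Category.assoc, slope_scaleFirst]

theorem scale_val (a : Z ⟶ R) (t : Tan hM b) : (scale a t).1 = scaleLine a ≫ t.1 := rfl

end Tan

end

end SDG

namespace SDG

noncomputable section

open WeilSpec

variable {C : Type u} [Category.{v} C] [CartesianMonoidalCategory C] [BraidedCategory C]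
  [HasFiniteLimits C] {k : Type w} [Field k] {R : C} [CommRingObj R] [AlgObj k R] {M Z : C}

/-! ### Strong differences -/

theorem IsStrongDiff.whiskerLeft {γ₁ γ₂ : (D R ⊗ D R) ⊗ Z ⟶ M} {t : D R ⊗ Z ⟶ M}
    (h : IsStrongDiff γ₁ γ₂ t) {Z' : C} (f : Z' ⟶ Z) :
    IsStrongDiff ((D R ⊗ D R) ◁ f ≫ γ₁) ((D R ⊗ D R) ◁ f ≫ γ₂) (D R ◁ f ≫ t) := by
  obtain ⟨m, rfl, rfl, rfl⟩ := h
  exact ⟨Wedge R ◁ f ≫ m, (whisker_exchange_assoc _ _ _).symm, (whisker_exchange_assoc _ _ _).symm,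
    (whisker_exchange_assoc _ _ _).symm⟩

theorem IsStrongDiff.unique (hM : Microlinear k R M) {γ₁ γ₂ : (D R ⊗ D R) ⊗ Z ⟶ M}
    {t t' : D R ⊗ Z ⟶ M} (h : IsStrongDiff γ₁ γ₂ t) (h' : IsStrongDiff γ₁ γ₂ t') : t = t' := by
  obtain ⟨m, h₁, h₂, rfl⟩ := h
  obtain ⟨m', h₁', h₂', rfl⟩ := h'
  rw [wedge_hom_ext hM (h₁.trans h₁'.symm) (h₂.trans h₂'.symm)]

theorem base_wedge {b : Z ⟶ M} {m : Wedge R ⊗ Z ⟶ M} (h : tanBase (wedgeAxis R ▷ Z ≫ m) = b) :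
    base (A := wedge k R) m = snd (𝟙_ C) Z ≫ b :=
  ((base_act (A := wedge k R) (B := line k R) (wedgeAxisHom k) m).symm.trans
    (congrArg (base (A := line k R)) (act_wedgeAxisHom m))).trans (base_line_iff.2 h)

theorem base_wedgeMul (m : Wedge R ⊗ Z ⟶ M) :
    base (A := square k R) (wedgeMul R ▷ Z ≫ m) = base (A := wedge k R) m :=
  (congrArg (base (A := square k R)) (act_wedgeMulHom m)).symm.trans
    (base_act (A := wedge k R) (B := square k R) (wedgeMulHom k) m)

theorem base_wedgeZero (m : Wedge R ⊗ Z ⟶ M) :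
    base (A := square k R) (wedgeZero R ▷ Z ≫ m) = base (A := wedge k R) m :=
  (congrArg (base (A := square k R)) (act_wedgeZeroHom m)).symm.trans
    (base_act (A := wedge k R) (B := square k R) (wedgeZeroHom k) m)

namespace Tan

variable {hM : Microlinear k R M} {b : Z ⟶ M} {ι : Type} [Fintype ι]

/-- The criterion for linear relations between tangent vectors: when all of them are images of one
`u`, it is enough to compare the coefficients of `ε`. The homomorphism `firstLift τ` takes `u` to
`joint t`, and the slope `c` then produces the combination. -/
theorem eq_comb_of_snd {A : WeilSpec k R} {u : A.S ⊗ Z ⟶ M} (hu : base u = snd (𝟙_ C) Z ≫ b)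
    {τ : ι → (A.W →ₐ[k] DualNumber k)} {τ' : A.W →ₐ[k] DualNumber k} {t : ι → Tan hM b}
    {t' : Tan hM b} (h : ∀ i, act (B := line k R) (τ i) u = (t i).1)
    (h' : act (B := line k R) τ' u = t'.1) (c : ι → k)
    (hs : ∀ a, (τ' a).snd = ∑ i, (τ i a).snd * c i) : t' = ∑ i, c i • t i := by
  classical
  have hl : act (B := first k R ι) (firstLift τ) u = joint t :=
    eq_joint ((base_act (B := first k R ι) _ u).trans hu) fun i => by
      rw [axis_eq_slope (k := k)]
      refine (act_slopeHom _ _).symm.trans ?_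
      exact (act_act (B := first k R ι) (E := line k R) (slopeHom_firstLift τ i) u).trans (h i)
  rw [← comb_eq_sum]
  refine Tan.ext (h'.symm.trans ?_)
  change _ = WeilSpec.slope R c ▷ Z ≫ joint t
  rw [← hl]
  refine Eq.trans ?_ (act_slopeHom _ _)
  have hτ : ∀ a, slopeHom c (firstLift τ a) = τ' a := fun a => by
    refine TrivSqZeroExt.ext ?_ ?_
    · rw [slopeHom_fst, fst_hom_eq_aug, fst_hom_eq_aug]
    · rw [slopeHom_snd, hs]
      simp [firstLift]
  exact (act_act (B := first k R ι) (E := line k R) hτ u).symm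

/-- Strong differences are linear in the second coordinate of the squares. -/
theorem eq_sum_of_isStrongDiff {Γ₁ Γ₂ : (D R ⊗ Dfirst R ι) ⊗ Z ⟶ M} {t : ι → Tan hM b}
    {t' : Tan hM b} (c : ι → k)
    (h : ∀ i, IsStrongDiff ((D R ◁ axis R i) ▷ Z ≫ Γ₁) ((D R ◁ axis R i) ▷ Z ≫ Γ₂) (t i).1)
    (h' : IsStrongDiff ((D R ◁ WeilSpec.slope R c) ▷ Z ≫ Γ₁)
      ((D R ◁ WeilSpec.slope R c) ▷ Z ≫ Γ₂) t'.1) : t' = ∑ i, c i • t i := by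
  classical
  choose m h₁ h₂ h₃ using h
  obtain ⟨m', h₁', h₂', h₃'⟩ := h'
  have hb' : base (A := wedge k R) m' = snd (𝟙_ C) Z ≫ b := base_wedge (by rw [h₃', t'.2])
  have hΓ : ∀ Γ : (D R ⊗ Dfirst R ι) ⊗ Z ⟶ M, base (A := square k R)
      ((D R ◁ WeilSpec.slope R c) ▷ Z ≫ Γ) = base (A := dual (first k R ι)) Γ := fun Γ =>
    (congrArg (base (A := square k R)) (act_dual_slope c Γ)).symm.trans
      (base_act (A := dual (first k R ι)) (B := square k R) (dualMap (slopeHom c)) Γ)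
  -- Both families of squares and all the witnesses of strong differences are made images of one
  -- faithful element.
  obtain ⟨A, u, θ, hu, hf, hθ⟩ := exists_generic hM (snd (𝟙_ C) Z ≫ b)
    (ι := Bool ⊕ Option ι)
    (Sum.elim (fun _ => dual (first k R ι)) fun _ => wedge k R)
    (fun | .inl true => Γ₁ | .inl false => Γ₂ | .inr none => m' | .inr (some i) => m i) (by
      rintro ((_ | _) | (_ | i))
      · exact (hΓ Γ₂).symm.trans ((congrArg (base (A := square k R)) h₂'.symm).trans
          ((base_wedgeZero m').trans hb'))
      · exact (hΓ Γ₁).symm.trans ((congrArg (base (A := square k R)) h₁'.symm).trans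
          ((base_wedgeMul m').trans hb'))
      · exact hb'
      · exact base_wedge (by rw [h₃, (t i).2]))
  let G₁ : A.W →ₐ[k] DualNumber (TrivSqZeroExt k (ι → k)) := θ (.inl true)
  let G₂ : A.W →ₐ[k] DualNumber (TrivSqZeroExt k (ι → k)) := θ (.inl false)
  let μ' : A.W →ₐ[k] wedgeAlg k := θ (.inr none)
  let μ : ι → (A.W →ₐ[k] wedgeAlg k) := fun i => θ (.inr (some i))
  have e₁ : act (B := dual (first k R ι)) G₁ u = Γ₁ := hθ (.inl true)
  have e₂ : act (B := dual (first k R ι)) G₂ u = Γ₂ := hθ (.inl false)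
  have e' : act (B := wedge k R) μ' u = m' := hθ (.inr none)
  have e : ∀ i, act (B := wedge k R) (μ i) u = m i := fun i => hθ (.inr (some i))
  have a₁ : ∀ i, (D R ◁ WeilSpec.slope R (Pi.single i (1 : k))) ▷ Z ≫ Γ₁ = wedgeMul R ▷ Z ≫ m i :=
    fun i => by rw [h₁, axis_eq_slope (k := k)]
  have a₂ : ∀ i, (D R ◁ WeilSpec.slope R (Pi.single i (1 : k))) ▷ Z ≫ Γ₂ =
      wedgeZero R ▷ Z ≫ m i := fun i => by rw [h₂, axis_eq_slope (k := k)]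
  have k₁ : ∀ i a, dualMap (slopeHom (Pi.single i 1)) (G₁ a) = wedgeMulHom k (μ i a) := fun i =>
    hf.comp_eq (B₁ := dual (first k R ι)) (B₂ := wedge k R) (V := square k R) e₁ (e i) _ _
      ((act_dual_slope _ _).trans ((a₁ i).trans (act_wedgeMulHom (m i)).symm))
  have k₂ : ∀ i a, dualMap (slopeHom (Pi.single i 1)) (G₂ a) = wedgeZeroHom k (μ i a) := fun i =>
    hf.comp_eq (B₁ := dual (first k R ι)) (B₂ := wedge k R) (V := square k R) e₂ (e i) _ _
      ((act_dual_slope _ _).trans ((a₂ i).trans (act_wedgeZeroHom (m i)).symm))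
  have k₁' : ∀ a, dualMap (slopeHom c) (G₁ a) = wedgeMulHom k (μ' a) :=
    hf.comp_eq (B₁ := dual (first k R ι)) (B₂ := wedge k R) (V := square k R) e₁ e' _ _
      ((act_dual_slope _ _).trans (h₁'.symm.trans (act_wedgeMulHom m').symm))
  have k₂' : ∀ a, dualMap (slopeHom c) (G₂ a) = wedgeZeroHom k (μ' a) :=
    hf.comp_eq (B₁ := dual (first k R ι)) (B₂ := wedge k R) (V := square k R) e₂ e' _ _
      ((act_dual_slope _ _).trans (h₂'.symm.trans (act_wedgeZeroHom m').symm))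
  refine eq_comb_of_snd hu (τ := fun i => (wedgeAxisHom k).comp (μ i))
    (τ' := (wedgeAxisHom k).comp μ') (fun i => ?_) ?_ c fun a => ?_
  · refine (act_comp (B := wedge k R) (E := line k R) _ _ u).trans ?_
    rw [e]
    exact (act_wedgeAxisHom _).trans (h₃ i)
  · refine (act_comp (B := wedge k R) (E := line k R) _ _ u).trans ?_
    rw [e']
    exact (act_wedgeAxisHom _).trans h₃'
  · rw [AlgHom.comp_apply, wedgeAxisHom_snd]
    have l₁ := congrArg (fun x => x.snd.snd) (k₁' a)
    have l₂ := congrArg (fun x => x.snd.snd) (k₂' a)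
    simp only [dualMap_snd, slopeHom_snd, wedgeMulHom_apply, wedgeZeroHom_apply] at l₁ l₂
    -- The top coefficient along the slope `c` is the sum of the top coefficients along the axes,
    -- weighted by `c`, for `Γ₁` and `Γ₂` alike.
    rw [← l₁, ← l₂, ← Finset.sum_sub_distrib]
    refine Finset.sum_congr rfl fun i _ => ?_
    rw [AlgHom.comp_apply, wedgeAxisHom_snd, ← sub_mul]
    have l₁ := congrArg (fun x => x.snd.snd) (k₁ i a)
    have l₂ := congrArg (fun x => x.snd.snd) (k₂ i a)
    simp only [dualMap_snd, slopeHom_snd, wedgeMulHom_apply, wedgeZeroHom_apply] at l₁ l₂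
    rw [← l₁, ← l₂]
    simp [Pi.single_apply]

/-- Interchanging the coordinates fixes the coefficient of `ε₁ε₂`, while exchanging the squares
reverses the difference. -/
theorem eq_neg_of_isStrongDiff {γ₁ γ₂ : (D R ⊗ D R) ⊗ Z ⟶ M} {t t' : Tan hM b}
    (h : IsStrongDiff γ₁ γ₂ t.1)
    (h' : IsStrongDiff (swapD R ▷ Z ≫ γ₂) (swapD R ▷ Z ≫ γ₁) t'.1) : t' = -t := by
  obtain ⟨m, h₁, h₂, h₃⟩ := h
  obtain ⟨m', h₁', h₂', h₃'⟩ := h'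
  obtain ⟨A, u, θ, hu, hf, hθ⟩ := exists_generic hM (snd (𝟙_ C) Z ≫ b)
    (fun _ : Bool => wedge k R) (fun | true => m | false => m') (by
      rintro (_ | _)
      · exact base_wedge (by rw [h₃', t'.2])
      · exact base_wedge (by rw [h₃, t.2]))
  let μ : A.W →ₐ[k] wedgeAlg k := θ true
  let μ' : A.W →ₐ[k] wedgeAlg k := θ false
  have e : act (B := wedge k R) μ u = m := hθ true
  have e' : act (B := wedge k R) μ' u = m' := hθ false
  have k₁ : ∀ a, swapHom k (wedgeMulHom k (μ a)) = wedgeZeroHom k (μ' a) :=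
    hf.comp_eq (B₁ := wedge k R) (B₂ := wedge k R) (V := square k R) e e'
      ((swapHom k).comp (wedgeMulHom k)) (wedgeZeroHom k)
      ((act_comp (A := wedge k R) (B := square k R) (E := square k R) _ _ m).trans
        ((congrArg (act (A := square k R) (B := square k R) (swapHom k))
          ((act_wedgeMulHom m).trans h₁)).trans
          ((act_swapHom γ₁).trans (h₂'.symm.trans (act_wedgeZeroHom m').symm))))
  have k₂ : ∀ a, swapHom k (wedgeZeroHom k (μ a)) = wedgeMulHom k (μ' a) :=
    hf.comp_eq (B₁ := wedge k R) (B₂ := wedge k R) (V := square k R) e e'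
      ((swapHom k).comp (wedgeZeroHom k)) (wedgeMulHom k)
      ((act_comp (A := wedge k R) (B := square k R) (E := square k R) _ _ m).trans
        ((congrArg (act (A := square k R) (B := square k R) (swapHom k))
          ((act_wedgeZeroHom m).trans h₂)).trans
          ((act_swapHom γ₂).trans (h₁'.symm.trans (act_wedgeMulHom m').symm))))
  have key := eq_comb_of_snd (ι := Unit) hu (τ := fun _ => (wedgeAxisHom k).comp μ)
    (τ' := (wedgeAxisHom k).comp μ') (t := fun _ => t) (t' := t') (fun i => by
      refine (act_comp (B := wedge k R) (E := line k R) _ _ u).trans ?_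
      rw [e]
      exact (act_wedgeAxisHom _).trans h₃) (by
      refine (act_comp (B := wedge k R) (E := line k R) _ _ u).trans ?_
      rw [e']
      exact (act_wedgeAxisHom _).trans h₃') (fun _ => -1) fun a => by
      have l₁ := congrArg (fun x => x.snd.snd) (k₁ a)
      have l₂ := congrArg (fun x => x.snd.snd) (k₂ a)
      simp only [swapHom_apply, mkDual_snd, wedgeMulHom_apply, wedgeZeroHom_apply] at l₁ l₂
      rw [Fintype.sum_unique, AlgHom.comp_apply, AlgHom.comp_apply, wedgeAxisHom_snd,
        wedgeAxisHom_snd, ← l₁, ← l₂]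
      ring
  rw [key]
  simp

section Generic

/-! The homomorphisms, with the algebras bundled in the spectra. -/

variable (k R) in
def mulHom : (wedge k R).W →ₐ[k] (square k R).W := wedgeMulHom k

variable (k R) in
def zeroHom : (wedge k R).W →ₐ[k] (square k R).W := wedgeZeroHom k

variable (k R) in
def axisHom : (wedge k R).W →ₐ[k] (line k R).W := wedgeAxisHom k

variable (k R) in
def cubeCycleHom : (cube k R).W →ₐ[k] (cube k R).W := cycleHom k

def dualHom {A B : WeilSpec k R} (f : A.W →ₐ[k] B.W) : (dual A).W →ₐ[k] (dual B).W := dualMap f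

def dualSnd {A : WeilSpec k R} (x : (dual A).W) : A.W := TrivSqZeroExt.snd (R := A.W) (M := A.W) x

theorem dualSnd_dualHom {A B : WeilSpec k R} (f : A.W →ₐ[k] B.W) (x : (dual A).W) :
    dualSnd (dualHom f x) = f (dualSnd x) := dualMap_snd f x

variable (k R) in
def dualMulHom : (dual (wedge k R)).W →ₐ[k] (cube k R).W := dualHom (mulHom k R)

variable (k R) in
def dualZeroHom : (dual (wedge k R)).W →ₐ[k] (cube k R).W := dualHom (zeroHom k R)

variable (k R) in
def dualAxisHom : (dual (wedge k R)).W →ₐ[k] (square k R).W := dualHom (axisHom k R)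

/-! The coefficients of highest degree. -/

def lineTop (x : (line k R).W) : k := TrivSqZeroExt.snd (R := k) (M := k) x

def squareTop (x : (square k R).W) : k := lineTop (R := R) (dualSnd x)

def cubeTop (x : (cube k R).W) : k := squareTop (R := R) (dualSnd x)

/-- The coefficients of `ε₁ε₂ε₃` in the two cubes to which an element over `D × (D² ∨ D)` restricts,
along `wedgeMul` here and along `wedgeZero` in the next definition. -/
def mulTop (x : (dual (wedge k R)).W) : k := squareTop (mulHom k R (dualSnd x))

def zeroTop (x : (dual (wedge k R)).W) : k := squareTop (zeroHom k R (dualSnd x))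

theorem cubeTop_dualMulHom (x : (dual (wedge k R)).W) :
    cubeTop (dualMulHom k R x) = mulTop x :=
  congrArg squareTop (dualSnd_dualHom (mulHom k R) x)

theorem cubeTop_dualZeroHom (x : (dual (wedge k R)).W) :
    cubeTop (dualZeroHom k R x) = zeroTop x :=
  congrArg squareTop (dualSnd_dualHom (zeroHom k R) x)

theorem lineTop_axisHom (x : (wedge k R).W) :
    lineTop (axisHom k R x) = squareTop (mulHom k R x) - squareTop (zeroHom k R x) :=
  wedgeAxisHom_snd (k := k) x

theorem squareTop_dualAxisHom (x : (dual (wedge k R)).W) :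
    squareTop (dualAxisHom k R x) = mulTop x - zeroTop x :=
  (congrArg lineTop (dualSnd_dualHom (axisHom k R) x)).trans (lineTop_axisHom _)

theorem cycleHom_snd_snd_snd (x : DualNumber (DualNumber (DualNumber k))) :
    (cycleHom k x).snd.snd.snd = x.snd.snd.snd := by
  simp [cycleHom_apply]

theorem cubeTop_cubeCycleHom (x : (cube k R).W) : cubeTop (cubeCycleHom k R x) = cubeTop x :=
  cycleHom_snd_snd_snd (k := k) x

theorem act_dualMulHom (m : (D R ⊗ Wedge R) ⊗ Z ⟶ M) :
    act (dualMulHom k R) m = (D R ◁ wedgeMul R) ▷ Z ≫ m :=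
  act_dualMap (A := wedge k R) (B := square k R) wedgeMul_char m

theorem act_dualZeroHom (m : (D R ⊗ Wedge R) ⊗ Z ⟶ M) :
    act (dualZeroHom k R) m = (D R ◁ wedgeZero R) ▷ Z ≫ m :=
  act_dualMap (A := wedge k R) (B := square k R) wedgeZero_char m

theorem act_dualAxisHom (m : (D R ⊗ Wedge R) ⊗ Z ⟶ M) :
    act (dualAxisHom k R) m = (D R ◁ wedgeAxis R) ▷ Z ≫ m :=
  act_dualMap (A := wedge k R) (B := line k R) wedgeAxis_char m

variable {A : WeilSpec k R} {u : A.S ⊗ Z ⟶ M} {m₁ m₂ : (D R ⊗ Wedge R) ⊗ Z ⟶ M}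
  {μ₁ μ₂ : A.W →ₐ[k] (dual (wedge k R)).W}

/-- A permutation of the three coordinates leaves the coefficient of `ε₁ε₂ε₃` unchanged. -/
theorem mulTop_eq_mulTop (hf : Faithful u) (e₁ : act μ₁ u = m₁) (e₂ : act μ₂ u = m₂)
    (h : (D R ◁ wedgeMul R) ▷ Z ≫ m₂ = cycleD R ▷ Z ≫ (D R ◁ wedgeMul R) ▷ Z ≫ m₁) (a : A.W) :
    mulTop (μ₂ a) = mulTop (μ₁ a) := by
  have h₁ : act (dualMulHom k R) m₁ = (D R ◁ wedgeMul R) ▷ Z ≫ m₁ := act_dualMulHom m₁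
  have h₂ : act (dualMulHom k R) m₂ = (D R ◁ wedgeMul R) ▷ Z ≫ m₂ := act_dualMulHom m₂
  have h₃ : act (cubeCycleHom k R) (act (dualMulHom k R) m₁) =
      cycleD R ▷ Z ≫ act (dualMulHom k R) m₁ := act_cycleHom _
  have key := hf.comp_eq e₂ e₁ (dualMulHom k R) ((cubeCycleHom k R).comp (dualMulHom k R))
    ((h₂.trans h).trans ((congrArg (cycleD R ▷ Z ≫ ·) h₁).symm.trans
      (h₃.symm.trans (act_comp _ _ _).symm))) a
  rw [← cubeTop_dualMulHom, key, AlgHom.comp_apply, cubeTop_cubeCycleHom, cubeTop_dualMulHom]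

theorem zeroTop_eq_zeroTop (hf : Faithful u) (e₁ : act μ₁ u = m₁) (e₂ : act μ₂ u = m₂)
    (h : (D R ◁ wedgeZero R) ▷ Z ≫ m₂ = cycleD R ▷ Z ≫ (D R ◁ wedgeZero R) ▷ Z ≫ m₁) (a : A.W) :
    zeroTop (μ₂ a) = zeroTop (μ₁ a) := by
  have h₁ : act (dualZeroHom k R) m₁ = (D R ◁ wedgeZero R) ▷ Z ≫ m₁ := act_dualZeroHom m₁
  have h₂ : act (dualZeroHom k R) m₂ = (D R ◁ wedgeZero R) ▷ Z ≫ m₂ := act_dualZeroHom m₂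
  have h₃ : act (cubeCycleHom k R) (act (dualZeroHom k R) m₁) =
      cycleD R ▷ Z ≫ act (dualZeroHom k R) m₁ := act_cycleHom _
  have key := hf.comp_eq e₂ e₁ (dualZeroHom k R) ((cubeCycleHom k R).comp (dualZeroHom k R))
    ((h₂.trans h).trans ((congrArg (cycleD R ▷ Z ≫ ·) h₁).symm.trans
      (h₃.symm.trans (act_comp _ _ _).symm))) a
  rw [← cubeTop_dualZeroHom, key, AlgHom.comp_apply, cubeTop_cubeCycleHom, cubeTop_dualZeroHom]

/-- An iterated strong difference is an alternating sum of four coefficients of `ε₁ε₂ε₃`. -/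
theorem lineTop_eq (hf : Faithful u) (e₁ : act μ₁ u = m₁) (e₂ : act μ₂ u = m₂)
    {ν : A.W →ₐ[k] (wedge k R).W} {n : Wedge R ⊗ Z ⟶ M}
    (e : act ν u = n) (h₁ : wedgeMul R ▷ Z ≫ n = (D R ◁ wedgeAxis R) ▷ Z ≫ m₁)
    (h₂ : wedgeZero R ▷ Z ≫ n = (D R ◁ wedgeAxis R) ▷ Z ≫ m₂) (a : A.W) :
    lineTop (axisHom k R (ν a)) =
      mulTop (μ₁ a) - zeroTop (μ₁ a) - (mulTop (μ₂ a) - zeroTop (μ₂ a)) := by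
  have k₁ := hf.comp_eq e e₁ (mulHom k R) (dualAxisHom k R)
      ((act_wedgeMulHom n).trans (h₁.trans (act_dualAxisHom m₁).symm)) a
  have k₂ := hf.comp_eq e e₂ (zeroHom k R) (dualAxisHom k R)
      ((act_wedgeZeroHom n).trans (h₂.trans (act_dualAxisHom m₂).symm)) a
  rw [lineTop_axisHom, k₁, k₂, squareTop_dualAxisHom, squareTop_dualAxisHom]

end Generic

theorem base_wedgeAxis_dual (m : (D R ⊗ Wedge R) ⊗ Z ⟶ M) : base (A := square k R)
    ((D R ◁ wedgeAxis R) ▷ Z ≫ m) = base (A := dual (wedge k R)) m :=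
  (congrArg (base (A := square k R)) (act_dualAxisHom m)).symm.trans (base_act (dualAxisHom k R) m)

/-- The general Jacobi identity: the alternating sum of the strong differences of strong differences
of six cubes. -/
theorem sum_eq_zero_of_isStrongDiff {m₁ m₂ : Fin 3 → ((D R ⊗ Wedge R) ⊗ Z ⟶ M)}
    {t : Fin 3 → Tan hM b}
    (h₁ : ∀ c, (D R ◁ wedgeMul R) ▷ Z ≫ m₂ c =
      cycleD R ▷ Z ≫ (D R ◁ wedgeMul R) ▷ Z ≫ m₁ (c + 1))
    (h₂ : ∀ c, (D R ◁ wedgeZero R) ▷ Z ≫ m₁ c =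
      cycleD R ▷ Z ≫ (D R ◁ wedgeZero R) ▷ Z ≫ m₂ (c + 1))
    (ht : ∀ c, IsStrongDiff ((D R ◁ wedgeAxis R) ▷ Z ≫ m₁ c) ((D R ◁ wedgeAxis R) ▷ Z ≫ m₂ c)
      (t c).1) : t 0 + t 1 + t 2 = 0 := by
  choose n n₁ n₂ n₃ using ht
  have hn : ∀ c, base (A := wedge k R) (n c) = snd (𝟙_ C) Z ≫ b := fun c =>
    base_wedge (by rw [n₃, (t c).2])
  obtain ⟨A, u, θ, hu, hf, hθ⟩ := exists_generic hM (snd (𝟙_ C) Z ≫ b)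
    (ι := (Fin 3 ⊕ Fin 3) ⊕ Fin 3)
    (Sum.elim (fun _ => dual (wedge k R)) fun _ => wedge k R)
    (fun | .inl (.inl c) => m₁ c | .inl (.inr c) => m₂ c | .inr c => n c) (by
      rintro ((c | c) | c)
      · exact (base_wedgeAxis_dual (m₁ c)).symm.trans ((congrArg (base (A := square k R))
          (n₁ c).symm).trans ((base_wedgeMul (n c)).trans (hn c)))
      · exact (base_wedgeAxis_dual (m₂ c)).symm.trans ((congrArg (base (A := square k R))
          (n₂ c).symm).trans ((base_wedgeZero (n c)).trans (hn c)))
      · exact hn c)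
  let μ₁ : Fin 3 → (A.W →ₐ[k] (dual (wedge k R)).W) := fun c => θ (.inl (.inl c))
  let μ₂ : Fin 3 → (A.W →ₐ[k] (dual (wedge k R)).W) := fun c => θ (.inl (.inr c))
  let ν : Fin 3 → (A.W →ₐ[k] (wedge k R).W) := fun c => θ (.inr c)
  have e₁ : ∀ c, act (μ₁ c) u = m₁ c := fun c => hθ (.inl (.inl c))
  have e₂ : ∀ c, act (μ₂ c) u = m₂ c := fun c => hθ (.inl (.inr c))
  have e : ∀ c, act (ν c) u = n c := fun c => hθ (.inr c)
  have ht : ∀ c, act ((axisHom k R).comp (ν c)) u = (t c).1 := fun c => by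
    rw [act_comp, e]
    exact (act_wedgeAxisHom _).trans (n₃ c)
  clear_value μ₁ μ₂ ν
  -- The claim is proved in the form `t 0 = 0 • t 0 - t 1 - t 2`, which the criterion covers.
  have key := eq_comb_of_snd hu (τ := fun c => (axisHom k R).comp (ν c)) (t := t) (t' := t 0)
    ht (ht 0) ![0, -1, -1] fun a => by
      have hτ : ∀ c, lineTop (axisHom k R (ν c a)) = _ := fun c =>
        lineTop_eq hf (e₁ c) (e₂ c) (e c) (n₁ c) (n₂ c) a
      have hA : ∀ c, mulTop (μ₂ c a) = mulTop (μ₁ (c + 1) a) := fun c =>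
        mulTop_eq_mulTop hf (e₁ (c + 1)) (e₂ c) (h₁ c) a
      have hB : ∀ c, zeroTop (μ₁ c a) = zeroTop (μ₂ (c + 1) a) := fun c =>
        zeroTop_eq_zeroTop hf (e₂ (c + 1)) (e₁ c) (h₂ c) a
      change lineTop (axisHom k R (ν 0 a)) =
        ∑ c, lineTop (axisHom k R (ν c a)) * (![0, -1, -1] : Fin 3 → k) c
      -- With `a c = mulTop (μ₁ c a)` and `b c = zeroTop (μ₂ c a)`, the coefficient of `t c` is `(a
      -- c + b c) - (a (c+1) + b (c+1))`, so the cyclic sum telescopes to zero.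
      rw [Fin.sum_univ_three, hτ, hτ, hτ, hA, hA, hA, hB, hB, hB, show (0 : Fin 3) + 1 = 1 from rfl,
        show (1 : Fin 3) + 1 = 2 from rfl, show (2 : Fin 3) + 1 = 0 from rfl]
      simp only [Matrix.cons_val, Fin.isValue]
      ring
  rw [Fin.sum_univ_three] at key
  simp only [Matrix.cons_val, Fin.isValue, zero_smul, neg_smul, one_smul, zero_add] at key
  rw [key]
  abel

end Tan

end

end SDG

namespace SDG

noncomputable section

/-! ### Arguments of microcubes and their distribution over two blocks. -/

section Tuples

variable {C : Type u} [Category.{v} C] [CartesianMonoidalCategory C] [BraidedCategory C]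
  [HasFiniteLimits C] {R : C} [CommRingObj R] {M Y Y' : C} {m n p q r N : ℕ}

theorem comp_tuple (d : Fin n → (Y ⟶ D R)) (i : Fin n) : comp (tuple d) i = d i := by
  simp [comp, tuple]

theorem comp_comp (f : Y' ⟶ Y) (d : Y ⟶ Dpow R n) (i : Fin n) : f ≫ comp d i = comp (f ≫ d) i := by
  simp [comp]

theorem Dpow_hom_ext {d d' : Y ⟶ Dpow R n} (h : ∀ i, comp d i = comp d' i) : d = d' :=
  Pi.hom_ext _ _ h

theorem comp_tuple' (f : Y' ⟶ Y) (d : Fin n → (Y ⟶ D R)) :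
    f ≫ tuple d = tuple fun i => f ≫ d i :=
  Dpow_hom_ext fun i => by rw [← comp_comp, comp_tuple, comp_tuple]

theorem tuple_comp (d : Y ⟶ Dpow R n) : tuple (comp d) = d :=
  Dpow_hom_ext fun i => comp_tuple _ _

theorem comp_powMap (f : Y ⟶ Dpow R n) (σ : Fin m → Fin n) :
    f ≫ powMap R σ = tuple fun i => comp f (σ i) := by
  rw [powMap, comp_tuple']
  simp only [comp_comp, Category.comp_id]

theorem lift_whiskerLeft_comp {A B : C} (d : Y ⟶ A) (y : Y ⟶ Y') (f : Y' ⟶ B) (γ : A ⊗ B ⟶ M) :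
    lift d y ≫ A ◁ f ≫ γ = lift d (y ≫ f) ≫ γ := by
  rw [← Category.assoc, lift_whiskerLeft]

theorem whiskerLeft_eq_lift {A B : C} (f : Y ⟶ B) (γ : A ⊗ B ⟶ M) :
    A ◁ f ≫ γ = lift (fst A Y) (snd A Y ≫ f) ≫ γ := by
  congr 1
  apply CartesianMonoidalCategory.hom_ext <;> simp

/-- `(d, e) ↦ γ(…)`, where `ρ` tells for each argument of `γ` which component of `d` or `e` it is. -/
def slice (ρ : Fin N → Fin p ⊕ Fin q) (γ : Dpow R N ⊗ Y ⟶ M) : Dpow R p ⊗ (Dpow R q ⊗ Y) ⟶ M :=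
  lift (tuple fun i => Sum.elim (comp (fst (Dpow R p) (Dpow R q ⊗ Y)))
    (comp (snd (Dpow R p) (Dpow R q ⊗ Y) ≫ fst (Dpow R q) Y)) (ρ i))
    (snd (Dpow R p) (Dpow R q ⊗ Y) ≫ snd (Dpow R q) Y) ≫ γ

theorem lift_slice (ρ : Fin N → Fin p ⊕ Fin q) (γ : Dpow R N ⊗ Y ⟶ M) (d : Y' ⟶ Dpow R p)
    (e : Y' ⟶ Dpow R q) (y : Y' ⟶ Y) : lift d (lift e y) ≫ slice ρ γ =
      lift (tuple fun i => Sum.elim (comp d) (comp e) (ρ i)) y ≫ γ := by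
  rw [slice, ← Category.assoc]
  congr 1
  rw [comp_lift, comp_tuple']
  congr 1
  · congr 1
    funext i
    rcases ρ i with a | a <;> simp [comp_comp]
  · simp

theorem lift_permCube (σ : Fin m → Fin n) (γ : Dpow R m ⊗ Y ⟶ M) (d : Y' ⟶ Dpow R n) (y : Y' ⟶ Y) :
    lift d y ≫ permCube σ γ = lift (tuple fun i => comp d (σ i)) y ≫ γ := by
  rw [permCube, ← Category.assoc, lift_whiskerRight, comp_powMap]

theorem lift_scaleCube (α : Y ⟶ R) (i : Fin n) (γ : Dpow R n ⊗ Y ⟶ M) (d : Y' ⟶ Dpow R n)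
    (y : Y' ⟶ Y) : lift d y ≫ scaleCube α i γ =
      lift (tuple (Function.update (comp d) i (smulD (y ≫ α) (comp d i)))) y ≫ γ := by
  rw [scaleCube, ← Category.assoc]
  congr 1
  rw [comp_lift, comp_tuple', lift_snd]
  congr 2
  funext j
  by_cases h : j = i
  · subst h
    simp [comp_comp]
  · simp [comp_comp, Function.update_of_ne h]

theorem lift_eq_baseCube (γ : Dpow R n ⊗ Y ⟶ M) (y : Y' ⟶ Y) :
    lift (tuple fun _ => zeroD R Y') y ≫ γ = y ≫ baseCube γ := by
  rw [baseCube, ← Category.assoc, comp_lift, comp_tuple', Category.comp_id]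
  simp only [comp_zeroD]

theorem cube_ext {A B : C} {f g : A ⊗ B ⟶ M}
    (h : ∀ (Y : C) (d : Y ⟶ A) (y : Y ⟶ B), lift d y ≫ f = lift d y ≫ g) : f = g := by
  simpa using h _ (fst A B) (snd A B)

theorem cube_ext₂ {A B E : C} {f g : A ⊗ (B ⊗ E) ⟶ M}
    (h : ∀ (Y : C) (d : Y ⟶ A) (e : Y ⟶ B) (y : Y ⟶ E),
      lift d (lift e y) ≫ f = lift d (lift e y) ≫ g) : f = g := by
  have h := h _ (fst A (B ⊗ E)) (snd A (B ⊗ E) ≫ fst B E) (snd A (B ⊗ E) ≫ snd B E)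
  have e : lift (fst A (B ⊗ E)) (lift (snd A (B ⊗ E) ≫ fst B E) (snd A (B ⊗ E) ≫ snd B E)) =
      𝟙 _ := by
    apply CartesianMonoidalCategory.hom_ext
    · simp
    · apply CartesianMonoidalCategory.hom_ext <;> simp
  rwa [e, Category.id_comp, Category.id_comp] at h

theorem slice_whiskerLeft (ρ : Fin N → Fin p ⊕ Fin q) (f : Y' ⟶ Y) (γ : Dpow R N ⊗ Y ⟶ M) :
    Dpow R p ◁ Dpow R q ◁ f ≫ slice ρ γ = slice ρ (Dpow R N ◁ f ≫ γ) := by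
  refine cube_ext₂ fun Z d e y => ?_
  rw [lift_whiskerLeft_comp, lift_whiskerLeft, lift_slice, lift_slice, lift_whiskerLeft_comp]

theorem slice_permCube (ρ : Fin N → Fin p ⊕ Fin q) (σ : Fin m → Fin N) (γ : Dpow R m ⊗ Y ⟶ M) :
    slice ρ (permCube σ γ) = slice (fun i => ρ (σ i)) γ := by
  refine cube_ext₂ fun Z d e y => ?_
  rw [lift_slice, lift_permCube, lift_slice]
  simp only [comp_tuple]

theorem permCube_slice (ρ : Fin N → Fin m ⊕ Fin q) (σ : Fin m → Fin p) (γ : Dpow R N ⊗ Y ⟶ M) :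
    permCube σ (slice ρ γ) = slice (fun i => Sum.map σ id (ρ i)) γ := by
  refine cube_ext₂ fun Z d e y => ?_
  rw [lift_slice, lift_permCube, lift_slice]
  simp only [Sum.elim_map]
  congr 3
  funext i
  rcases ρ i with a | a <;> simp [comp_tuple]

theorem slice_perm_right (ρ : Fin N → Fin p ⊕ Fin m) (σ : Fin m → Fin q)
    (γ : Dpow R N ⊗ Y ⟶ M) :
    Dpow R p ◁ powMap R σ ▷ Y ≫ slice ρ γ = slice (fun i => Sum.map id σ (ρ i)) γ := by
  refine cube_ext₂ fun Z d e y => ?_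
  rw [lift_whiskerLeft_comp, lift_whiskerRight, lift_slice, lift_slice]
  congr 3
  funext i
  rcases ρ i with a | a <;> simp [comp_powMap, comp_tuple]

/-- As `ρ` is injective, `i` is the only argument of `γ` fed by the component `a`, so scaling the
one is scaling the other. -/
theorem slice_scaleCube_left {ρ : Fin N → Fin p ⊕ Fin q} (hρ : Function.Injective ρ) {i : Fin N}
    {a : Fin p} (hi : ρ i = .inl a) (α : Y ⟶ R) (γ : Dpow R N ⊗ Y ⟶ M) :
    slice ρ (scaleCube α i γ) = scaleCube (snd (Dpow R q) Y ≫ α) a (slice ρ γ) := by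
  refine cube_ext₂ fun Z d e y => ?_
  rw [lift_slice, lift_scaleCube, lift_scaleCube, lift_slice]
  congr 3
  funext j
  by_cases hj : j = i
  · subst hj
    simp [hi, comp_tuple]
  · rw [Function.update_of_ne hj, comp_tuple]
    rcases hb : ρ j with b | b
    · have : b ≠ a := fun h => hj (hρ (by rw [hi, hb, h]))
      simp [comp_tuple, Function.update_of_ne this]
    · simp

theorem slice_scaleCube_right {ρ : Fin N → Fin p ⊕ Fin q} (hρ : Function.Injective ρ) {i : Fin N}
    {a : Fin q} (hi : ρ i = .inr a) (α : Y ⟶ R) (γ : Dpow R N ⊗ Y ⟶ M) :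
    slice ρ (scaleCube α i γ) = Dpow R p ◁ lift (tuple (Function.update (comp (fst (Dpow R q) Y)) a
    (smulD (snd (Dpow R q) Y ≫ α) (comp (fst (Dpow R q) Y) a)))) (snd (Dpow R q) Y) ≫
      slice ρ γ := by
  refine cube_ext₂ fun Z d e y => ?_
  rw [lift_slice, lift_scaleCube, lift_whiskerLeft_comp, comp_lift, lift_snd, lift_slice]
  congr 3
  funext j
  by_cases hj : j = i
  · subst hj
    simp [hi, comp_tuple, comp_tuple', comp_comp]
  · rw [Function.update_of_ne hj, comp_tuple]
    rcases hb : ρ j with b | b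
    · simp
    · have : b ≠ a := fun h => hj (hρ (by rw [hi, hb, h]))
      simp [comp_tuple, comp_tuple', comp_comp, Function.update_of_ne this]

/-- Associativity: `h` says that the two iterated distributions send each argument to the same one
of the three blocks. -/
theorem slice_slice {ρ : Fin N → Fin p ⊕ Fin m} {σ : Fin m → Fin q ⊕ Fin r}
    {ρ' : Fin N → Fin n ⊕ Fin r} {σ' : Fin n → Fin p ⊕ Fin q}
    (h : ∀ i, Sum.map id σ (ρ i) = Equiv.sumAssoc _ _ _ (Sum.map σ' id (ρ' i)))
    (γ : Dpow R N ⊗ Y ⟶ M) :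
    Dpow R p ◁ lift (tuple fun i => Sum.elim (comp (fst (Dpow R q) (Dpow R r ⊗ Y)))
      (comp (snd (Dpow R q) (Dpow R r ⊗ Y) ≫ fst (Dpow R r) Y)) (σ i))
      (snd (Dpow R q) (Dpow R r ⊗ Y) ≫ snd (Dpow R r) Y) ≫ slice ρ γ =
      slice σ' (slice ρ' γ) := by
  refine cube_ext₂ fun Z d e y => ?_
  obtain ⟨f, y, rfl⟩ : ∃ f y', y = lift f y' := ⟨y ≫ fst _ _, y ≫ snd _ _, by simp⟩
  rw [lift_whiskerLeft_comp, comp_lift, lift_snd_assoc, lift_snd, lift_slice, lift_slice,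
    lift_slice]
  congr 3
  funext i
  have key : ∀ s t, Sum.map id σ s = Equiv.sumAssoc _ _ _ (Sum.map σ' id t) →
      Sum.elim (comp d) (comp (lift e (lift f y) ≫ tuple fun i =>
        Sum.elim (comp (fst (Dpow R q) (Dpow R r ⊗ Y)))
      (comp (snd (Dpow R q) (Dpow R r ⊗ Y) ≫ fst (Dpow R r) Y)) (σ i))) s =
      Sum.elim (comp (tuple fun i => Sum.elim (comp d) (comp e) (σ' i))) (comp f) t := by
    rintro (a | a) (b | b) hab
    · rcases hb : σ' b with c | c <;> simp_all [comp_tuple]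
    · simp at hab
    · rcases hb : σ' b with c | c
      · simp [hb] at hab
      · simp_all [comp_tuple, comp_tuple', comp_comp]
    · simp_all [comp_tuple, comp_tuple', comp_comp]
  exact key _ _ (h i)

end Tuples

end

end SDG

namespace SDG

noncomputable section

variable {C : Type u} [Category.{v} C] [CartesianMonoidalCategory C] [BraidedCategory C]
  [MonoidalClosed C] [HasFiniteLimits C] {R : C} [CommRingObj R] {M X Y Y' S S' T T' : C}
  {m n p q r N : ℕ}

open MonoidalClosed

/-! ### Mappings into the object of functions on the object of microcubes -/

/-- `θ_s(γ)`. -/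
def pev (θ : S ⊗ (X ⊗ Cubes R M n) ⟶ M) (x : Y ⟶ X) (s : Y ⟶ S) (γ : Dpow R n ⊗ Y ⟶ M) : Y ⟶ M :=
  lift s (lift x (curry γ)) ≫ θ

theorem comp_pev (θ : S ⊗ (X ⊗ Cubes R M n) ⟶ M) (f : Y' ⟶ Y) (x : Y ⟶ X) (s : Y ⟶ S)
    (γ : Dpow R n ⊗ Y ⟶ M) :
    f ≫ pev θ x s γ = pev θ (f ≫ x) (f ≫ s) (Dpow R n ◁ f ≫ γ) := by
  rw [pev, pev, curry_natural_left, ← Category.assoc, comp_lift, comp_lift]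

theorem pev_whiskerRight (θ : S ⊗ (X ⊗ Cubes R M n) ⟶ M) (g : T ⟶ S) (x : Y ⟶ X) (s : Y ⟶ T)
    (γ : Dpow R n ⊗ Y ⟶ M) : pev (g ▷ _ ≫ θ) x s γ = pev θ x (s ≫ g) γ := by
  rw [pev, pev, ← Category.assoc, lift_whiskerRight]

theorem pev_generic (θ : S ⊗ (X ⊗ Cubes R M n) ⟶ M) :
    pev θ (snd _ _ ≫ fst _ _) (fst _ _) (uncurry (snd _ _ ≫ snd _ _)) = θ := by
  rw [pev, curry_uncurry]
  have : lift (fst S (X ⊗ Cubes R M n)) (lift (snd S (X ⊗ Cubes R M n) ≫ fst _ _)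
      (snd S (X ⊗ Cubes R M n) ≫ snd _ _)) = 𝟙 _ := by
    apply CartesianMonoidalCategory.hom_ext
    · simp
    · apply CartesianMonoidalCategory.hom_ext <;> simp
  rw [this, Category.id_comp]

/-- A mapping is recovered from its value at the generic parameter and the generic microcube. -/
theorem pev_ext {θ θ' : S ⊗ (X ⊗ Cubes R M n) ⟶ M}
    (h : ∀ (Y : C) (x : Y ⟶ X) (s : Y ⟶ S) (γ : Dpow R n ⊗ Y ⟶ M), pev θ x s γ = pev θ' x s γ) :
    θ = θ' := by
  rw [← pev_generic θ, ← pev_generic θ', h]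

/-- The mapping with given values at the generic elements. -/
theorem pev_of_generic (F : ∀ {Y : C}, (Y ⟶ X) → (Y ⟶ S) → (Dpow R n ⊗ Y ⟶ M) → (Y ⟶ M))
    (hF : ∀ {Y Y' : C} (f : Y' ⟶ Y) (x : Y ⟶ X) (s : Y ⟶ S) (γ : Dpow R n ⊗ Y ⟶ M),
      f ≫ F x s γ = F (f ≫ x) (f ≫ s) (Dpow R n ◁ f ≫ γ))
    (x : Y ⟶ X) (s : Y ⟶ S) (γ : Dpow R n ⊗ Y ⟶ M) :
    pev (F (snd S (X ⊗ Cubes R M n) ≫ fst _ _) (fst _ _)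
      (uncurry (snd S (X ⊗ Cubes R M n) ≫ snd _ _))) x s γ = F x s γ := by
  rw [pev, hF, ← uncurry_natural_left]
  simp only [lift_snd_assoc, lift_fst, lift_snd, uncurry_curry]

/-- `e ↦ ψ_t(d ↦ γ(…))`. -/
def inner (ψ : T ⊗ (X ⊗ Cubes R M p) ⟶ M) (x : Y ⟶ X) (t : Y ⟶ T) (ρ : Fin N → Fin p ⊕ Fin q)
    (γ : Dpow R N ⊗ Y ⟶ M) : Dpow R q ⊗ Y ⟶ M :=
  pev ψ (snd (Dpow R q) Y ≫ x) (snd (Dpow R q) Y ≫ t) (slice ρ γ)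

theorem whiskerLeft_inner (ψ : T ⊗ (X ⊗ Cubes R M p) ⟶ M) (f : Y' ⟶ Y) (x : Y ⟶ X) (t : Y ⟶ T)
    (ρ : Fin N → Fin p ⊕ Fin q) (γ : Dpow R N ⊗ Y ⟶ M) :
    Dpow R q ◁ f ≫ inner ψ x t ρ γ = inner ψ (f ≫ x) (f ≫ t) ρ (Dpow R N ◁ f ≫ γ) := by
  rw [inner, comp_pev, inner, whiskerLeft_snd_assoc, whiskerLeft_snd_assoc, slice_whiskerLeft]

theorem inner_whiskerRight (ψ : T ⊗ (X ⊗ Cubes R M p) ⟶ M) (g : T' ⟶ T) (x : Y ⟶ X) (t : Y ⟶ T')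
    (ρ : Fin N → Fin p ⊕ Fin q) (γ : Dpow R N ⊗ Y ⟶ M) :
    inner (g ▷ _ ≫ ψ) x t ρ γ = inner ψ x (t ≫ g) ρ γ := by
  rw [inner, pev_whiskerRight, inner, Category.assoc]

theorem inner_permCube (ψ : T ⊗ (X ⊗ Cubes R M p) ⟶ M) (x : Y ⟶ X) (t : Y ⟶ T)
    (ρ : Fin N → Fin p ⊕ Fin q) (σ : Fin m → Fin N) (γ : Dpow R m ⊗ Y ⟶ M) :
    inner ψ x t ρ (permCube σ γ) = inner ψ x t (fun i => ρ (σ i)) γ := by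
  rw [inner, slice_permCube, inner]

theorem permCube_inner (ψ : T ⊗ (X ⊗ Cubes R M p) ⟶ M) (x : Y ⟶ X) (t : Y ⟶ T)
    (ρ : Fin N → Fin p ⊕ Fin m) (σ : Fin m → Fin q) (γ : Dpow R N ⊗ Y ⟶ M) :
    permCube σ (inner ψ x t ρ γ) = inner ψ x t (fun i => Sum.map id σ (ρ i)) γ := by
  rw [permCube, inner, comp_pev, inner, whiskerRight_snd_assoc, whiskerRight_snd_assoc,
    slice_perm_right]

theorem scaleCube_inner (ψ : T ⊗ (X ⊗ Cubes R M p) ⟶ M) (x : Y ⟶ X) (t : Y ⟶ T)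
    {ρ : Fin N → Fin p ⊕ Fin q} (hρ : Function.Injective ρ) {i : Fin N} {a : Fin q}
    (hi : ρ i = .inr a) (α : Y ⟶ R) (γ : Dpow R N ⊗ Y ⟶ M) :
    inner ψ x t ρ (scaleCube α i γ) = scaleCube α a (inner ψ x t ρ γ) := by
  rw [inner, slice_scaleCube_right hρ hi, scaleCube, inner, comp_pev, lift_snd_assoc,
    lift_snd_assoc]

theorem slice_inner (ψ : T ⊗ (X ⊗ Cubes R M p) ⟶ M) (x : Y ⟶ X) (t : Y ⟶ T)
    {ρ : Fin N → Fin p ⊕ Fin m} {σ : Fin m → Fin q ⊕ Fin r}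
    {ρ' : Fin N → Fin n ⊕ Fin r} {σ' : Fin n → Fin p ⊕ Fin q}
    (h : ∀ i, Sum.map id σ (ρ i) = Equiv.sumAssoc _ _ _ (Sum.map σ' id (ρ' i)))
    (γ : Dpow R N ⊗ Y ⟶ M) :
    slice σ (inner ψ x t ρ γ) =
      inner ψ (snd (Dpow R r) Y ≫ x) (snd (Dpow R r) Y ≫ t) σ' (slice ρ' γ) := by
  rw [slice, inner, comp_pev, slice_slice h, inner, lift_snd_assoc, lift_snd_assoc, Category.assoc,
    Category.assoc]

/-- `θ_s(e ↦ ψ_t(d ↦ γ(…)))`. -/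
def nest (θ : S ⊗ (X ⊗ Cubes R M q) ⟶ M) (ψ : T ⊗ (X ⊗ Cubes R M p) ⟶ M)
    (ρ : Fin N → Fin p ⊕ Fin q) (x : Y ⟶ X) (s : Y ⟶ S) (t : Y ⟶ T) (γ : Dpow R N ⊗ Y ⟶ M) :
    Y ⟶ M :=
  pev θ x s (inner ψ x t ρ γ)

theorem comp_nest (θ : S ⊗ (X ⊗ Cubes R M q) ⟶ M) (ψ : T ⊗ (X ⊗ Cubes R M p) ⟶ M)
    (ρ : Fin N → Fin p ⊕ Fin q) (f : Y' ⟶ Y) (x : Y ⟶ X) (s : Y ⟶ S) (t : Y ⟶ T)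
    (γ : Dpow R N ⊗ Y ⟶ M) :
    f ≫ nest θ ψ ρ x s t γ = nest θ ψ ρ (f ≫ x) (f ≫ s) (f ≫ t) (Dpow R N ◁ f ≫ γ) := by
  rw [nest, comp_pev, whiskerLeft_inner, nest]

/-- `((t, s), γ) ↦ θ_s(e ↦ ψ_t(d ↦ γ(…)))`. -/
def convL (θ : S ⊗ (X ⊗ Cubes R M q) ⟶ M) (ψ : T ⊗ (X ⊗ Cubes R M p) ⟶ M)
    (ρ : Fin N → Fin p ⊕ Fin q) : (T ⊗ S) ⊗ (X ⊗ Cubes R M N) ⟶ M :=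
  nest θ ψ ρ (snd _ _ ≫ fst _ _) (fst _ _ ≫ snd _ _) (fst _ _ ≫ fst _ _)
    (uncurry (snd _ _ ≫ snd _ _))

/-- `((s, t), γ) ↦ θ_s(e ↦ ψ_t(d ↦ γ(…)))`. -/
def convR (θ : S ⊗ (X ⊗ Cubes R M q) ⟶ M) (ψ : T ⊗ (X ⊗ Cubes R M p) ⟶ M)
    (ρ : Fin N → Fin p ⊕ Fin q) : (S ⊗ T) ⊗ (X ⊗ Cubes R M N) ⟶ M :=
  nest θ ψ ρ (snd _ _ ≫ fst _ _) (fst _ _ ≫ fst _ _) (fst _ _ ≫ snd _ _)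
    (uncurry (snd _ _ ≫ snd _ _))

theorem pev_convL (θ : S ⊗ (X ⊗ Cubes R M q) ⟶ M) (ψ : T ⊗ (X ⊗ Cubes R M p) ⟶ M)
    (ρ : Fin N → Fin p ⊕ Fin q) (x : Y ⟶ X) (s : Y ⟶ T ⊗ S) (γ : Dpow R N ⊗ Y ⟶ M) :
    pev (convL θ ψ ρ) x s γ = nest θ ψ ρ x (s ≫ snd _ _) (s ≫ fst _ _) γ :=
  pev_of_generic (fun x s γ => nest θ ψ ρ x (s ≫ snd _ _) (s ≫ fst _ _) γ)
    (fun f x s γ => by rw [comp_nest, Category.assoc, Category.assoc]) x s γ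

theorem pev_convR (θ : S ⊗ (X ⊗ Cubes R M q) ⟶ M) (ψ : T ⊗ (X ⊗ Cubes R M p) ⟶ M)
    (ρ : Fin N → Fin p ⊕ Fin q) (x : Y ⟶ X) (s : Y ⟶ S ⊗ T) (γ : Dpow R N ⊗ Y ⟶ M) :
    pev (convR θ ψ ρ) x s γ = nest θ ψ ρ x (s ≫ fst _ _) (s ≫ snd _ _) γ :=
  pev_of_generic (fun x s γ => nest θ ψ ρ x (s ≫ fst _ _) (s ≫ snd _ _) γ)
    (fun f x s γ => by rw [comp_nest, Category.assoc, Category.assoc]) x s γ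

theorem nest_whiskerRight_left (θ : S ⊗ (X ⊗ Cubes R M q) ⟶ M) (ψ : T ⊗ (X ⊗ Cubes R M p) ⟶ M)
    (ρ : Fin N → Fin p ⊕ Fin q) (g : S' ⟶ S) (x : Y ⟶ X) (s : Y ⟶ S') (t : Y ⟶ T)
    (γ : Dpow R N ⊗ Y ⟶ M) : nest (g ▷ _ ≫ θ) ψ ρ x s t γ = nest θ ψ ρ x (s ≫ g) t γ := by
  rw [nest, pev_whiskerRight, nest]

theorem nest_whiskerRight_right (θ : S ⊗ (X ⊗ Cubes R M q) ⟶ M) (ψ : T ⊗ (X ⊗ Cubes R M p) ⟶ M)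
    (ρ : Fin N → Fin p ⊕ Fin q) (g : T' ⟶ T) (x : Y ⟶ X) (s : Y ⟶ S) (t : Y ⟶ T')
    (γ : Dpow R N ⊗ Y ⟶ M) : nest θ (g ▷ _ ≫ ψ) ρ x s t γ = nest θ ψ ρ x s (t ≫ g) γ := by
  rw [nest, inner_whiskerRight, nest]

theorem whisker_convL (θ : S ⊗ (X ⊗ Cubes R M q) ⟶ M) (ψ : T ⊗ (X ⊗ Cubes R M p) ⟶ M)
    (ρ : Fin N → Fin p ⊕ Fin q) (g : S' ⟶ S) :
    (T ◁ g) ▷ _ ≫ convL θ ψ ρ = convL (g ▷ _ ≫ θ) ψ ρ :=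
  pev_ext fun Y x s γ => by
    rw [pev_whiskerRight, pev_convL, pev_convL, nest_whiskerRight_left]
    simp

theorem whisker_convR (θ : S ⊗ (X ⊗ Cubes R M q) ⟶ M) (ψ : T ⊗ (X ⊗ Cubes R M p) ⟶ M)
    (ρ : Fin N → Fin p ⊕ Fin q) (g : T' ⟶ T) :
    (S ◁ g) ▷ _ ≫ convR θ ψ ρ = convR θ (g ▷ _ ≫ ψ) ρ :=
  pev_ext fun Y x s γ => by
    rw [pev_whiskerRight, pev_convR, pev_convR, nest_whiskerRight_right]
    simp

theorem swapD_convL (θ : D R ⊗ (X ⊗ Cubes R M q) ⟶ M) (ψ : D R ⊗ (X ⊗ Cubes R M p) ⟶ M)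
    (ρ : Fin N → Fin p ⊕ Fin q) : WeilSpec.swapD R ▷ _ ≫ convL θ ψ ρ = convR θ ψ ρ :=
  pev_ext fun Y x s γ => by
    rw [pev_whiskerRight, pev_convL, pev_convR, WeilSpec.swapD]
    simp

theorem swapD_convR (θ : D R ⊗ (X ⊗ Cubes R M q) ⟶ M) (ψ : D R ⊗ (X ⊗ Cubes R M p) ⟶ M)
    (ρ : Fin N → Fin p ⊕ Fin q) : WeilSpec.swapD R ▷ _ ≫ convR θ ψ ρ = convL θ ψ ρ :=
  pev_ext fun Y x s γ => by
    rw [pev_whiskerRight, pev_convL, pev_convR, WeilSpec.swapD]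
    simp

theorem convAt_eq_nest (L : VMap R M X q) (K : VMap R M X p) (x : Y ⟶ X) (d₁ d₂ : Y ⟶ D R)
    (γ : Dpow R (p + q) ⊗ Y ⟶ M) :
    convAt L K x d₁ d₂ γ = nest L K finSumFinEquiv.symm x d₂ d₁ γ := by
  have h : ∀ (d : Dpow R p ⊗ (Dpow R q ⊗ Y) ⟶ Dpow R p) (e : Dpow R p ⊗ (Dpow R q ⊗ Y) ⟶ Dpow R q),
      append d e = tuple fun i => Sum.elim (comp d) (comp e) (finSumFinEquiv.symm i) := by
    intro d e
    rw [append]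
    congr 1
    funext i
    refine Fin.addCases (fun a => ?_) (fun a => ?_) i <;> simp
  rw [convAt, nest, inner, slice, h]
  rfl

theorem conv_eq_convL (L : VMap R M X q) (K : VMap R M X p) :
    conv L K = convL L K finSumFinEquiv.symm :=
  convAt_eq_nest _ _ _ _ _ _

/-- In terms of distributions of arguments, the interchange of blocks is the swap of the two
summands. -/
theorem convTilde_eq_convR (K : VMap R M X p) (L : VMap R M X q) :
    convTilde K L = convR K L fun i => (finSumFinEquiv.symm i).swap := by
  rw [convTilde, convAt_eq_nest, nest, inner_permCube, convR, nest]
  congr 2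
  funext i
  simp [finAddFlip]

theorem pev_perm (σ : Fin m → Fin n) (θ : S ⊗ (X ⊗ Cubes R M n) ⟶ M) (x : Y ⟶ X) (s : Y ⟶ S)
    (γ : Dpow R m ⊗ Y ⟶ M) :
    pev (S ◁ X ◁ (pre (powMap R σ)).app M ≫ θ) x s γ = pev θ x s (permCube σ γ) := by
  rw [pev, lift_whiskerLeft_comp, lift_whiskerLeft, curry_pre_app, permCube, pev]

end

end SDG

namespace SDG

noncomputable section

/-! ### The bracket `⌊K, L⌋` for an arbitrary distribution of the arguments. -/

open MonoidalClosed WeilSpec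

variable {C : Type u} [Category.{v} C] [CartesianMonoidalCategory C] [BraidedCategory C]
  [MonoidalClosed C] [HasFiniteLimits C] {R : C} [CommRingObj R] {M X Y Y' Z S S' T T' : C}
  {m n p q r N : ℕ}

theorem comp_baseCube (f : Y' ⟶ Y) (γ : Dpow R n ⊗ Y ⟶ M) :
    f ≫ baseCube γ = baseCube (Dpow R n ◁ f ≫ γ) := by
  rw [← lift_eq_baseCube, baseCube, lift_whiskerLeft_comp, Category.id_comp]

variable (R M X) in
/-- The base point of a microcube. -/
def cubeBase (n : ℕ) : X ⊗ Cubes R M n ⟶ M := baseCube (uncurry (snd X (Cubes R M n)))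

theorem lift_cubeBase (x : Y ⟶ X) (γ : Dpow R n ⊗ Y ⟶ M) :
    lift x (curry γ) ≫ cubeBase R M X n = baseCube γ := by
  rw [cubeBase, comp_baseCube, ← uncurry_natural_left, lift_snd, uncurry_curry]

theorem zeroForm_eq (n : ℕ) : zeroForm R M X n = snd (D R) _ ≫ cubeBase R M X n := by
  rw [zeroForm, cubeBase, comp_baseCube, ← uncurry_natural_left]

theorem pev_zeroD (K : VMap R M X n) (x : Y ⟶ X) (γ : Dpow R n ⊗ Y ⟶ M) :
    pev K x (zeroD R Y) γ = lift x (curry γ) ≫ tanBase K := by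
  rw [tanBase, ← Category.assoc, comp_lift, comp_zeroD, Category.comp_id, pev]

/-- The condition on `K_0` prescribes one fixed base point, so the mappings satisfying it form a
single module of tangent vectors. -/
theorem tanBase_eq_cubeBase_iff (K : VMap R M X n) : tanBase K = cubeBase R M X n ↔
    ∀ (Y : C) (x : Y ⟶ X) (γ : Dpow R n ⊗ Y ⟶ M), pev K x (zeroD R Y) γ = baseCube γ := by
  constructor
  · intro h Y x γ
    rw [pev_zeroD, h, lift_cubeBase]
  · intro h
    have := h _ (fst X (Cubes R M n)) (uncurry (snd X (Cubes R M n)))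
    rw [pev_zeroD, curry_uncurry] at this
    simpa [cubeBase] using this

theorem whiskerLeft_slice_zero (ρ : Fin N → Fin p ⊕ Fin q) (γ : Dpow R N ⊗ Y ⟶ M) :
    Dpow R p ◁ lift (tuple fun _ => zeroD R Y) (𝟙 Y) ≫ slice ρ γ =
      baseCube (slice (fun i => (ρ i).swap) γ) := by
  refine cube_ext fun Z d y => ?_
  rw [lift_whiskerLeft_comp, comp_lift, comp_tuple', ← lift_eq_baseCube, lift_slice, lift_slice,
    Category.comp_id]
  congr 3
  funext i
  rcases ρ i with a | a <;> simp [comp_tuple]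

theorem baseCube_inner (K : VMap R M X p) (x : Y ⟶ X) (d : Y ⟶ D R) (ρ : Fin N → Fin p ⊕ Fin q)
    (γ : Dpow R N ⊗ Y ⟶ M) :
    baseCube (inner K x d ρ γ) = pev K x d (baseCube (slice (fun i => (ρ i).swap) γ)) := by
  rw [baseCube, inner, comp_pev, whiskerLeft_slice_zero]
  simp

theorem baseCube_baseCube_slice (ρ : Fin N → Fin p ⊕ Fin q) (γ : Dpow R N ⊗ Y ⟶ M) :
    baseCube (baseCube (slice ρ γ)) = baseCube γ := by
  rw [baseCube, ← lift_eq_baseCube, lift_slice, baseCube]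
  congr 3
  funext i
  rcases ρ i with a | a <;> simp [comp_tuple]

theorem IsStrongDiff.tanBase_eq {γ₁ γ₂ : (D R ⊗ D R) ⊗ Z ⟶ M} {t : D R ⊗ Z ⟶ M}
    (h : IsStrongDiff γ₁ γ₂ t) :
    tanBase t = lift (lift (zeroD R Z) (zeroD R Z)) (𝟙 Z) ≫ γ₂ := by
  obtain ⟨m, -, rfl, rfl⟩ := h
  rw [tanBase, ← Category.assoc, ← Category.assoc, lift_whiskerRight, lift_whiskerRight]
  congr 2
  apply Wedge_hom_ext <;> simp [wedgeAxis, wedgeZero, mkWedge_wedge₁, mkWedge_wedge₂, mkWedge_wedge₃]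

variable {k : Type w} [Field k] [AlgObj k R] {hM : Microlinear k R M}

/-- The mappings `K` with `K_0(γ) = γ(0, …, 0)`. -/
abbrev VTan (hM : Microlinear k R M) (X : C) (n : ℕ) : Type v := Tan hM (cubeBase R M X n)

theorem VTan.pev_zero (K : VTan hM X n) (x : Y ⟶ X) (γ : Dpow R n ⊗ Y ⟶ M) :
    pev K.1 x (zeroD R Y) γ = baseCube γ :=
  (tanBase_eq_cubeBase_iff K.1).1 K.2 Y x γ

theorem VTan.inner_zero (K : VTan hM X p) (x : Y ⟶ X) (ρ : Fin N → Fin p ⊕ Fin q)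
    (γ : Dpow R N ⊗ Y ⟶ M) : inner K.1 x (zeroD R Y) ρ γ = baseCube (slice ρ γ) := by
  rw [inner, comp_zeroD, VTan.pev_zero]

/-- As `L_0` or `K_0` only evaluates at zero, a convolution with one parameter `0` is the other form
applied to `γ` with a block of arguments set to zero, whichever form is outside. Hence the two
convolutions agree on both axes, as `exists_floor` requires. -/
theorem VTan.nest_zero_left (K : VTan hM X p) (L : VTan hM X q) (ρ : Fin N → Fin p ⊕ Fin q)
    (x : Y ⟶ X) (d : Y ⟶ D R) (γ : Dpow R N ⊗ Y ⟶ M) :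
    nest L.1 K.1 ρ x (zeroD R Y) d γ =
      nest K.1 L.1 (fun i => (ρ i).swap) x d (zeroD R Y) γ := by
  rw [nest, VTan.pev_zero, baseCube_inner, nest, VTan.inner_zero]

theorem exists_floor (ρ : Fin N → Fin p ⊕ Fin q) (K : VTan hM X p) (L : VTan hM X q) :
    ∃ T : VTan hM X N, IsStrongDiff (convL L.1 K.1 ρ) (convR K.1 L.1 fun i => (ρ i).swap) T.1 := by
  obtain ⟨m, h₁, h₂⟩ := exists_wedge hM (γ₁ := convL L.1 K.1 ρ)
    (γ₂ := convR K.1 L.1 fun i => (ρ i).swap)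
    (pev_ext fun Y x s γ => by
      rw [pev_whiskerRight, pev_whiskerRight, pev_convL, pev_convR]
      simp only [Category.assoc, lift_fst, lift_snd, Category.comp_id, comp_zeroD]
      exact VTan.nest_zero_left K L ρ x s γ)
    (pev_ext fun Y x s γ => by
      rw [pev_whiskerRight, pev_whiskerRight, pev_convL, pev_convR]
      simp only [Category.assoc, lift_fst, lift_snd, Category.comp_id, comp_zeroD]
      rw [VTan.nest_zero_left L K]
      simp only [Sum.swap_swap])
  have h : IsStrongDiff (convL L.1 K.1 ρ) (convR K.1 L.1 fun i => (ρ i).swap)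
      (wedgeAxis R ▷ _ ≫ m) := ⟨m, h₁, h₂, rfl⟩
  refine ⟨⟨_, ?_⟩, h⟩
  rw [tanBase_eq_cubeBase_iff]
  intro Y x γ
  rw [pev_zeroD, h.tanBase_eq, ← Category.assoc, comp_lift, comp_lift, comp_zeroD, Category.comp_id]
  change pev (convR K.1 L.1 fun i => (ρ i).swap) x (lift (zeroD R Y) (zeroD R Y)) γ = _
  rw [pev_convR, lift_fst, lift_snd, nest, VTan.pev_zero, VTan.inner_zero, baseCube_baseCube_slice]

/-- `⌊K, L⌋`, with the arguments of a cube attributed to `K` and `L` by `ρ`. -/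
def floor (ρ : Fin N → Fin p ⊕ Fin q) (K : VTan hM X p) (L : VTan hM X q) : VTan hM X N :=
  (exists_floor ρ K L).choose

theorem isStrongDiff_floor (ρ : Fin N → Fin p ⊕ Fin q) (K : VTan hM X p) (L : VTan hM X q) :
    IsStrongDiff (convL L.1 K.1 ρ) (convR K.1 L.1 fun i => (ρ i).swap) (floor ρ K L).1 :=
  (exists_floor ρ K L).choose_spec

theorem eq_floor {ρ : Fin N → Fin p ⊕ Fin q} {K : VTan hM X p} {L : VTan hM X q}
    {t : VMap R M X N}
    (h : IsStrongDiff (convL L.1 K.1 ρ) (convR K.1 L.1 fun i => (ρ i).swap) t) :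
    t = (floor ρ K L).1 :=
  h.unique hM (isStrongDiff_floor ρ K L)

/-- Convolution of `K` with the joint map of the `L i` gives families over `D × D(ι)`, whose
restriction to each line is the convolution with the corresponding combination; strong differences
are linear in such a family. -/
theorem floor_sum {ι : Type} [Fintype ι] (ρ : Fin N → Fin p ⊕ Fin q) (K : VTan hM X p)
    (c : ι → k) (L : ι → VTan hM X q) :
    floor ρ K (∑ i, c i • L i) = ∑ i, c i • floor ρ K (L i) := by
  refine Tan.eq_sum_of_isStrongDiff (Γ₁ := convL (Tan.joint L) K.1 ρ)
    (Γ₂ := convR K.1 (Tan.joint L) fun i => (ρ i).swap) c (fun i => ?_) ?_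
  · rw [whisker_convL, whisker_convR, Tan.axis_joint]
    exact isStrongDiff_floor _ _ _
  · rw [whisker_convL, whisker_convR]
    have h := isStrongDiff_floor ρ K (∑ i, c i • L i)
    rwa [← Tan.comb_eq_sum] at h ⊢

/-- Interchanging the two parameters turns each convolution into the other kind. -/
theorem floor_swap (ρ : Fin N → Fin p ⊕ Fin q) (K : VTan hM X p) (L : VTan hM X q) :
    floor (fun i => (ρ i).swap) L K = -floor ρ K L := by
  refine Tan.eq_neg_of_isStrongDiff (isStrongDiff_floor ρ K L) ?_
  rw [swapD_convL, swapD_convR]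
  have h := isStrongDiff_floor (fun i => (ρ i).swap) L K
  simpa only [Sum.swap_swap] using h

theorem comp_pre_cubeBase (σ : Fin m → Fin n) :
    X ◁ (pre (powMap R σ)).app M ≫ cubeBase R M X n = cubeBase R M X m := by
  rw [cubeBase, comp_baseCube, ← uncurry_natural_left, whiskerLeft_snd, uncurry_pre_app, baseCube,
    ← Category.assoc, lift_whiskerRight, comp_powMap, cubeBase, baseCube]
  simp only [comp_tuple]

/-- `γ ↦ K(γ^σ)`. -/
def VTan.perm (σ : Fin m → Fin n) : VTan hM X n →ₗ[k] VTan hM X m :=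
  Tan.pullback (X ◁ (pre (powMap R σ)).app M) (comp_pre_cubeBase σ)

theorem VTan.pev_perm (σ : Fin m → Fin n) (K : VTan hM X n) (x : Y ⟶ X) (s : Y ⟶ D R)
    (γ : Dpow R m ⊗ Y ⟶ M) : pev (VTan.perm σ K).1 x s γ = pev K.1 x s (permCube σ γ) :=
  SDG.pev_perm σ K.1 x s γ

theorem VTan.ext_pev {K L : VTan hM X n} (h : ∀ (Y : C) (x : Y ⟶ X) (s : Y ⟶ D R)
    (γ : Dpow R n ⊗ Y ⟶ M), pev K.1 x s γ = pev L.1 x s γ) : K = L :=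
  Tan.ext (pev_ext h)

theorem permCube_permCube (σ : Fin m → Fin n) (τ : Fin n → Fin p) (γ : Dpow R m ⊗ Y ⟶ M) :
    permCube τ (permCube σ γ) = permCube (fun i => τ (σ i)) γ := by
  refine cube_ext fun Z d y => ?_
  rw [lift_permCube, lift_permCube, lift_permCube]
  simp only [comp_tuple]

theorem permCube_id (γ : Dpow R m ⊗ Y ⟶ M) : permCube (fun i => i) γ = γ := by
  refine cube_ext fun Z d y => ?_
  rw [lift_permCube, tuple_comp]

theorem VTan.perm_perm (σ : Fin m → Fin n) (τ : Fin n → Fin p) (K : VTan hM X p) :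
    VTan.perm σ (VTan.perm τ K) = VTan.perm (fun i => τ (σ i)) K :=
  VTan.ext_pev fun Y x s γ => by
    rw [VTan.pev_perm, VTan.pev_perm, VTan.pev_perm, permCube_permCube]

theorem VTan.perm_id (K : VTan hM X n) : VTan.perm (fun i => i) K = K :=
  VTan.ext_pev fun Y x s γ => by rw [VTan.pev_perm, permCube_id]

theorem VTan.inner_perm (τ : Fin m → Fin p) (K : VTan hM X p) (x : Y ⟶ X) (s : Y ⟶ D R)
    (ρ : Fin N → Fin m ⊕ Fin q) (γ : Dpow R N ⊗ Y ⟶ M) :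
    inner (VTan.perm τ K).1 x s ρ γ = inner K.1 x s (fun i => Sum.map τ id (ρ i)) γ := by
  rw [inner, VTan.pev_perm, permCube_slice, inner]

theorem VTan.nest_perm (τ : Fin m → Fin p) (τ' : Fin n → Fin q) (K : VTan hM X p)
    (L : VTan hM X q) (ρ : Fin N → Fin m ⊕ Fin n) (x : Y ⟶ X) (s t : Y ⟶ D R)
    (γ : Dpow R N ⊗ Y ⟶ M) : nest (VTan.perm τ' L).1 (VTan.perm τ K).1 ρ x s t γ =
      nest L.1 K.1 (fun i => Sum.map τ τ' (ρ i)) x s t γ := by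
  rw [nest, VTan.pev_perm, VTan.inner_perm, permCube_inner, nest]
  simp only [Sum.map_map, Function.id_comp, Function.comp_id]

/-- Reindexing the forms, or the cube as in `perm_floor`, only alters the distribution `ρ` in both
convolutions, and strong differences are unique. -/
theorem floor_perm (τ : Fin m → Fin p) (τ' : Fin n → Fin q) (ρ : Fin N → Fin m ⊕ Fin n)
    (K : VTan hM X p) (L : VTan hM X q) :
    floor ρ (VTan.perm τ K) (VTan.perm τ' L) = floor (fun i => Sum.map τ τ' (ρ i)) K L := by
  refine Tan.ext (eq_floor ?_)
  have h := isStrongDiff_floor ρ (VTan.perm τ K) (VTan.perm τ' L)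
  have h₁ : convL (VTan.perm τ' L).1 (VTan.perm τ K).1 ρ =
      convL L.1 K.1 fun i => Sum.map τ τ' (ρ i) := pev_ext fun Y x s γ => by
    rw [pev_convL, pev_convL, VTan.nest_perm]
  have h₂ : convR (VTan.perm τ K).1 (VTan.perm τ' L).1 (fun i => (ρ i).swap) =
      convR K.1 L.1 fun i => (Sum.map τ τ' (ρ i)).swap := pev_ext fun Y x s γ => by
    rw [pev_convR, pev_convR, VTan.nest_perm]
    congr 1
    funext i
    rcases ρ i with a | a <;> rfl
  rwa [h₁, h₂] at h

theorem nest_permCube (θ : S ⊗ (X ⊗ Cubes R M q) ⟶ M) (ψ : T ⊗ (X ⊗ Cubes R M p) ⟶ M)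
    (ρ : Fin N → Fin p ⊕ Fin q) (σ : Fin m → Fin N) (x : Y ⟶ X) (s : Y ⟶ S) (t : Y ⟶ T)
    (γ : Dpow R m ⊗ Y ⟶ M) :
    nest θ ψ ρ x s t (permCube σ γ) = nest θ ψ (fun i => ρ (σ i)) x s t γ := by
  rw [nest, inner_permCube, nest]

theorem perm_floor (σ : Fin m → Fin N) (ρ : Fin N → Fin p ⊕ Fin q) (K : VTan hM X p)
    (L : VTan hM X q) : VTan.perm σ (floor ρ K L) = floor (fun i => ρ (σ i)) K L := by
  refine Tan.ext (eq_floor ?_)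
  have h := (isStrongDiff_floor ρ K L).whiskerLeft (X ◁ (pre (powMap R σ)).app M)
  have h₁ : (D R ⊗ D R) ◁ X ◁ (pre (powMap R σ)).app M ≫ convL L.1 K.1 ρ =
      convL L.1 K.1 fun i => ρ (σ i) := pev_ext fun Y x s γ => by
    rw [pev_perm, pev_convL, pev_convL, nest_permCube]
  have h₂ : (D R ⊗ D R) ◁ X ◁ (pre (powMap R σ)).app M ≫ convR K.1 L.1 (fun i => (ρ i).swap) =
      convR K.1 L.1 fun i => (ρ (σ i)).swap := pev_ext fun Y x s γ => by
    rw [pev_perm, pev_convR, pev_convR, nest_permCube]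
  rwa [h₁, h₂] at h

end

end SDG

namespace SDG

noncomputable section

open MonoidalClosed WeilSpec

variable {C : Type u} [Category.{v} C] [CartesianMonoidalCategory C] [BraidedCategory C]
  [MonoidalClosed C] [HasFiniteLimits C] {R : C} [CommRingObj R] {M X Y Y' Z S S' T T' : C}
  {m n p q r N : ℕ}

/-! ### The Jacobi identity for `⌊K, L⌋` -/

/-- The cyclic interchange of three blocks. -/
def cycleSum {α β γ : Type*} : α ⊕ (β ⊕ γ) ≃ β ⊕ (γ ⊕ α) :=
  (Equiv.sumComm α (β ⊕ γ)).trans (Equiv.sumAssoc β γ α)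

section Cycle

variable {n' : ℕ} {ρ : Fin N → Fin p ⊕ Fin n} {σ : Fin n → Fin q ⊕ Fin r}
  {ρ' : Fin N → Fin q ⊕ Fin n'} {σ' : Fin n' → Fin r ⊕ Fin p}

/-- Both sides nest `K₀` outside `K₂` outside `K₁`; they differ in the bracketing and in the
rotation of the parameters. Cyclically this accounts for three of the six orders of nesting, and
`convL_convR_eq_cycleD` for the other three. -/
theorem convR_convL_eq_cycleD
    (h : ∀ i, Sum.map id σ' (ρ' i) = cycleSum (Sum.map id σ (ρ i)))
    (K₀ : VMap R M X p) (K₁ : VMap R M X q) (K₂ : VMap R M X r) :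
    convR K₀ (convL K₂ K₁ σ) (fun i => (ρ i).swap) =
      cycleD R ▷ _ ≫ convL (convL K₀ K₂ σ') K₁ ρ' := by
  refine pev_ext fun Y x s γ => ?_
  rw [pev_whiskerRight, pev_convR, pev_convL, nest, inner, pev_convL, nest, nest, pev_convL, nest,
    inner.eq_1 K₂, slice_inner (ρ := ρ') (σ := σ') (ρ' := fun i => (ρ i).swap) (σ' := σ)]
  · simp [cycleD]
  · intro i
    rw [h]
    rcases ρ i with a | a <;> simp [cycleSum]

theorem convL_convR_eq_cycleD
    (h : ∀ i, Sum.map id σ' (ρ' i) = cycleSum (Sum.map id σ (ρ i)))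
    (K₀ : VMap R M X p) (K₁ : VMap R M X q) (K₂ : VMap R M X r) :
    convL (convR K₁ K₂ fun i => (σ i).swap) K₀ ρ =
      cycleD R ▷ _ ≫ convR K₁ (convR K₂ K₀ fun i => (σ' i).swap) (fun i => (ρ' i).swap) := by
  refine pev_ext fun Y x s γ => ?_
  rw [pev_whiskerRight, pev_convL, pev_convR, nest, nest, pev_convR, nest, inner.eq_1 K₂,
    inner.eq_1 (convR K₂ K₀ _), pev_convR, nest, slice_inner (ρ' := fun i => (ρ' i).swap) (σ' := fun i => (σ' i).swap)]
  · simp [cycleD]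
  · intro i
    have := h i
    rcases hρ : ρ i with a | a <;> rcases hρ' : ρ' i with b | b <;> rw [hρ, hρ'] at this
    · simp [cycleSum] at this
    · rcases hσ' : σ' b with c | c <;> simp_all [cycleSum]
    · rcases hσ : σ a with c | c <;> simp_all [cycleSum]
    · rcases hσ : σ a with c | c <;> rcases hσ' : σ' b with d | d <;> simp_all [cycleSum]

end Cycle

variable {k : Type w} [Field k] [AlgObj k R] {hM : Microlinear k R M}

theorem floor_jacobi {p₀ p₁ p₂ n₀ n₁ n₂ : ℕ} {K₀ : VTan hM X p₀} {K₁ : VTan hM X p₁}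
    {K₂ : VTan hM X p₂} {ρ₀ : Fin N → Fin p₀ ⊕ Fin n₀} {ρ₁ : Fin N → Fin p₁ ⊕ Fin n₁}
    {ρ₂ : Fin N → Fin p₂ ⊕ Fin n₂} {σ₀ : Fin n₀ → Fin p₁ ⊕ Fin p₂} {σ₁ : Fin n₁ → Fin p₂ ⊕ Fin p₀}
    {σ₂ : Fin n₂ → Fin p₀ ⊕ Fin p₁}
    (h₀ : ∀ i, Sum.map id σ₁ (ρ₁ i) = cycleSum (Sum.map id σ₀ (ρ₀ i)))
    (h₁ : ∀ i, Sum.map id σ₂ (ρ₂ i) = cycleSum (Sum.map id σ₁ (ρ₁ i))) :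
    floor ρ₀ K₀ (floor σ₀ K₁ K₂) + floor ρ₁ K₁ (floor σ₁ K₂ K₀) +
      floor ρ₂ K₂ (floor σ₂ K₀ K₁) = 0 := by
  -- Three rotations of the blocks compose to the identity, so the third compatibility is a
  -- consequence of the other two.
  have h₂ : ∀ i, Sum.map id σ₀ (ρ₀ i) = cycleSum (Sum.map id σ₂ (ρ₂ i)) := fun i => by
    rw [h₁, h₀]
    rcases Sum.map id σ₀ (ρ₀ i) with a | a | a <;> rfl
  -- The witnesses `w` of the inner strong differences, convolved with the outer form, are maps on
  -- `D × (D² ∨ D)`: `wedgeMul` and `wedgeZero` restrict them to triple convolutions, `wedgeAxis` to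
  -- the convolutions whose strong difference is the outer `floor`.
  obtain ⟨w₀, a₀, b₀, c₀⟩ := isStrongDiff_floor σ₀ K₁ K₂
  obtain ⟨w₁, a₁, b₁, c₁⟩ := isStrongDiff_floor σ₁ K₂ K₀
  obtain ⟨w₂, a₂, b₂, c₂⟩ := isStrongDiff_floor σ₂ K₀ K₁
  refine Tan.sum_eq_zero_of_isStrongDiff
    (m₁ := ![convL w₀ K₀.1 ρ₀, convL w₁ K₁.1 ρ₁, convL w₂ K₂.1 ρ₂])
    (m₂ := ![convR K₀.1 w₀ fun i => (ρ₀ i).swap, convR K₁.1 w₁ fun i => (ρ₁ i).swap,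
      convR K₂.1 w₂ fun i => (ρ₂ i).swap])
    (t := ![floor ρ₀ K₀ (floor σ₀ K₁ K₂), floor ρ₁ K₁ (floor σ₁ K₂ K₀),
      floor ρ₂ K₂ (floor σ₂ K₀ K₁)]) ?_ ?_ ?_
  · have e₀ := convR_convL_eq_cycleD h₀ K₀.1 K₁.1 K₂.1
    have e₁ := convR_convL_eq_cycleD h₁ K₁.1 K₂.1 K₀.1
    have e₂ := convR_convL_eq_cycleD h₂ K₂.1 K₀.1 K₁.1
    rw [← a₀, ← a₁, ← whisker_convL, ← whisker_convR] at e₀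
    rw [← a₁, ← a₂, ← whisker_convL, ← whisker_convR] at e₁
    rw [← a₂, ← a₀, ← whisker_convL, ← whisker_convR] at e₂
    intro c
    fin_cases c
    exacts [e₀, e₁, e₂]
  · have e₀ := convL_convR_eq_cycleD h₀ K₀.1 K₁.1 K₂.1
    have e₁ := convL_convR_eq_cycleD h₁ K₁.1 K₂.1 K₀.1
    have e₂ := convL_convR_eq_cycleD h₂ K₂.1 K₀.1 K₁.1
    rw [← b₀, ← b₁, ← whisker_convL, ← whisker_convR] at e₀
    rw [← b₁, ← b₂, ← whisker_convL, ← whisker_convR] at e₁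
    rw [← b₂, ← b₀, ← whisker_convL, ← whisker_convR] at e₂
    intro c
    fin_cases c
    exacts [e₀, e₁, e₂]
  · have e₀ := isStrongDiff_floor ρ₀ K₀ (floor σ₀ K₁ K₂)
    have e₁ := isStrongDiff_floor ρ₁ K₁ (floor σ₁ K₂ K₀)
    have e₂ := isStrongDiff_floor ρ₂ K₂ (floor σ₂ K₀ K₁)
    rw [← c₀, ← whisker_convL, ← whisker_convR] at e₀
    rw [← c₁, ← whisker_convL, ← whisker_convR] at e₁
    rw [← c₂, ← whisker_convL, ← whisker_convR] at e₂
    intro c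
    fin_cases c
    exacts [e₀, e₁, e₂]

/-! ### Homogeneity -/

theorem baseCube_scaleCube (α : Y ⟶ R) (i : Fin n) (γ : Dpow R n ⊗ Y ⟶ M) :
    baseCube (scaleCube α i γ) = baseCube γ := by
  rw [baseCube, lift_scaleCube, baseCube]
  congr 3
  funext j
  by_cases h : j = i
  · subst h
    simp [comp_tuple]
  · simp [comp_tuple, Function.update_of_ne h]

theorem whiskerLeft_scaleCube (f : Y' ⟶ Y) (α : Y ⟶ R) (i : Fin n) (γ : Dpow R n ⊗ Y ⟶ M) :
    Dpow R n ◁ f ≫ scaleCube α i γ = scaleCube (f ≫ α) i (Dpow R n ◁ f ≫ γ) := by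
  refine cube_ext fun Z d y => ?_
  rw [lift_whiskerLeft_comp, lift_scaleCube, lift_scaleCube, lift_whiskerLeft_comp, Category.assoc]

/-- `K_d` is homogeneous in each argument of the cube. -/
def IsHomog (K : VMap R M X n) : Prop :=
  ∀ (Y : C) (x : Y ⟶ X) (d : Y ⟶ D R) (α : Y ⟶ R) (γ : Dpow R n ⊗ Y ⟶ M) (i : Fin n),
    pev K x d (scaleCube α i γ) = pev K x (smulD α d) γ

theorem lift_scaleLine (α : Y ⟶ R) (d : Y' ⟶ D R) (y : Y' ⟶ Y) (t : D R ⊗ Y ⟶ M) :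
    lift d y ≫ Tan.scaleLine α ≫ t = lift (smulD (y ≫ α) d) y ≫ t := by
  simp [Tan.scaleLine, comp_lift_assoc]

theorem isHomog_iff (K : VMap R M X n) : IsHomog K ↔
    ∀ (Y : C) (x : Y ⟶ X) (α : Y ⟶ R) (γ : Dpow R n ⊗ Y ⟶ M) (i : Fin n),
      D R ◁ lift x (curry (scaleCube α i γ)) ≫ K = Tan.scaleLine α ≫ D R ◁ lift x (curry γ) ≫ K := by
  constructor
  · intro h Y x α γ i
    refine cube_ext fun Z d y => ?_
    have := h Z (y ≫ x) d (y ≫ α) (Dpow R n ◁ y ≫ γ) i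
    rw [← whiskerLeft_scaleCube, pev, pev, curry_natural_left, curry_natural_left, ← comp_lift,
      ← comp_lift] at this
    rw [lift_whiskerLeft_comp, this, lift_scaleLine, lift_whiskerLeft_comp]
  · intro h Y x d α γ i
    have : lift d (𝟙 Y) ≫ _ = lift d (𝟙 Y) ≫ _ := congrArg (lift d (𝟙 Y) ≫ ·) (h Y x α γ i)
    rw [lift_whiskerLeft_comp, lift_scaleLine, lift_whiskerLeft_comp, Category.id_comp,
      Category.id_comp, Category.id_comp] at this
    exact this

/-- Both sides of the equation are linear in `K`, so homogeneity passes to linear combinations. -/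
theorem isHomog_iff_pullback (K : VTan hM X n) : IsHomog K.1 ↔
    ∀ (Y : C) (x : Y ⟶ X) (α : Y ⟶ R) (γ : Dpow R n ⊗ Y ⟶ M) (i : Fin n),
      Tan.pullback (lift x (curry (scaleCube α i γ)))
        ((lift_cubeBase _ _).trans (baseCube_scaleCube α i γ)) K =
      Tan.scale α (Tan.pullback (lift x (curry γ)) (lift_cubeBase _ _) K) := by
  rw [isHomog_iff]
  simp only [Tan.ext_iff, Tan.scale_val, Tan.pullback_val]

theorem isHomog_sum {ι : Type} [Fintype ι] {K : ι → VTan hM X n} (hK : ∀ i, IsHomog (K i).1)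
    (c : ι → k) : IsHomog (∑ i, c i • K i : VTan hM X n).1 := by
  rw [isHomog_iff_pullback]
  intro Y x α γ j
  simp only [map_sum, map_smul]
  exact Finset.sum_congr rfl fun i _ => by rw [(isHomog_iff_pullback _).1 (hK i)]

theorem isHomog_smul {K : VTan hM X n} (hK : IsHomog K.1) (c : k) : IsHomog (c • K).1 := by
  simpa using isHomog_sum (ι := Unit) (fun _ => hK) fun _ => c

/-- `(d_1, d_2, z) ↦ (a(z) d_1, d_2, z)`. -/
def scaleFst (a : Z ⟶ R) : (D R ⊗ D R) ⊗ Z ⟶ (D R ⊗ D R) ⊗ Z :=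
  lift (lift (smulD (snd _ _ ≫ a) (fst _ _ ≫ fst _ _)) (fst _ _ ≫ snd _ _)) (snd _ _)

/-- `(d_1, d_2, z) ↦ (d_1, a(z) d_2, z)`. -/
def scaleSnd (a : Z ⟶ R) : (D R ⊗ D R) ⊗ Z ⟶ (D R ⊗ D R) ⊗ Z :=
  lift (lift (fst _ _ ≫ fst _ _) (smulD (snd _ _ ≫ a) (fst _ _ ≫ snd _ _))) (snd _ _)

theorem comp_wedge_condition (s : Y ⟶ Wedge R) :
    ((s ≫ wedge₁) ≫ incl R) * ((s ≫ wedge₃) ≫ incl R) = 0 ∧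
      ((s ≫ wedge₂) ≫ incl R) * ((s ≫ wedge₃) ≫ incl R) = 0 := by
  simp only [Category.assoc, ← comp_mul', wedge_condition.1, wedge_condition.2, comp_zero',
    and_self]

/-- The map `(d_1, d_2, e) ↦ (a d_1, d_2, a e)` preserves `D² ∨ D` and is compatible with both
embeddings of `D²`, `e = d_1 d_2` and `e = 0`. -/
theorem IsStrongDiff.scaleFst {γ₁ γ₂ : (D R ⊗ D R) ⊗ Z ⟶ M} {t : D R ⊗ Z ⟶ M}
    (h : IsStrongDiff γ₁ γ₂ t) (a : Z ⟶ R) :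
    IsStrongDiff (scaleFst a ≫ γ₁) (SDG.scaleFst a ≫ γ₂) (Tan.scaleLine a ≫ t) := by
  obtain ⟨m, rfl, rfl, rfl⟩ := h
  refine ⟨lift (mkWedge (smulD (snd _ _ ≫ a) (fst _ _ ≫ wedge₁)) (fst _ _ ≫ wedge₂)
    (smulD (snd _ _ ≫ a) (fst _ _ ≫ wedge₃)) ?_ ?_) (snd _ _) ≫ m, ?_, ?_, ?_⟩
  · rw [smulD_incl, smulD_incl, mul_mul_mul_comm, (comp_wedge_condition _).1, mul_zero]
  · rw [smulD_incl, mul_left_comm, (comp_wedge_condition _).2, mul_zero]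
  all_goals
    rw [← Category.assoc, ← Category.assoc]
    congr 1
    apply CartesianMonoidalCategory.hom_ext
    · apply Wedge_hom_ext <;> apply D_hom_ext <;>
      simp [SDG.scaleFst, Tan.scaleLine, wedgeMul, wedgeZero, wedgeAxis, mkWedge_wedge₁,
        mkWedge_wedge₂, mkWedge_wedge₃, mul_assoc]
    · simp [SDG.scaleFst, Tan.scaleLine]

theorem IsStrongDiff.scaleSnd {γ₁ γ₂ : (D R ⊗ D R) ⊗ Z ⟶ M} {t : D R ⊗ Z ⟶ M}
    (h : IsStrongDiff γ₁ γ₂ t) (a : Z ⟶ R) :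
    IsStrongDiff (scaleSnd a ≫ γ₁) (SDG.scaleSnd a ≫ γ₂) (Tan.scaleLine a ≫ t) := by
  obtain ⟨m, rfl, rfl, rfl⟩ := h
  refine ⟨lift (mkWedge (fst _ _ ≫ wedge₁) (smulD (snd _ _ ≫ a) (fst _ _ ≫ wedge₂))
    (smulD (snd _ _ ≫ a) (fst _ _ ≫ wedge₃)) ?_ ?_) (snd _ _) ≫ m, ?_, ?_, ?_⟩
  · rw [smulD_incl, mul_left_comm, (comp_wedge_condition _).1, mul_zero]
  · rw [smulD_incl, smulD_incl, mul_mul_mul_comm, (comp_wedge_condition _).2, mul_zero]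
  all_goals
    rw [← Category.assoc, ← Category.assoc]
    congr 1
    apply CartesianMonoidalCategory.hom_ext
    · apply Wedge_hom_ext <;> apply D_hom_ext <;>
      simp [SDG.scaleSnd, Tan.scaleLine, wedgeMul, wedgeZero, wedgeAxis, mkWedge_wedge₁,
        mkWedge_wedge₂, mkWedge_wedge₃, mul_left_comm]
    · simp [SDG.scaleSnd, Tan.scaleLine]

theorem nest_scaleCube_inner {K : VMap R M X p} (L : S ⊗ (X ⊗ Cubes R M q) ⟶ M) (hK : IsHomog K)
    {ρ : Fin N → Fin p ⊕ Fin q} (hρ : Function.Injective ρ) {i : Fin N} {a : Fin p}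
    (hi : ρ i = .inl a) (x : Y ⟶ X) (s : Y ⟶ S) (d : Y ⟶ D R) (α : Y ⟶ R)
    (γ : Dpow R N ⊗ Y ⟶ M) :
    nest L K ρ x s d (scaleCube α i γ) = nest L K ρ x s (smulD α d) γ := by
  rw [nest, inner, slice_scaleCube_left hρ hi, hK, nest, inner, comp_smulD]

theorem nest_scaleCube_outer (K : T ⊗ (X ⊗ Cubes R M p) ⟶ M) {L : VMap R M X q} (hL : IsHomog L)
    {ρ : Fin N → Fin p ⊕ Fin q} (hρ : Function.Injective ρ) {i : Fin N} {a : Fin q}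
    (hi : ρ i = .inr a) (x : Y ⟶ X) (d : Y ⟶ D R) (t : Y ⟶ T) (α : Y ⟶ R)
    (γ : Dpow R N ⊗ Y ⟶ M) :
    nest L K ρ x d t (scaleCube α i γ) = nest L K ρ x (smulD α d) t γ := by
  rw [nest, scaleCube_inner _ _ _ hρ hi, hL, nest]

theorem whiskerLeft_curry_eq {θ : S ⊗ (X ⊗ Cubes R M n) ⟶ M} {f : S ⊗ Y ⟶ S ⊗ Y} {x : Y ⟶ X}
    {γ γ' : Dpow R n ⊗ Y ⟶ M} (hf : f ≫ snd S Y = snd S Y)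
    (h : pev θ (snd S Y ≫ x) (fst S Y) (Dpow R n ◁ snd S Y ≫ γ') =
      pev θ (snd S Y ≫ x) (f ≫ fst S Y) (Dpow R n ◁ snd S Y ≫ γ)) :
    S ◁ lift x (curry γ') ≫ θ = f ≫ S ◁ lift x (curry γ) ≫ θ := by
  rw [pev, pev, curry_natural_left, curry_natural_left, ← comp_lift, ← comp_lift] at h
  rw [whiskerLeft_eq_lift, h, whiskerLeft_eq_lift, comp_lift_assoc f, ← Category.assoc f, hf]

/-- In both convolutions the first parameter belongs to `K` and the second to `L`. Scaling an
argument given to `K` scales the first, an argument given to `L` the second, and either way the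
strong difference is scaled. -/
theorem isHomog_floor {ρ : Fin N → Fin p ⊕ Fin q} (hρ : Function.Injective ρ) {K : VTan hM X p}
    {L : VTan hM X q} (hK : IsHomog K.1) (hL : IsHomog L.1) : IsHomog (floor ρ K L).1 := by
  rw [isHomog_iff]
  intro Y x α γ i
  have hρ' : Function.Injective fun i => (ρ i).swap := Sum.swap_leftInverse.injective.comp hρ
  have h := isStrongDiff_floor ρ K L
  have h₁ := h.whiskerLeft (lift x (curry (scaleCube α i γ)))
  have h₂ := h.whiskerLeft (lift x (curry γ))
  rcases hi : ρ i with a | a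
  · have hi' : (ρ i).swap = .inr a := by rw [hi]; rfl
    refine h₁.unique hM ?_
    have h₃ := h₂.scaleFst α
    rw [← whiskerLeft_curry_eq (θ := convL L.1 K.1 ρ) (f := scaleFst α)
      (γ' := scaleCube α i γ) (by simp [scaleFst]), ← whiskerLeft_curry_eq
      (θ := convR K.1 L.1 fun i => (ρ i).swap) (f := scaleFst α)
      (γ' := scaleCube α i γ) (by simp [scaleFst])] at h₃
    · exact h₃
    · rw [pev_convR, pev_convR, whiskerLeft_scaleCube, nest_scaleCube_outer _ hK hρ' hi', scaleFst]
      simp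
    · rw [pev_convL, pev_convL, whiskerLeft_scaleCube, nest_scaleCube_inner _ hK hρ hi, scaleFst]
      simp
  · have hi' : (ρ i).swap = .inl a := by rw [hi]; rfl
    refine h₁.unique hM ?_
    have h₃ := h₂.scaleSnd α
    rw [← whiskerLeft_curry_eq (θ := convL L.1 K.1 ρ) (f := scaleSnd α)
      (γ' := scaleCube α i γ) (by simp [scaleSnd]), ← whiskerLeft_curry_eq
      (θ := convR K.1 L.1 fun i => (ρ i).swap) (f := scaleSnd α)
      (γ' := scaleCube α i γ) (by simp [scaleSnd])] at h₃
    · exact h₃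
    · rw [pev_convR, pev_convR, whiskerLeft_scaleCube, nest_scaleCube_inner _ hL hρ' hi', scaleSnd]
      simp
    · rw [pev_convL, pev_convL, whiskerLeft_scaleCube, nest_scaleCube_outer _ hL hρ hi, scaleSnd]
      simp

end

end SDG

namespace SDG

noncomputable section

/-! ### Signs of block permutations. -/

section Signs

open Equiv

theorem finRotate_pow_apply (n l : ℕ) [NeZero n] (i : Fin n) :
    (finRotate n ^ l) i = i + (Fin.ofNat n l) := by
  induction l with
  | zero => simp
  | succ l ih =>
    rw [pow_succ', Perm.mul_apply, ih, finRotate_apply]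
    ext
    simp [Fin.val_add, add_assoc]

/-- The interchange of two blocks, as a permutation. -/
def blockFlip (m n : ℕ) : Perm (Fin (m + n)) := finAddFlip.trans (finCongr (Nat.add_comm n m))

theorem val_blockFlip (m n : ℕ) (i : Fin (m + n)) :
    (blockFlip m n i : ℕ) = if (i : ℕ) < m then (i : ℕ) + n else i - m := by
  refine Fin.addCases (fun a => ?_) (fun a => ?_) i <;> simp [blockFlip, Nat.add_comm]

theorem blockFlip_eq_pow (m n : ℕ) : blockFlip m n = finRotate (m + n) ^ n := by
  rcases Nat.eq_zero_or_pos (m + n) with h | h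
  · ext i
    exact absurd i.2 (by omega)
  have : NeZero (m + n) := ⟨h.ne'⟩
  ext i
  rw [finRotate_pow_apply, val_blockFlip, Fin.val_add, Fin.val_ofNat, Nat.add_mod_mod]
  split_ifs with hi
  · rw [Nat.mod_eq_of_lt (by omega)]
  · rw [show (i : ℕ) + n = i - m + (m + n) by omega, Nat.add_mod_right,
      Nat.mod_eq_of_lt (by omega)]

/-- The interchange is the `n`-th power of the rotation of `m + n` elements, whose sign is
`(-1)^(m+n-1)`; in `n(m+n-1) = mn + n(n-1)` the last term is even. -/
theorem sign_blockFlip (m n : ℕ) : Perm.sign (blockFlip m n) = (-1) ^ (m * n) := by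
  rw [blockFlip_eq_pow, map_pow, sign_finRotate, ← pow_mul]
  rcases n with - | n
  · simp
  · have h : (m + (n + 1) - 1) * (n + 1) = m * (n + 1) + n * (n + 1) := by
      rw [← Nat.add_mul]; rfl
    rw [h, pow_add, (Nat.even_mul_succ_self n).neg_one_pow, mul_one]

variable (k : Type*) [Field k]

/-- The sign of a permutation, in `k`. -/
def sgn {n : ℕ} (σ : Perm (Fin n)) : k := ((Perm.sign σ : ℤˣ) : ℤ)

theorem sgn_mul {n : ℕ} (σ τ : Perm (Fin n)) : sgn k (σ * τ) = sgn k σ * sgn k τ := by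
  simp [sgn]

theorem sgn_mul_self {n : ℕ} (σ : Perm (Fin n)) : sgn k σ * sgn k σ = 1 := by
  rw [← sgn_mul, sgn, Perm.sign_mul, Int.units_mul_self]
  simp

theorem sgn_blockFlip (m n : ℕ) : sgn k (blockFlip m n) = (-1) ^ (m * n) := by
  simp [sgn, sign_blockFlip]

end Signs

/-! ### Alternation and the Frölicher-Nijenhuis bracket. -/

open MonoidalClosed WeilSpec

variable {C : Type u} [Category.{v} C] [CartesianMonoidalCategory C] [BraidedCategory C]
  [MonoidalClosed C] [HasFiniteLimits C] {R : C} [CommRingObj R] {M X : C} {m n p q r : ℕ}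
  {k : Type w} [Field k] [AlgObj k R] {hM : Microlinear k R M}

/-- The base point is built into `VTan`; what remains of being a form is homogeneity and a linear
condition. -/
theorem isForm_iff (K : VTan hM X n) : IsForm k K.1 ↔
    IsHomog K.1 ∧ ∀ σ : Equiv.Perm (Fin n), VTan.perm σ K = sgn k σ • K := by
  have key : ∀ (σ : Equiv.Perm (Fin n)) (Y : C) (x : Y ⟶ X) (s : Y ⟶ D R) (γ : Dpow R n ⊗ Y ⟶ M),
      pev (sgn k σ • K).1 x s γ = pev K.1 x (constSmulD (sgn k σ) s) γ := fun σ Y x s γ => by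
    rw [Tan.smul_val, tanSmul, pev_whiskerRight, comp_constSmulD, Category.comp_id]
  constructor
  · intro h
    refine ⟨h.homogeneous, fun σ => VTan.ext_pev fun Y x s γ => ?_⟩
    rw [VTan.pev_perm, key]
    exact h.alternating Y x s γ σ
  · rintro ⟨h, h'⟩
    refine ⟨fun Y x γ => K.pev_zero x γ, h, fun Y x d γ σ => ?_⟩
    have := key σ Y x d γ
    rw [← h', VTan.pev_perm] at this
    exact this

/-- The alternation. -/
def alt : VTan hM X n →ₗ[k] VTan hM X n := ∑ σ : Equiv.Perm (Fin n), sgn k σ • VTan.perm σ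

theorem alt_apply (K : VTan hM X n) :
    alt K = ∑ σ : Equiv.Perm (Fin n), sgn k σ • VTan.perm σ K := by
  simp [alt]

/-- Translation by `τ` in the symmetric group reindexes the sum, at the cost of the sign of `τ`;
`perm_alt` uses the translation on the other side. -/
theorem alt_perm (τ : Equiv.Perm (Fin n)) (K : VTan hM X n) :
    alt (VTan.perm τ K) = sgn k τ • alt K := by
  rw [alt_apply, alt_apply, Finset.smul_sum]
  refine Fintype.sum_equiv (Equiv.mulLeft τ) _ _ fun σ => ?_
  rw [VTan.perm_perm, Equiv.coe_mulLeft, sgn_mul, smul_smul, ← mul_assoc, sgn_mul_self, one_mul]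
  rfl

theorem perm_alt (τ : Equiv.Perm (Fin n)) (K : VTan hM X n) :
    VTan.perm τ (alt K) = sgn k τ • alt K := by
  rw [alt_apply, map_sum, Finset.smul_sum]
  refine Fintype.sum_equiv (Equiv.mulRight τ) _ _ fun σ => ?_
  rw [map_smul, VTan.perm_perm, Equiv.coe_mulRight, sgn_mul, smul_smul, mul_comm (sgn k σ),
    ← mul_assoc, sgn_mul_self, one_mul]
  rfl

/-- Transport along an equality of degrees. -/
def VTan.cast (h : m = n) : VTan hM X m →ₗ[k] VTan hM X n := VTan.perm (Fin.cast h.symm)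

theorem VTan.cast_val (h : m = n) (K : VTan hM X m) : (VTan.cast h K).1 = VMap.recast h K.1 := by
  subst h
  exact congrArg Tan.val (VTan.perm_id K)

theorem alt_cast (h : m = n) (K : VTan hM X m) : alt (VTan.cast h K) = VTan.cast h (alt K) := by
  subst h
  exact (congrArg alt (VTan.perm_id K)).trans (VTan.perm_id (alt K)).symm

theorem altTerm_eq (T : VTan hM X n) (σ : Equiv.Perm (Fin n)) :
    altTerm k T.1 σ = (sgn k σ • VTan.perm σ T).1 := by
  rw [Tan.smul_val]
  rfl

theorem isTanSum_altTerm_iff (T : VTan hM X n) (s : VMap R M X n) :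
    IsTanSum (altTerm k T.1) s ↔ s = (alt T).1 := by
  rw [alt_apply, ← Tan.isTanSum_iff]
  simp only [← altTerm_eq]

theorem alternate_val (T : VTan hM X n) : alternate k T.1 = (alt T).1 := by
  have h : ∃ s, IsTanSum (altTerm k T.1) s := ⟨_, (isTanSum_altTerm_iff T _).2 rfl⟩
  rw [alternate, tanSum, dif_pos h, ← isTanSum_altTerm_iff]
  exact h.choose_spec

theorem isStrongDiff_conv_iff (K : VTan hM X p) (L : VTan hM X q) (t : VMap R M X (p + q)) :
    IsStrongDiff (conv L.1 K.1) (convTilde K.1 L.1) t ↔ t = (floor finSumFinEquiv.symm K L).1 := by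
  rw [conv_eq_convL, convTilde_eq_convR]
  constructor
  · exact eq_floor
  · rintro rfl
    exact isStrongDiff_floor _ _ _

theorem floorBracket_val (K : VTan hM X p) (L : VTan hM X q) :
    floorBracket K.1 L.1 = (floor finSumFinEquiv.symm K L).1 := by
  have h : ∃ t, IsStrongDiff (conv L.1 K.1) (convTilde K.1 L.1) t :=
    ⟨_, (isStrongDiff_conv_iff K L _).2 rfl⟩
  rw [floorBracket, strongDiff, dif_pos h, ← isStrongDiff_conv_iff]
  exact h.choose_spec

/-- The Frölicher-Nijenhuis bracket of mappings `K` and `L` with `K_0(γ) = L_0(γ) = γ(0)`. -/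
def fn (K : VTan hM X p) (L : VTan hM X q) : VTan hM X (p + q) :=
  (p ! * q ! : k)⁻¹ • alt (floor finSumFinEquiv.symm K L)

theorem fnBracket_val (K : VTan hM X p) (L : VTan hM X q) : fnBracket k K.1 L.1 = (fn K L).1 := by
  rw [fn, Tan.smul_val, ← alternate_val, ← floorBracket_val]
  rfl

theorem isForm_fn {K : VTan hM X p} {L : VTan hM X q} (hK : IsForm k K.1) (hL : IsForm k L.1) :
    IsForm k (fn K L).1 := by
  rw [isForm_iff] at *
  refine ⟨isHomog_smul ?_ _, fun σ => ?_⟩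
  · rw [alt_apply]
    refine isHomog_sum (fun σ => ?_) _
    rw [perm_floor]
    exact isHomog_floor (finSumFinEquiv.symm.injective.comp σ.injective) hK.1 hL.1
  · rw [fn, map_smul, perm_alt, smul_comm]

/-- The standard distributions for `(p, q)` and `(q, p)` differ by `blockFlip` and a swap of the
summands; the swap contributes the minus sign. -/
theorem floor_finAddFlip (K : VTan hM X p) (L : VTan hM X q) :
    floor finSumFinEquiv.symm K L =
      -VTan.perm (blockFlip p q) (VTan.cast (Nat.add_comm q p) (floor finSumFinEquiv.symm L K)) := by
  rw [VTan.cast, VTan.perm_perm, perm_floor, ← floor_swap]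
  congr 1
  funext i
  simp [blockFlip, finAddFlip]

theorem fn_antisymm (K : VTan hM X p) (L : VTan hM X q) :
    fn K L = (-(-1) ^ (p * q) : k) • VTan.cast (Nat.add_comm q p) (fn L K) := by
  rw [fn, floor_finAddFlip, map_neg, alt_perm, alt_cast, sgn_blockFlip, fn, map_smul, smul_neg,
    neg_smul, smul_comm, mul_comm (p ! : k)]

/-- Permuting the arguments of the second form permutes the arguments of the whole cube within the
block that `ρ` gives to it. -/
theorem floor_perm_right (ρ : Fin m ≃ Fin p ⊕ Fin q) (σ : Equiv.Perm (Fin q)) (K : VTan hM X p)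
    (T : VTan hM X q) : floor ρ K (VTan.perm σ T) =
      VTan.perm (ρ.symm.permCongr (Equiv.sumCongr (Equiv.refl _) σ)) (floor ρ K T) := by
  conv_lhs => rw [← VTan.perm_id K]
  rw [floor_perm, perm_floor]
  congr 1
  funext i
  rw [Equiv.permCongr_apply, Equiv.apply_symm_apply]
  rcases h : ρ i with a | a <;> simp [h]

theorem sgn_permCongr_sumCongr (ρ : Fin m ≃ Fin p ⊕ Fin q) (σ : Equiv.Perm (Fin q)) :
    sgn k (ρ.symm.permCongr (Equiv.sumCongr (Equiv.refl _) σ)) = sgn k σ := by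
  rw [sgn, Equiv.Perm.sign_permCongr, sgn]
  have := Equiv.Perm.sign_sumCongr (Equiv.refl (Fin p)) σ
  rw [Equiv.Perm.sumCongr] at this
  rw [this]
  simp

/-- Each of the `q!` terms of the inner alternation contributes the same: the outer alternation
turns its permutation into a sign that cancels the sign already there. -/
theorem alt_floor_smul_alt (ρ : Fin m ≃ Fin p ⊕ Fin q) (c : k) (K : VTan hM X p)
    (T : VTan hM X q) : alt (floor ρ K (c • alt T)) = (c * q !) • alt (floor ρ K T) := by
  rw [alt_apply T, Finset.smul_sum]
  simp only [smul_smul]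
  rw [floor_sum, map_sum]
  simp only [map_smul, floor_perm_right, alt_perm, sgn_permCongr_sumCongr, smul_smul, mul_assoc,
    sgn_mul_self, mul_one]
  rw [Finset.sum_const, Finset.card_univ, Fintype.card_perm, Fintype.card_fin,
    ← Nat.cast_smul_eq_nsmul k, smul_smul, mul_comm]

/-- The factor `(q+r)!` from the inner alternation cancels the one in the normalisation of the outer
bracket, leaving a constant symmetric in the three degrees. -/
theorem fn_fn [CharZero k] (K₁ : VTan hM X p) (K₂ : VTan hM X q) (K₃ : VTan hM X r) :
    fn K₁ (fn K₂ K₃) = (p ! * q ! * r ! : k)⁻¹ •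
      alt (floor finSumFinEquiv.symm K₁ (floor finSumFinEquiv.symm K₂ K₃)) := by
  rw [fn, fn, alt_floor_smul_alt, smul_smul]
  congr 1
  have h₁ : ((q + r)! : k) ≠ 0 := Nat.cast_ne_zero.2 (Nat.factorial_ne_zero _)
  have h₂ : (p ! : k) ≠ 0 := Nat.cast_ne_zero.2 (Nat.factorial_ne_zero _)
  have h₃ : (q ! : k) ≠ 0 := Nat.cast_ne_zero.2 (Nat.factorial_ne_zero _)
  have h₄ : (r ! : k) ≠ 0 := Nat.cast_ne_zero.2 (Nat.factorial_ne_zero _)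
  field_simp

/-- The interchange of the last block with the two others, as a permutation. -/
def lastFlip (p q r : ℕ) : Equiv.Perm (Fin (p + (q + r))) :=
  (finCongr (Nat.add_assoc p q r)).permCongr (blockFlip (p + q) r)

theorem sgn_lastFlip (p q r : ℕ) : sgn k (lastFlip p q r) = (-1) ^ (r * (p + q)) := by
  rw [lastFlip, sgn, Equiv.Perm.sign_permCongr, mul_comm, ← sgn_blockFlip, sgn]

theorem floor_jacobi_fin (K₁ : VTan hM X p) (K₂ : VTan hM X q) (K₃ : VTan hM X r)
    (e₁ : q + (r + p) = p + (q + r)) (e₂ : r + (p + q) = p + (q + r)) :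
    floor finSumFinEquiv.symm K₁ (floor finSumFinEquiv.symm K₂ K₃) +
      VTan.perm (blockFlip p (q + r)) (VTan.cast e₁
        (floor finSumFinEquiv.symm K₂ (floor finSumFinEquiv.symm K₃ K₁))) +
      VTan.perm (lastFlip p q r) (VTan.cast e₂
        (floor finSumFinEquiv.symm K₃ (floor finSumFinEquiv.symm K₁ K₂))) = 0 := by
  rw [VTan.cast, VTan.perm_perm, perm_floor, VTan.cast, VTan.perm_perm, perm_floor]
  -- An index is given by its place `x` in one of three blocks, which reduces the two compatibility
  -- conditions to arithmetic of positions.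
  have e : ∀ {a b c : ℕ} (x : Fin a ⊕ (Fin b ⊕ Fin c)) (j : Fin (a + (b + c))),
      j = finSumFinEquiv (Sum.map id finSumFinEquiv x) →
      Sum.map id finSumFinEquiv.symm (finSumFinEquiv.symm j) = x := by
    rintro a b c (x | x) j rfl <;> simp
  have e' : ∀ i : Fin (p + (q + r)), ∃ x : Fin p ⊕ (Fin q ⊕ Fin r),
      i = finSumFinEquiv (Sum.map id finSumFinEquiv x) := fun i =>
    ⟨Sum.map id finSumFinEquiv.symm (finSumFinEquiv.symm i), by
      rcases h : finSumFinEquiv.symm i with a | a <;> simp [← h]⟩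
  have h₁ : ∀ i, Sum.map id finSumFinEquiv.symm (finSumFinEquiv.symm
      (Fin.cast e₁.symm (blockFlip p (q + r) i))) =
      (cycleSum (Sum.map id finSumFinEquiv.symm (finSumFinEquiv.symm i)) :
        Fin q ⊕ (Fin r ⊕ Fin p)) := fun i => by
    obtain ⟨x, rfl⟩ := e' i
    rw [e x _ rfl]
    refine e _ _ (Fin.ext ?_)
    rcases x with a | b | c <;> simp [blockFlip, cycleSum] <;> omega
  refine floor_jacobi h₁ fun i => ?_
  rw [h₁ i]
  obtain ⟨x, rfl⟩ := e' i
  rw [e x _ rfl]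
  refine e _ _ (Fin.ext ?_)
  rcases x with a | b | c <;> simp [lastFlip, val_blockFlip, cycleSum] <;> (try split_ifs) <;> omega

/-- Apply the alternation to `floor_jacobi_fin`: the two block permutations become the signs, and
the three normalising constants coincide up to the order of factors. -/
theorem fn_jacobi [CharZero k] (K₁ : VTan hM X p) (K₂ : VTan hM X q) (K₃ : VTan hM X r)
    (e₁ : q + (r + p) = p + (q + r)) (e₂ : r + (p + q) = p + (q + r)) :
    fn K₁ (fn K₂ K₃) +
      ((-1) ^ (p * (q + r)) : k) • VTan.cast e₁ (fn K₂ (fn K₃ K₁)) +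
      ((-1) ^ (r * (p + q)) : k) • VTan.cast e₂ (fn K₃ (fn K₁ K₂)) = 0 := by
  have h := congrArg (fun T => (p ! * q ! * r ! : k)⁻¹ • alt T) (floor_jacobi_fin K₁ K₂ K₃ e₁ e₂)
  simp only [map_add, alt_perm, alt_cast, sgn_blockFlip, sgn_lastFlip, map_zero, smul_zero,
    smul_add] at h
  rw [fn_fn, fn_fn, fn_fn, map_smul, map_smul, ← h]
  congr 1
  · congr 1
    rw [smul_comm, show (q ! * (r !) * (p !) : k) = p ! * (q !) * (r !) by ring]
  · rw [smul_comm, show (r ! * (p !) * (q !) : k) = p ! * (q !) * (r !) by ring]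

/-- A form, as a mapping `K` with `K_0(γ) = γ(0)`. -/
def IsForm.toVTan {K : VMap R M X n} (hK : IsForm k K) (hM : Microlinear k R M) : VTan hM X n :=
  ⟨K, (tanBase_eq_cubeBase_iff K).2 hK.base⟩

end

end SDG

/-- Graded antisymmetry and graded Jacobi identity of the Frölicher-Nijenhuis bracket. -/
theorem theorem4p4 {k : Type w} [Field k] [CharZero k] {C : Type u} [Category.{v} C]
    [CartesianMonoidalCategory C] [BraidedCategory C] [MonoidalClosed C] [HasFiniteLimits C]
    (R : C) [CommRingObj R] [SDG.AlgObj k R] (hR : SDG.KockLawvere k R)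
    (M : C) (hM : SDG.Microlinear k R M) (X : C) :
    -- the bracket of two forms is well defined, and it is a form
    (∀ (p q : ℕ) (K : SDG.VMap R M X p) (L : SDG.VMap R M X q),
      SDG.IsForm k K → SDG.IsForm k L →
        (∃! t, SDG.IsStrongDiff (SDG.conv L K) (SDG.convTilde K L) t) ∧
        (∃! s, SDG.IsTanSum (SDG.altTerm k (SDG.floorBracket K L)) s) ∧
        SDG.IsForm k (SDG.fnBracket k K L)) ∧
    -- graded antisymmetry
    (∀ (p q : ℕ) (K : SDG.VMap R M X p) (L : SDG.VMap R M X q),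
      SDG.IsForm k K → SDG.IsForm k L →
        SDG.fnBracket k K L =
          SDG.tanSmul (-(-1) ^ (p * q) : k)
            ((SDG.fnBracket k L K).recast (Nat.add_comm q p))) ∧
    -- graded Jacobi identity: the three terms have exactly one sum, and it is zero
    (∀ (p q r : ℕ) (K₁ : SDG.VMap R M X p) (K₂ : SDG.VMap R M X q) (K₃ : SDG.VMap R M X r),
      SDG.IsForm k K₁ → SDG.IsForm k K₂ → SDG.IsForm k K₃ →
        ∀ s, SDG.IsTanSum
          ![SDG.fnBracket k K₁ (SDG.fnBracket k K₂ K₃),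
            SDG.tanSmul ((-1) ^ (p * (q + r)) : k)
              ((SDG.fnBracket k K₂ (SDG.fnBracket k K₃ K₁)).recast (by omega)),
            SDG.tanSmul ((-1) ^ (r * (p + q)) : k)
              ((SDG.fnBracket k K₃ (SDG.fnBracket k K₁ K₂)).recast (by omega))]
          s ↔ s = SDG.zeroForm R M X (p + (q + r))) := by
  refine ⟨fun p q K L hK hL => ?_, fun p q K L hK hL => ?_, fun p q r K₁ K₂ K₃ h₁ h₂ h₃ s => ?_⟩
  · refine ⟨⟨_, (SDG.isStrongDiff_conv_iff (hK.toVTan hM) (hL.toVTan hM) _).2 rfl,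
      fun t => (SDG.isStrongDiff_conv_iff (hK.toVTan hM) (hL.toVTan hM) t).1⟩, ?_, ?_⟩
    · have h := SDG.floorBracket_val (hK.toVTan hM) (hL.toVTan hM)
      change SDG.floorBracket K L = _ at h
      rw [h]
      exact ⟨_, (SDG.isTanSum_altTerm_iff _ _).2 rfl, fun t => (SDG.isTanSum_altTerm_iff _ t).1⟩
    · have h := SDG.fnBracket_val (hK.toVTan hM) (hL.toVTan hM)
      change SDG.fnBracket k K L = _ at h
      rw [h]
      exact SDG.isForm_fn hK hL
  · have h := congrArg SDG.Tan.val (SDG.fn_antisymm (hK.toVTan hM) (hL.toVTan hM))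
    rwa [SDG.Tan.smul_val, SDG.VTan.cast_val, ← SDG.fnBracket_val, ← SDG.fnBracket_val] at h
  · have h := SDG.fn_jacobi (h₁.toVTan hM) (h₂.toVTan hM) (h₃.toVTan hM) (by omega) (by omega)
    -- At a common base point `IsTanSum` describes addition in the module `VTan`, whose zero is
    -- `zeroForm`.
    have e : ∀ A B E : SDG.VTan (k := k) hM X (p + (q + r)), A + B + E = 0 →
        (SDG.IsTanSum ![A.1, B.1, E.1] s ↔ s = SDG.zeroForm R M X (p + (q + r))) :=
      fun A B E h => by
        have := SDG.Tan.isTanSum_iff (k := k) ![A, B, E] s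
        rw [Fin.sum_univ_three] at this
        change _ ↔ s = (A + B + E).1 at this
        rw [h, SDG.Tan.zero_val, ← SDG.zeroForm_eq] at this
        rw [← this]
        congr! 1
        funext i
        fin_cases i <;> rfl
    have := e _ _ _ h
    rwa [SDG.Tan.smul_val, SDG.Tan.smul_val, SDG.VTan.cast_val, SDG.VTan.cast_val,
      ← SDG.fnBracket_val, ← SDG.fnBracket_val, ← SDG.fnBracket_val, ← SDG.fnBracket_val,
      ← SDG.fnBracket_val, ← SDG.fnBracket_val] at this
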